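/- Let $a>0$, let $q$ be a real $a$-periodic function with $q\in L_1(0,a)$, let $c,\omega,\delta\in\mathbb R$ and $\gamma\in(\tfrac12,1]$. Solutions of $-\psi''+q\psi=z\psi$ are understood in the Carathéodory sense. Let $D(z)$ be the monodromy matrix of this equation over $[0,a]$, and let $\lambda_n$, $\mu_n$ ($n\ge 0$) be the eigenvalues of the periodic and antiperiodic problems on $[0,a]$ ($\lambda_0$ the lowest periodic one). The spectrum of $\mathcal L_{per}=-\frac{d^2}{dx^2}+q$ on $\mathbb R$ is the union of its closed bands, $\sigma(\mathcal L_{per})=\{\lambda\in\mathbb R:|\operatorname{tr}D(\lambda)|\le 2\}$. Let $k$ be the quasi-momentum: the function that is continuous on $\overline{\mathbb C_+}$, analytic in $\mathbb C_+$ with $\operatorname{Im}k>0$ there, and satisfies $e^{ik(z)}+e^{-ik(z)}=\operatorname{tr}D(z)$ on $\overline{\mathbb C_+}$ and $k(\lambda_0)=0$. The critical points $\lambda_n^{\pm}\in\sigma(\mathcal L_{per})$, $n\ge0$, are given by $$k(\lambda_n^+)=\pi\Big(n+1-\Big\{\frac{a\omega}{\pi}\Big\}\Big),\qquad k(\lambda_n^-)=\pi\Big(n+\Big\{\frac{a\omega}{\pi}\Big\}\Big),$$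 where $\{\cdot\}$ is the fractional part. Put $$\varepsilon(z)=\frac12\min_{n\in\mathbb Z}\Big\{\Big|\frac{2k(z)}a+2\omega+\frac{2\pi n}a\Big|,\Big|\frac{2k(z)}a-2\omega+\frac{2\pi n}a\Big|\Big\},$$ and, for $\beta>0$ and $\mu\in\sigma(\mathcal L_{per})\setminus\{\lambda_n,\mu_n,\lambda_n^+,\lambda_n^-:n\ge0\}$, $$U(\beta,\mu)=\Big\{\lambda\in\overline{\mathbb C_+}:\ 2\varepsilon(\lambda)\ge\varepsilon(\mu),\ 0\le\operatorname{Im}\frac{2k(\lambda)}a\le1,\ |\operatorname{Re}k(\lambda)-k(\mu)|\le\beta\operatorname{Im}k(\lambda)\Big\}.$$ Fix such $\beta$, $\mu$. Let $\psi_\pm(x,\lambda)$ be Bloch solutions, $\psi_\pm(x+a,\lambda)=e^{\pm ik(\lambda)}\psi_\pm(x,\lambda)$, for $\lambda\in\Omega:=\mathbb C_+\cup(\sigma(\mathcal L_{per})\setminus\{\lambda_n,\mu_n\})\cup U(\beta,\mu)$, such that: for every $x\ge0$ the functions $\psi_\pm(x,\cdot)$, and the Wronskian $W(\lambda)=\psi_+'\psi_--\psi_+\psi_-'$,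 are analytic in $\mathbb C_+$ and continuous on $\Omega$; $W$ has no zeros in $\Omega$; and $\psi_+=\overline{\psi_-}$, $W\in i(0,\infty)$ for $\lambda\in\sigma(\mathcal L_{per})\setminus\{\lambda_n,\mu_n\}$. Let $p_\pm(x,\lambda)=e^{\mp ik(\lambda)x/a}\psi_\pm(x,\lambda)$, and let $Q(x,\lambda,\mu)$ be the $2\times2$ matrix with zero diagonal and $$Q_{12}=\frac{c}{W(\lambda)}\,e^{-2ik(\lambda)\frac xa}\int_x^\infty\frac{\sin(2\omega t+\delta)\,p_+^2(t,\lambda)\,e^{2ik(\lambda)\frac ta}}{(t+1)^\gamma}\,dt,$$ $$Q_{21}=\frac{c}{W(\lambda)}\,e^{2ik(\lambda)\frac xa}\Big(\int_0^x\frac{\sin(2\omega t+\delta)\,p_-^2(t,\lambda)\,e^{-2ik(\lambda)\frac ta}}{(t+1)^\gamma}\,dt-\int_0^\infty\frac{\sin(2\omega t+\delta)\,p_-^2(t,\lambda)\,e^{-2ik(\mu)\frac ta}}{(t+1)^\gamma}\,dt\Big).$$ Then there is a constant $c_1(\beta,\mu,\gamma)$ (for the given $q,a,c,\omega,\delta$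 and $\psi_\pm$) such that for every $x\ge0$ and every $\lambda\in U(\beta,\mu)$ the improper integrals above converge, $Q(\cdot,\lambda,\mu)$ is differentiable on $[0,\infty)$ (one-sidedly at $0$), and $$\|Q(x,\lambda,\mu)\|<\frac{c_1(\beta,\mu,\gamma)}{(x+1)^\gamma},\qquad\|Q'(x,\lambda,\mu)\|<\frac{c_1(\beta,\mu,\gamma)}{(x+1)^\gamma},$$ where $'$ is the derivative in $x$ and $\|\cdot\|$ is the Frobenius norm. -/

import Mathlib

open Set Filter Topology MeasureTheory
open scoped Matrix.Norms.Frobenius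

namespace Hill

noncomputable section

/-- `y` solves `-y'' + q y = z y` on the whole line in the sense of Caratheodory: `y` is
differentiable and `y'` is the (locally absolutely continuous) primitive of `(q - z) y`. -/
def IsSolution (q : ℝ → ℝ) (z : ℂ) (y : ℝ → ℂ) : Prop :=
  Differentiable ℝ y ∧
    ∀ x : ℝ, deriv y x = deriv y 0 + ∫ t in (0 : ℝ)..x, ((q t : ℂ) - z) * y t

/-- The solution of `-y'' + q y = z y` with Cauchy data `y(0) = y₀`, `y'(0) = y₁`
(it exists and is unique when `q` is locally integrable). -/
def cauchySolution (q : ℝ → ℝ) (z y₀ y₁ : ℂ) : ℝ → ℂ :=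
  Classical.epsilon fun y => IsSolution q z y ∧ y 0 = y₀ ∧ deriv y 0 = y₁

/-- The monodromy matrix `D(z)`: it maps `(y(0), y'(0))` to `(y(a), y'(a))`. -/
def monodromy (q : ℝ → ℝ) (a : ℝ) (z : ℂ) : Matrix (Fin 2) (Fin 2) ℂ :=
  !![cauchySolution q z 1 0 a, cauchySolution q z 0 1 a;
     deriv (cauchySolution q z 1 0) a, deriv (cauchySolution q z 0 1) a]

/-- The discriminant `tr D(z)`. -/
def discriminant (q : ℝ → ℝ) (a : ℝ) (z : ℂ) : ℂ := (monodromy q a z).trace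

/-- The set `{λ_n : n ≥ 0}` of eigenvalues of the periodic problem on `[0, a]`. -/
def periodicEigenvalues (q : ℝ → ℝ) (a : ℝ) : Set ℝ :=
  {l | ∃ y : ℝ → ℂ, IsSolution q l y ∧ y ≠ 0 ∧ y a = y 0 ∧ deriv y a = deriv y 0}

/-- The set `{μ_n : n ≥ 0}` of eigenvalues of the antiperiodic problem on `[0, a]`. -/
def antiperiodicEigenvalues (q : ℝ → ℝ) (a : ℝ) : Set ℝ :=
  {l | ∃ y : ℝ → ℂ, IsSolution q l y ∧ y ≠ 0 ∧ y a = -y 0 ∧ deriv y a = -deriv y 0}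

/-- The set of all band edges `λ_n`, `μ_n`. -/
def bandEdges (q : ℝ → ℝ) (a : ℝ) : Set ℝ :=
  periodicEigenvalues q a ∪ antiperiodicEigenvalues q a

/-- The spectrum of the periodic operator on the line, i.e. the union of its closed bands: the
real `l` at which the discriminant lies in `[-2, 2]`. -/
def bands (q : ℝ → ℝ) (a : ℝ) : Set ℝ :=
  {l | ∃ d : ℝ, discriminant q a l = d ∧ |d| ≤ 2}

/-- `k` is the quasi-momentum, the branch of `-i ln ((tr D + √(tr² D - 4)) / 2)` on the closed
upper half-plane that is continuous, analytic in the open half-plane with values there in the open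
upper half-plane, and vanishes at the lowest periodic eigenvalue `λ_0`.
(`e^{ik}` is a root of `w² - (tr D) w + 1` iff `e^{ik} + e^{-ik} = tr D`.) -/
structure IsQuasimomentum (q : ℝ → ℝ) (a : ℝ) (k : ℂ → ℂ) : Prop where
  continuousOn : ContinuousOn k {z | 0 ≤ z.im}
  differentiableOn : DifferentiableOn ℂ k {z | 0 < z.im}
  exp_add_exp : ∀ z : ℂ, 0 ≤ z.im →
    Complex.exp (Complex.I * k z) + Complex.exp (-(Complex.I * k z)) = discriminant q a z
  im_pos : ∀ z : ℂ, 0 < z.im → 0 < (k z).im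
  lowest : ∃ l₀ : ℝ, IsLeast (periodicEigenvalues q a) l₀ ∧ k l₀ = 0

/-- The critical points `λ_n^+`, `λ_n^-` of the bands. -/
def criticalPoints (q : ℝ → ℝ) (a ω : ℝ) (k : ℂ → ℂ) : Set ℝ :=
  {l | l ∈ bands q a ∧ ∃ n : ℕ,
    k l = ((Real.pi * (n + 1 - Int.fract (a * ω / Real.pi)) : ℝ) : ℂ) ∨
    k l = ((Real.pi * (n + Int.fract (a * ω / Real.pi)) : ℝ) : ℂ)}

/-- `ε(z) = ½ min_n {|2k(z)/a + 2ω + 2πn/a|, |2k(z)/a - 2ω + 2πn/a|}`. -/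
def eps (a ω : ℝ) (k : ℂ → ℂ) (z : ℂ) : ℝ :=
  (1 / 2) * ⨅ n : ℤ,
    min ‖2 * k z / a + 2 * ω + 2 * Real.pi * n / a‖ ‖2 * k z / a - 2 * ω + 2 * Real.pi * n / a‖

/-- The set `U(β, μ)`. -/
def sector (a ω : ℝ) (k : ℂ → ℂ) (β μ : ℝ) : Set ℂ :=
  {z | 0 ≤ z.im ∧ eps a ω k μ ≤ 2 * eps a ω k z ∧
    0 ≤ (2 * k z / a).im ∧ (2 * k z / a).im ≤ 1 ∧
    |(k z).re - (k μ).re| ≤ β * (k z).im}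

/-- The Wronskian `W(ψ₊, ψ₋) = ψ₊' ψ₋ - ψ₊ ψ₋'` (independent of `x`, taken at `x = 0`). -/
def wronskian (ψp ψm : ℝ → ℂ → ℂ) (z : ℂ) : ℂ :=
  deriv (fun x => ψp x z) 0 * ψm 0 z - ψp 0 z * deriv (fun x => ψm x z) 0

/-- The open upper half-plane, the bands without their edges, and a further set `S`. -/
def blochDomain (q : ℝ → ℝ) (a : ℝ) (S : Set ℂ) : Set ℂ :=
  {z | 0 < z.im} ∪ Complex.ofReal '' (bands q a \ bandEdges q a) ∪ S

/-- `ψp`, `ψm` are Bloch solutions `ψ₊(x, z)`, `ψ₋(x, z)`, normalized in the usual way: they are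
solutions with Floquet multipliers `e^{± i k(z)}`; they and their Wronskian are analytic in the open
upper half-plane and continuous on `blochDomain q a S`; the Wronskian has no zeros there; inside the
bands `ψ₊` is the conjugate of `ψ₋` and the Wronskian is in `i (0, ∞)`. The set `S` is a set of
points of the closed upper half-plane that may contain points of open spectral gaps. -/
structure IsBlochPair (q : ℝ → ℝ) (a : ℝ) (k : ℂ → ℂ) (S : Set ℂ) (ψp ψm : ℝ → ℂ → ℂ) : Prop where
  solution_p : ∀ z ∈ blochDomain q a S,
    IsSolution q z (fun x => ψp x z)
  solution_m : ∀ z ∈ blochDomain q a S,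
    IsSolution q z (fun x => ψm x z)
  floquet_p : ∀ z ∈ blochDomain q a S,
    ∀ x : ℝ, ψp (x + a) z = Complex.exp (Complex.I * k z) * ψp x z
  floquet_m : ∀ z ∈ blochDomain q a S,
    ∀ x : ℝ, ψm (x + a) z = Complex.exp (-(Complex.I * k z)) * ψm x z
  analytic_p : ∀ x : ℝ, 0 ≤ x → DifferentiableOn ℂ (ψp x) {z | 0 < z.im}
  analytic_m : ∀ x : ℝ, 0 ≤ x → DifferentiableOn ℂ (ψm x) {z | 0 < z.im}
  analytic_wronskian : DifferentiableOn ℂ (wronskian ψp ψm) {z | 0 < z.im}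
  continuous_p : ∀ x : ℝ, 0 ≤ x → ContinuousOn (ψp x) (blochDomain q a S)
  continuous_m : ∀ x : ℝ, 0 ≤ x → ContinuousOn (ψm x) (blochDomain q a S)
  continuous_wronskian : ContinuousOn (wronskian ψp ψm) (blochDomain q a S)
  wronskian_ne_zero :
    ∀ z ∈ blochDomain q a S,
      wronskian ψp ψm z ≠ 0
  conj_eq : ∀ l ∈ bands q a \ bandEdges q a, ∀ x : ℝ,
    ψp x (l : ℂ) = (starRingEnd ℂ) (ψm x (l : ℂ))
  wronskian_re : ∀ l ∈ bands q a \ bandEdges q a, (wronskian ψp ψm (l : ℂ)).re = 0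
  wronskian_im : ∀ l ∈ bands q a \ bandEdges q a, 0 < (wronskian ψp ψm (l : ℂ)).im

/-- The periodic factor `p₊(x, z) = e^{-i k(z) x / a} ψ₊(x, z)`. -/
def periodicPartP (a : ℝ) (k : ℂ → ℂ) (ψp : ℝ → ℂ → ℂ) (x : ℝ) (z : ℂ) : ℂ :=
  Complex.exp (-(Complex.I * k z * x / a)) * ψp x z

/-- The periodic factor `p₋(x, z) = e^{i k(z) x / a} ψ₋(x, z)`. -/
def periodicPartM (a : ℝ) (k : ℂ → ℂ) (ψm : ℝ → ℂ → ℂ) (x : ℝ) (z : ℂ) : ℂ :=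
  Complex.exp (Complex.I * k z * x / a) * ψm x z

/-- `sin(2ωt + δ) p₊²(t, z) e^{2 i k(z) t / a} / (t + 1)^γ`. -/
def integrandP (a ω δ γ : ℝ) (k : ℂ → ℂ) (ψp : ℝ → ℂ → ℂ) (z : ℂ) (t : ℝ) : ℂ :=
  ((Real.sin (2 * ω * t + δ) / (t + 1) ^ γ : ℝ) : ℂ) * periodicPartP a k ψp t z ^ 2 *
    Complex.exp (2 * Complex.I * k z * t / a)

/-- `sin(2ωt + δ) p₋²(t, z) e^{-2 i k(w) t / a} / (t + 1)^γ`. -/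
def integrandM (a ω δ γ : ℝ) (k : ℂ → ℂ) (ψm : ℝ → ℂ → ℂ) (z w : ℂ) (t : ℝ) : ℂ :=
  ((Real.sin (2 * ω * t + δ) / (t + 1) ^ γ : ℝ) : ℂ) * periodicPartM a k ψm t z ^ 2 *
    Complex.exp (-(2 * Complex.I * k w * t / a))

/-- The (possibly conditionally) convergent improper integral of `f` over `[x, ∞)` exists. -/
def ImproperConverges (f : ℝ → ℂ) (x : ℝ) : Prop :=
  ∃ L : ℂ, Tendsto (fun X : ℝ => ∫ t in x..X, f t) atTop (𝓝 L)

/-- The improper integral of `f` over `[x, ∞)`. -/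
def improperIntegral (f : ℝ → ℂ) (x : ℝ) : ℂ :=
  limUnder atTop fun X : ℝ => ∫ t in x..X, f t

/-- The transformation matrix `Q(x, z, μ)`. -/
def Q (a c ω δ γ : ℝ) (k : ℂ → ℂ) (ψp ψm : ℝ → ℂ → ℂ) (x : ℝ) (z : ℂ) (μ : ℝ) :
    Matrix (Fin 2) (Fin 2) ℂ :=
  ((c : ℂ) / wronskian ψp ψm z) •
    !![0,
       Complex.exp (-(2 * Complex.I * k z * x / a)) *
         improperIntegral (integrandP a ω δ γ k ψp z) x;
       Complex.exp (2 * Complex.I * k z * x / a) *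
         ((∫ t in (0 : ℝ)..x, integrandM a ω δ γ k ψm z z t) -
           improperIntegral (integrandM a ω δ γ k ψm z μ) 0),
       0]

end

end Hill

/-!
The entries of `Q` are oscillatory integrals whose phases are the frequencies
`±2k(z)/a ± 2ω`. A quasi-periodic function `e^{iκt} h(t)`, `h` being `a`-periodic, has a
quasi-periodic primitive as soon as `e^{iκa} ≠ 1` (`Hill.floquetPrimitive`), with the bound
proportional to `1 / |e^{iκa} - 1|`. Integration by parts against `(t + 1)^{-γ}` then gives the
decay of `Q₁₂`. In `Q₂₁` the two integrals have different frequencies `2k(z)/a` and `2k(μ)/a`;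
the sector condition bounds their difference by a multiple of `Im k(z)`, and after two
integrations by parts this factor `τ` is absorbed by `τ ≤ e^{τu}/(u + 1)`
(`Hill.exists_lower_entry`). The derivative `Q'` is a combination of `Q` and the integrands.

All constants have to be uniform for `z` in the sector, and this comes from two facts.

* The sector is compact (`Hill.IsQuasimomentum.isCompact_sector`). The bound on `Im k` and the cone
  condition keep `k` bounded, so it must be shown that `k` is proper. Variation of constants and
  Grönwall's inequality give `tr D(w²) = 2 cos(aw) + O(e^{a |Im w|} / |w|)`
  (`Hill.exists_trace_asymptotics`), and this forces `|k|` to grow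
  (`Hill.IsQuasimomentum.exists_norm_le`). On the compact sector the Wronskian is bounded away from
  zero, and the Bloch solutions are bounded uniformly in `x` although continuity in `z` is only
  assumed for each fixed `x`: finitely many values of `x` control a whole period
  (`Hill.exists_uniform_bound`).

* The number `ε(μ)` is positive (`Hill.eps_pos`), so that, by `2 ε(z) ≥ ε(μ)`, no frequency is
  resonant on the sector (`Hill.exists_nonresonance`). If `ε(μ) = 0`, then `k(μ)` is congruent to
  `±aω` modulo `π`; that `μ` is then a critical point uses `k(μ) ≥ 0`
  (`Hill.IsQuasimomentum.re_nonneg_of_mem_bands`). The discriminant tends to `+∞` at `-∞`, so the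
  bands lie to the right of `λ₀`; and to the right of `λ₀` the real part of `k` is nonnegative,
  because Cauchy's theorem on thin rectangles makes `Re k` nondecreasing where `Im k = 0`, while it
  is constant where `Im k > 0`, the discriminant being real there.
-/

namespace Hill

/-! ### Primitives of locally integrable functions -/

/-- `F` is a primitive on the whole line of the locally integrable function `f`; equivalently, `F`
is locally absolutely continuous with `F' = f` almost everywhere. -/
structure IsPrimitive (F f : ℝ → ℂ) : Prop where
  intervalIntegrable : ∀ x y : ℝ, IntervalIntegrable f volume x y
  eq_add_integral : ∀ x : ℝ, F x = F 0 + ∫ t in (0 : ℝ)..x, f t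

namespace IsPrimitive

variable {F G f g : ℝ → ℂ}

lemma sub_eq_integral (h : IsPrimitive F f) (x y : ℝ) : F y - F x = ∫ t in x..y, f t := by
  rw [h.eq_add_integral y, h.eq_add_integral x, add_sub_add_left_eq_sub,
    intervalIntegral.integral_interval_sub_left (h.intervalIntegrable _ _)
      (h.intervalIntegrable _ _)]

lemma continuous (h : IsPrimitive F f) : Continuous F := by
  rw [funext h.eq_add_integral]
  exact continuous_const.add (intervalIntegral.continuous_primitive h.intervalIntegrable 0)

lemma of_hasDerivAt (h : ∀ x, HasDerivAt F (f x) x) (hf : Continuous f) : IsPrimitive F f where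
  intervalIntegrable x y := hf.intervalIntegrable x y
  eq_add_integral x := by
    rw [intervalIntegral.integral_eq_sub_of_hasDerivAt (fun t _ => h t)
      (hf.intervalIntegrable _ _)]
    ring

lemma add (hF : IsPrimitive F f) (hG : IsPrimitive G g) :
    IsPrimitive (fun x => F x + G x) (fun x => f x + g x) where
  intervalIntegrable x y := (hF.intervalIntegrable x y).add (hG.intervalIntegrable x y)
  eq_add_integral x := by
    rw [intervalIntegral.integral_add (hF.intervalIntegrable _ _) (hG.intervalIntegrable _ _),
      hF.eq_add_integral x, hG.eq_add_integral x]
    ring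

lemma const_mul (c : ℂ) (hF : IsPrimitive F f) :
    IsPrimitive (fun x => c * F x) (fun x => c * f x) where
  intervalIntegrable x y := (hF.intervalIntegrable x y).const_mul c
  eq_add_integral x := by
    rw [intervalIntegral.integral_const_mul, hF.eq_add_integral x]
    ring

lemma absolutelyContinuousOnInterval (h : IsPrimitive F f) (x y : ℝ) :
    AbsolutelyContinuousOnInterval F x y := by
  have hre : ∀ s t, IntervalIntegrable (fun u => (f u).re) volume s t := fun s t =>
    ⟨(h.intervalIntegrable s t).1.re, (h.intervalIntegrable s t).2.re⟩
  have him : ∀ s t, IntervalIntegrable (fun u => (f u).im) volume s t := fun s t =>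
    ⟨(h.intervalIntegrable s t).1.im, (h.intervalIntegrable s t).2.im⟩
  have key : F = fun s => (∫ t in x..s, (f t).re) • (1 : ℂ) + ((∫ t in x..s, (f t).im) • Complex.I
      + F x) := by
    funext s
    have h1 : ∫ t in x..s, f t = ∫ t in x..s, (((f t).re : ℂ) + ((f t).im : ℂ) * Complex.I) := by
      simp
    have h2 := h.sub_eq_integral x s
    rw [h1, intervalIntegral.integral_add, intervalIntegral.integral_mul_const,
      intervalIntegral.integral_ofReal, intervalIntegral.integral_ofReal] at h2
    · rw [Complex.real_smul, Complex.real_smul, mul_one, ← add_assoc, ← h2]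
      ring
    · exact ⟨(hre x s).1.ofReal, (hre x s).2.ofReal⟩
    · exact IntervalIntegrable.mul_const ⟨(him x s).1.ofReal, (him x s).2.ofReal⟩ _
  have hc : ∀ c : ℂ, AbsolutelyContinuousOnInterval (fun _ : ℝ => c) x y := fun c =>
    (LipschitzWith.const c).lipschitzOnWith.absolutelyContinuousOnInterval
  rw [key]
  exact (((hre x y).absolutelyContinuousOnInterval_intervalIntegral (by simp)).fun_smul
    (hc 1)).fun_add ((((him x y).absolutelyContinuousOnInterval_intervalIntegral
      (by simp)).fun_smul (hc Complex.I)).fun_add (hc (F x)))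

lemma ae_hasDerivAt (h : IsPrimitive F f) (x y : ℝ) :
    ∀ᵐ s, s ∈ uIcc x y → HasDerivAt F (f s) s := by
  filter_upwards [(h.intervalIntegrable x y).ae_hasDerivAt_integral] with s hs hxy
  have h2 := (hs hxy x (by simp)).const_add (F x)
  refine h2.congr_of_eventuallyEq (Eventually.of_forall fun t => ?_)
  simp only [← h.sub_eq_integral x t]
  ring

/-- The product rule for locally absolutely continuous functions. -/
lemma mul (hF : IsPrimitive F f) (hG : IsPrimitive G g) :
    IsPrimitive (fun x => F x * G x) (fun x => f x * G x + F x * g x) := by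
  have hint : ∀ x y, IntervalIntegrable (fun x => f x * G x + F x * g x) volume x y := fun x y =>
    ((hF.intervalIntegrable x y).mul_continuousOn hG.continuous.continuousOn).add
      ((hG.intervalIntegrable x y).continuousOn_mul hF.continuous.continuousOn)
  refine ⟨hint, fun x => ?_⟩
  have hP : IsPrimitive (fun x => ∫ t in (0 : ℝ)..x, (f t * G t + F t * g t))
      (fun x => f x * G x + F x * g x) := ⟨hint, fun x => by simp⟩
  have hac : AbsolutelyContinuousOnInterval
      (fun x => F x * G x - ∫ t in (0 : ℝ)..x, (f t * G t + F t * g t)) 0 x :=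
    ((hF.absolutelyContinuousOnInterval 0 x).fun_smul
      (hG.absolutelyContinuousOnInterval 0 x)).fun_sub (hP.absolutelyContinuousOnInterval 0 x)
  obtain ⟨C, hC⟩ := hac.const_of_ae_hasDerivAt_zero (by
    filter_upwards [hF.ae_hasDerivAt 0 x, hG.ae_hasDerivAt 0 x, hP.ae_hasDerivAt 0 x]
      with s h1 h2 h3 hs
    exact (((h1 hs).mul (h2 hs)).sub (h3 hs)).congr_deriv (by simp))
  have h0 := hC 0 (by simp)
  have h1 := hC x (by simp)
  simp only [intervalIntegral.integral_same, sub_zero] at h0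
  rw [h0, ← h1]
  ring

end IsPrimitive

/-! ### Gronwall's inequality with an integrable weight -/

/-- Gronwall's inequality with a merely integrable weight `g`. With
`F x = A + ∫₀ˣ g f` one has `F y ≤ F x + F y ∫ₓʸ g`, so `F` at most doubles over each step on which
`∫ g ≤ 1/2`, and finitely many such steps cover `[0, a]`. -/
lemma exists_gronwall {a : ℝ} (ha : 0 < a) {g : ℝ → ℝ}
    (hg : ∀ x y, IntervalIntegrable g volume x y) (hg0 : ∀ x, 0 ≤ g x) :
    ∃ C : ℝ, 0 < C ∧ ∀ (f : ℝ → ℝ) (A : ℝ), Continuous f → (∀ x, 0 ≤ f x) → 0 ≤ A →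
      (∀ x ∈ Icc 0 a, f x ≤ A + ∫ t in (0 : ℝ)..x, g t * f t) →
      ∀ x ∈ Icc 0 a, f x ≤ C * A := by
  have hGc : Continuous fun x => ∫ t in (0 : ℝ)..x, g t :=
    intervalIntegral.continuous_primitive hg 0
  have huc := (isCompact_Icc (a := (0 : ℝ)) (b := a)).uniformContinuousOn_of_continuous
    hGc.continuousOn
  obtain ⟨η, hη, hηG⟩ := Metric.uniformContinuousOn_iff.1 huc (1 / 2) (by norm_num)
  obtain ⟨N, hN⟩ := exists_nat_gt (a / η)
  have hN0 : (0 : ℝ) < N := (by positivity : 0 < a / η).trans hN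
  have hstep : a / N < η := by
    rw [div_lt_iff₀ hη] at hN
    rw [div_lt_iff₀ hN0]
    linarith
  refine ⟨2 ^ N, by positivity, fun f A hf hf0 hA hfA => ?_⟩
  have hgf : ∀ x y, IntervalIntegrable (fun t => g t * f t) volume x y := fun x y =>
    (hg x y).mul_continuousOn hf.continuousOn
  set F : ℝ → ℝ := fun x => A + ∫ t in (0 : ℝ)..x, g t * f t with hF
  have hFsub : ∀ x y, F y - F x = ∫ t in x..y, g t * f t := fun x y => by
    simp only [hF]
    rw [add_sub_add_left_eq_sub, intervalIntegral.integral_interval_sub_left (hgf _ _) (hgf _ _)]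
  have hmono : ∀ x y, x ≤ y → F x ≤ F y := fun x y hxy => by
    have := intervalIntegral.integral_nonneg (μ := volume) hxy
      (fun t _ => mul_nonneg (hg0 t) (hf0 t))
    rw [← hFsub] at this
    linarith
  have hF0 : F 0 = A := by simp [hF]
  have hdouble : ∀ x ∈ Icc 0 a, ∀ y ∈ Icc 0 a, x ≤ y → y - x < η → F y ≤ 2 * F x := by
    intro x hx y hy hxy hd
    have h1 : ∫ t in x..y, g t * f t ≤ ∫ t in x..y, g t * F y := by
      refine intervalIntegral.integral_mono_on hxy (hgf _ _) ((hg _ _).mul_const _)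
        fun t ht => mul_le_mul_of_nonneg_left ?_ (hg0 t)
      exact (hfA t ⟨hx.1.trans ht.1, ht.2.trans hy.2⟩).trans (hmono t y ht.2)
    rw [intervalIntegral.integral_mul_const, ← hFsub] at h1
    have h2 := hηG y hy x hx (by rw [Real.dist_eq, abs_of_nonneg] <;> linarith)
    rw [Real.dist_eq, intervalIntegral.integral_interval_sub_left (hg _ _) (hg _ _)] at h2
    have h3 := (abs_lt.1 h2).2
    have h4 : 0 ≤ F y := by
      have := hmono 0 y hy.1
      rw [hF0] at this
      linarith
    nlinarith
  have hind : ∀ n : ℕ, n ≤ N → F (n * (a / N)) ≤ 2 ^ n * A := by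
    intro n
    induction n with
    | zero => intro _; simp [hF0]
    | succ n ih =>
      intro hn
      have hn' : ((n : ℝ) + 1) ≤ N := by exact_mod_cast hn
      have hs : 0 < a / N := by positivity
      have hend : ((n : ℝ) + 1) * (a / N) ≤ a := by
        calc ((n : ℝ) + 1) * (a / N) ≤ N * (a / N) := by gcongr
          _ = a := by field_simp
      have := hdouble (n * (a / N)) ⟨by positivity, by linarith⟩ ((n + 1) * (a / N))
        ⟨by positivity, hend⟩ (by linarith) (by linarith)
      push_cast
      have h2 := ih (by omega)
      calc F (((n : ℝ) + 1) * (a / N)) ≤ 2 * F (n * (a / N)) := this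
        _ ≤ 2 * (2 ^ n * A) := by linarith
        _ = 2 ^ (n + 1) * A := by ring
  intro x hx
  have h1 := hind N le_rfl
  rw [mul_div_cancel₀ _ hN0.ne'] at h1
  exact ((hfA x hx).trans (hmono x a hx.2)).trans h1

/-! ### Solutions of Hill's equation -/

section Solutions

variable {q : ℝ → ℝ} {a : ℝ} {z z' : ℂ} {y y' : ℝ → ℂ}

lemma IsSolution.continuous (h : IsSolution q z y) : Continuous y := h.1.continuous

lemma intervalIntegrable_potential_mul (hq : ∀ s t, IntervalIntegrable q volume s t) (z : ℂ)
    (hy : Continuous y) (s t : ℝ) :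
    IntervalIntegrable (fun t => ((q t : ℂ) - z) * y t) volume s t :=
  IntervalIntegrable.mul_continuousOn
    (IntervalIntegrable.sub ⟨(hq s t).1.ofReal, (hq s t).2.ofReal⟩ intervalIntegrable_const)
    hy.continuousOn

lemma IsSolution.isPrimitive_deriv (hq : ∀ s t, IntervalIntegrable q volume s t)
    (h : IsSolution q z y) : IsPrimitive (deriv y) (fun t => ((q t : ℂ) - z) * y t) :=
  ⟨intervalIntegrable_potential_mul hq z h.continuous, h.2⟩

lemma IsSolution.isPrimitive (hq : ∀ s t, IntervalIntegrable q volume s t)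
    (h : IsSolution q z y) : IsPrimitive y (deriv y) :=
  .of_hasDerivAt (fun x => (h.1 x).hasDerivAt) (h.isPrimitive_deriv hq).continuous

lemma IsSolution.linear_combination (hq : ∀ s t, IntervalIntegrable q volume s t)
    (h : IsSolution q z y) (h' : IsSolution q z y') (c c' : ℂ) :
    IsSolution q z (fun x => c * y x + c' * y' x) := by
  have hd : ∀ x, HasDerivAt (fun x => c * y x + c' * y' x) (c * deriv y x + c' * deriv y' x) x :=
    fun x => ((h.1 x).hasDerivAt.const_mul c).add ((h'.1 x).hasDerivAt.const_mul c')
  refine ⟨fun x => (hd x).differentiableAt, fun x => ?_⟩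
  rw [(hd x).deriv, (hd 0).deriv, (((h.isPrimitive_deriv hq).const_mul c).add
    ((h'.isPrimitive_deriv hq).const_mul c')).eq_add_integral x]
  congr 1
  refine intervalIntegral.integral_congr fun t _ => ?_
  ring

lemma isSolution_zero : IsSolution q z (fun _ => 0) := by
  refine ⟨differentiable_const _, fun x => ?_⟩
  simp

lemma IsSolution.conj (h : IsSolution q z y) :
    IsSolution q ((starRingEnd ℂ) z) (fun x => (starRingEnd ℂ) (y x)) := by
  have hd : ∀ x, HasDerivAt (fun x => (starRingEnd ℂ) (y x)) ((starRingEnd ℂ) (deriv y x)) x :=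
    fun x => (h.1 x).hasDerivAt.star
  refine ⟨fun x => (hd x).differentiableAt, fun x => ?_⟩
  rw [(hd x).deriv, (hd 0).deriv, h.2 x, map_add]
  congr 1
  have h1 : (fun t => ((q t : ℂ) - (starRingEnd ℂ) z) * (starRingEnd ℂ) (y t))
      = fun t => (starRingEnd ℂ) (((q t : ℂ) - z) * y t) := by
    funext t
    simp
  rw [h1, intervalIntegral.intervalIntegral_eq_integral_uIoc,
    intervalIntegral.intervalIntegral_eq_integral_uIoc, integral_conj]
  split_ifs <;> simp

/-- The Wronskian of two solutions is constant. -/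
lemma IsSolution.wronskian_const (hq : ∀ s t, IntervalIntegrable q volume s t)
    (h : IsSolution q z y) (h' : IsSolution q z y') (x : ℝ) :
    y x * deriv y' x - deriv y x * y' x = y 0 * deriv y' 0 - deriv y 0 * y' 0 := by
  have h1 := ((h.isPrimitive hq).mul (h'.isPrimitive_deriv hq)).add
    (((h.isPrimitive_deriv hq).mul (h'.isPrimitive hq)).const_mul (-1))
  have h2 := h1.eq_add_integral x
  rw [intervalIntegral.integral_congr (g := fun _ => 0) (fun t _ => by ring)] at h2
  simp only [intervalIntegral.integral_zero, add_zero] at h2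
  linear_combination h2

/-- Continuous dependence of solutions on the Cauchy data and on the spectral parameter,
uniformly on `[0, a]` and on bounded sets of spectral parameters. -/
lemma exists_stability (ha : 0 < a) (hq : ∀ s t, IntervalIntegrable q volume s t) (R : ℝ) :
    ∃ C : ℝ, 0 < C ∧ ∀ (z z' : ℂ) (y y' : ℝ → ℂ), ‖z‖ ≤ R → ‖z'‖ ≤ R →
      IsSolution q z y → IsSolution q z' y' → ∀ x ∈ Icc 0 a,
      ‖y x - y' x‖ + ‖deriv y x - deriv y' x‖ ≤ C * (‖y 0 - y' 0‖ + ‖deriv y 0 - deriv y' 0‖ +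
        ‖z - z'‖ * (‖y' 0‖ + ‖deriv y' 0‖)) := by
  have hgi : ∀ s t, IntervalIntegrable (fun t => 1 + |q t| + |R|) volume s t := fun s t =>
    (intervalIntegrable_const.add (hq s t).abs).add intervalIntegrable_const
  obtain ⟨C, hC, hgr⟩ := exists_gronwall ha hgi (fun x => by positivity)
  -- The difference solves an inhomogeneous equation with right-hand side `(z - z') y'`.
  have main : ∀ (z z' : ℂ) (y y' : ℝ → ℂ), ‖z‖ ≤ R →
      IsSolution q z y → IsSolution q z' y' → ∀ B : ℝ, 0 ≤ B → (∀ x ∈ Icc 0 a, ‖y' x‖ ≤ B) →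
      ∀ x ∈ Icc 0 a, ‖y x - y' x‖ + ‖deriv y x - deriv y' x‖ ≤
        C * (‖y 0 - y' 0‖ + ‖deriv y 0 - deriv y' 0‖ + ‖z - z'‖ * B * a) := by
    intro z z' y y' hz h h' B hB hyB
    have hdc := (h.isPrimitive_deriv hq).continuous
    have hdc' := (h'.isPrimitive_deriv hq).continuous
    refine hgr (fun x => ‖y x - y' x‖ + ‖deriv y x - deriv y' x‖) _
      ((h.continuous.sub h'.continuous).norm.add (hdc.sub hdc').norm)
      (fun x => by positivity) (by positivity) fun x hx => ?_
    set f : ℝ → ℝ := fun x => ‖y x - y' x‖ + ‖deriv y x - deriv y' x‖ with hf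
    have hfc : Continuous f := (h.continuous.sub h'.continuous).norm.add (hdc.sub hdc').norm
    have hgf : ∀ s t, IntervalIntegrable (fun t => (1 + |q t| + |R|) * f t) volume s t :=
      fun s t => (hgi s t).mul_continuousOn hfc.continuousOn
    have e1 : y x - y' x = (y 0 - y' 0) + ∫ t in (0 : ℝ)..x, (deriv y t - deriv y' t) := by
      rw [intervalIntegral.integral_sub (hdc.intervalIntegrable _ _)
        (hdc'.intervalIntegrable _ _), (h.isPrimitive hq).eq_add_integral x,
        (h'.isPrimitive hq).eq_add_integral x]
      ring
    have e2 : deriv y x - deriv y' x = (deriv y 0 - deriv y' 0) +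
        ∫ t in (0 : ℝ)..x, (((q t : ℂ) - z) * (y t - y' t) - (z - z') * y' t) := by
      rw [intervalIntegral.integral_congr (g := fun t =>
        ((q t : ℂ) - z) * y t - ((q t : ℂ) - z') * y' t) (fun t _ => by ring),
        intervalIntegral.integral_sub (intervalIntegrable_potential_mul hq z h.continuous _ _)
        (intervalIntegrable_potential_mul hq z' h'.continuous _ _), h.2 x, h'.2 x]
      ring
    have b1 : ‖∫ t in (0 : ℝ)..x, (deriv y t - deriv y' t)‖ ≤
        ∫ t in (0 : ℝ)..x, ‖deriv y t - deriv y' t‖ :=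
      intervalIntegral.norm_integral_le_integral_norm hx.1
    have hi3 : IntervalIntegrable (fun t => ((|q t| + |R|) * ‖y t - y' t‖ + ‖z - z'‖ * B))
        volume 0 x :=
      ((((hq _ _).abs).add intervalIntegrable_const).mul_continuousOn
        (h.continuous.sub h'.continuous).norm.continuousOn).add intervalIntegrable_const
    have b2 : ‖∫ t in (0 : ℝ)..x, (((q t : ℂ) - z) * (y t - y' t) - (z - z') * y' t)‖ ≤
        ∫ t in (0 : ℝ)..x, ((|q t| + |R|) * ‖y t - y' t‖ + ‖z - z'‖ * B) := by
      refine intervalIntegral.norm_integral_le_of_norm_le hx.1 ?_ hi3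
      refine Eventually.of_forall fun t ht => (norm_sub_le _ _).trans ?_
      rw [norm_mul, norm_mul]
      refine add_le_add (mul_le_mul_of_nonneg_right ((norm_sub_le _ _).trans ?_)
        (norm_nonneg _)) (mul_le_mul_of_nonneg_left (hyB t ⟨ht.1.le, ht.2.trans hx.2⟩)
          (norm_nonneg _))
      rw [Complex.norm_real, Real.norm_eq_abs]
      linarith [le_abs_self R]
    have b3 : (∫ t in (0 : ℝ)..x, ‖deriv y t - deriv y' t‖) +
        (∫ t in (0 : ℝ)..x, ((|q t| + |R|) * ‖y t - y' t‖ + ‖z - z'‖ * B)) ≤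
        (∫ t in (0 : ℝ)..x, (1 + |q t| + |R|) * f t) + ‖z - z'‖ * B * a := by
      have hconst : (∫ t in (0 : ℝ)..x, ‖z - z'‖ * B) ≤ ‖z - z'‖ * B * a := by
        rw [intervalIntegral.integral_const, smul_eq_mul, sub_zero, mul_comm]
        exact mul_le_mul_of_nonneg_left hx.2 (by positivity)
      refine le_trans ?_ (add_le_add_right hconst _)
      have hnc : Continuous fun t => ‖deriv y t - deriv y' t‖ := (hdc.sub hdc').norm
      rw [← intervalIntegral.integral_add (hnc.intervalIntegrable _ _) hi3,
        ← intervalIntegral.integral_add (hgf _ _) intervalIntegrable_const]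
      refine intervalIntegral.integral_mono_on hx.1
        ((hnc.intervalIntegrable _ _).add hi3)
        ((hgf _ _).add intervalIntegrable_const) fun t _ => ?_
      have : 0 ≤ (|q t| + |R|) * ‖deriv y t - deriv y' t‖ := by positivity
      simp only [hf]
      nlinarith [norm_nonneg (y t - y' t)]
    calc f x ≤ (‖y 0 - y' 0‖ + ‖∫ t in (0 : ℝ)..x, (deriv y t - deriv y' t)‖) +
          (‖deriv y 0 - deriv y' 0‖ +
          ‖∫ t in (0 : ℝ)..x, (((q t : ℂ) - z) * (y t - y' t) - (z - z') * y' t)‖) := by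
          simp only [hf]
          rw [e1, e2]
          exact add_le_add (norm_add_le _ _) (norm_add_le _ _)
      _ ≤ _ := by linarith
  refine ⟨C * (1 + C * a), by positivity, fun z z' y y' hz hz' h h' x hx => ?_⟩
  have hB : ∀ x ∈ Icc 0 a, ‖y' x‖ ≤ C * (‖y' 0‖ + ‖deriv y' 0‖) := fun x hx => by
    have := main z' z' y' (fun _ => 0) hz' h' isSolution_zero 0 le_rfl (by simp) x hx
    simp only [sub_zero, deriv_const, sub_self, norm_zero, zero_mul, add_zero] at this
    linarith [norm_nonneg (deriv y' x)]
  refine (main z z' y y' hz h h' _ (by positivity) hB x hx).trans ?_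
  have h1 : 0 ≤ C * a * (‖y 0 - y' 0‖ + ‖deriv y 0 - deriv y' 0‖) := by positivity
  have h2 : 0 ≤ ‖z - z'‖ * (‖y' 0‖ + ‖deriv y' 0‖) := by positivity
  rw [mul_assoc C]
  refine mul_le_mul_of_nonneg_left ?_ hC.le
  nlinarith

end Solutions

/-! ### Asymptotics of the discriminant -/

lemma norm_cos_sin_le (v : ℂ) :
    ‖Complex.cos v‖ ≤ Real.exp |v.im| ∧ ‖Complex.sin v‖ ≤ Real.exp |v.im| := by
  have h1 : ‖Complex.exp (v * Complex.I)‖ ≤ Real.exp |v.im| := by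
    rw [Complex.norm_exp]
    refine Real.exp_le_exp.2 ?_
    simpa using neg_le_abs v.im
  have h2 : ‖Complex.exp (-v * Complex.I)‖ ≤ Real.exp |v.im| := by
    rw [Complex.norm_exp]
    refine Real.exp_le_exp.2 ?_
    simpa using le_abs_self v.im
  constructor
  · rw [Complex.cos, norm_div, Complex.norm_two, div_le_iff₀ two_pos]
    exact (norm_add_le _ _).trans (by linarith)
  · rw [Complex.sin, norm_div, norm_mul, Complex.norm_I, mul_one, Complex.norm_two,
      div_le_iff₀ two_pos]
    exact (norm_sub_le _ _).trans (by linarith)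

section Asymptotics

variable {q : ℝ → ℝ} {a : ℝ} {w : ℂ} {y : ℝ → ℂ}

/-- Variation of constants, with `z = w²`; the equation for `y` is multiplied by `w`. -/
lemma IsSolution.variation_of_constants (hq : ∀ s t, IntervalIntegrable q volume s t)
    (h : IsSolution q (w ^ 2) y) (x : ℝ) :
    w * y x = Complex.sin (w * x) * deriv y 0 + w * Complex.cos (w * x) * y 0 +
        ∫ t in (0 : ℝ)..x, Complex.sin (w * (x - t)) * (q t * y t) ∧
    deriv y x = Complex.cos (w * x) * deriv y 0 - w * Complex.sin (w * x) * y 0 +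
        ∫ t in (0 : ℝ)..x, Complex.cos (w * (x - t)) * (q t * y t) := by
  have harg : ∀ t : ℝ, HasDerivAt (fun t : ℝ => w * ((x : ℂ) - t)) (-w) t := fun t => by
    simpa using ((Complex.ofRealCLM.hasDerivAt (x := t)).const_sub (x : ℂ)).const_mul w
  have hS : IsPrimitive (fun t : ℝ => Complex.sin (w * (x - t)))
      (fun t : ℝ => Complex.cos (w * (x - t)) * -w) :=
    .of_hasDerivAt (fun t => (Complex.hasDerivAt_sin _).comp t (harg t)) (by fun_prop)
  have hC : IsPrimitive (fun t : ℝ => Complex.cos (w * (x - t)))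
      (fun t : ℝ => -Complex.sin (w * (x - t)) * -w) :=
    .of_hasDerivAt (fun t => (Complex.hasDerivAt_cos _).comp t (harg t)) (by fun_prop)
  have hy := h.isPrimitive hq
  have hy' := h.isPrimitive_deriv hq
  constructor
  · have h1 := ((hS.mul hy').add ((hC.mul hy).const_mul w)).eq_add_integral x
    rw [intervalIntegral.integral_congr (g := fun t : ℝ =>
      Complex.sin (w * (x - t)) * (q t * y t)) (fun t _ => by ring)] at h1
    simpa [mul_assoc] using h1
  · have h1 := ((hC.mul hy').add ((hS.mul hy).const_mul (-w))).eq_add_integral x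
    rw [intervalIntegral.integral_congr (g := fun t : ℝ =>
      Complex.cos (w * (x - t)) * (q t * y t)) (fun t _ => by ring)] at h1
    simpa [mul_assoc, sub_eq_add_neg] using h1

/-- Solutions grow at most like `e^{Im w x}`, by variation of constants and Gronwall's inequality
for `‖y x‖ e^{-Im w x}`. -/
lemma exists_solution_bound (ha : 0 < a) (hq : ∀ s t, IntervalIntegrable q volume s t) :
    ∃ C : ℝ, 0 < C ∧ ∀ (w : ℂ) (y : ℝ → ℂ), 0 ≤ w.im → 1 ≤ ‖w‖ → IsSolution q (w ^ 2) y →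
      ∀ x ∈ Icc 0 a, ‖y x‖ ≤ C * (‖y 0‖ + ‖deriv y 0‖ / ‖w‖) * Real.exp (w.im * x) := by
  obtain ⟨C, hC, hgr⟩ := exists_gronwall ha (fun s t => (hq s t).abs) (fun x => abs_nonneg (q x))
  refine ⟨C, hC, fun w y hw hw1 h x hx => ?_⟩
  have hw0 : 0 < ‖w‖ := by linarith
  have hyc := h.continuous
  have key := hgr (fun t => ‖y t‖ * Real.exp (-(w.im * t))) (‖y 0‖ + ‖deriv y 0‖ / ‖w‖)
    (by fun_prop) (fun t => by positivity) (by positivity) ?_ x hx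
  · rw [Real.exp_neg, ← div_eq_mul_inv, div_le_iff₀ (Real.exp_pos _)] at key
    exact key
  intro x hx
  have habs : ∀ t : ℝ, t ≤ x → |(w * ((x : ℂ) - t)).im| = w.im * (x - t) := fun t ht => by
    rw [← Complex.ofReal_sub, Complex.im_mul_ofReal, abs_of_nonneg]
    exact mul_nonneg hw (by linarith)
  have habs0 : |(w * (x : ℂ)).im| = w.im * x := by simpa using habs 0 hx.1
  have hexp : 0 < Real.exp (w.im * x) := Real.exp_pos _
  have hint : ‖∫ t in (0 : ℝ)..x, Complex.sin (w * (x - t)) * (q t * y t)‖ ≤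
      ∫ t in (0 : ℝ)..x, Real.exp (w.im * x) *
        (|q t| * (‖y t‖ * Real.exp (-(w.im * t)))) := by
    refine intervalIntegral.norm_integral_le_of_norm_le hx.1
      (Eventually.of_forall fun t ht => ?_) ?_
    · rw [norm_mul, norm_mul, Complex.norm_real, Real.norm_eq_abs]
      have h1 := (norm_cos_sin_le (w * ((x : ℂ) - t))).2
      rw [habs t ht.2] at h1
      have h2 : Real.exp (w.im * (x - t)) = Real.exp (w.im * x) * Real.exp (-(w.im * t)) := by
        rw [← Real.exp_add]
        ring_nf
      calc _ ≤ Real.exp (w.im * (x - t)) * (|q t| * ‖y t‖) := by gcongr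
        _ = _ := by rw [h2]; ring
    · exact ((hq 0 x).abs.mul_continuousOn
        (Continuous.continuousOn (by fun_prop))).const_mul _
  rw [intervalIntegral.integral_const_mul] at hint
  set J := ∫ t in (0 : ℝ)..x, |q t| * (‖y t‖ * Real.exp (-(w.im * t))) with hJ
  have hJ0 : 0 ≤ J := intervalIntegral.integral_nonneg hx.1 fun t _ => by positivity
  have h1 : ‖w‖ * ‖y x‖ ≤ Real.exp (w.im * x) * ‖deriv y 0‖ +
      ‖w‖ * Real.exp (w.im * x) * ‖y 0‖ + Real.exp (w.im * x) * J := by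
    rw [← norm_mul, (h.variation_of_constants hq x).1]
    refine (norm_add₃_le).trans ?_
    rw [norm_mul, norm_mul, norm_mul]
    have h2 := norm_cos_sin_le (w * (x : ℂ))
    rw [habs0] at h2
    have h3 := h2.1
    have h4 := h2.2
    gcongr
  rw [Real.exp_neg, ← div_eq_mul_inv, div_le_iff₀ hexp, ← mul_le_mul_iff_right₀ hw0]
  refine h1.trans ?_
  have h5 : Real.exp (w.im * x) * J ≤ ‖w‖ * (Real.exp (w.im * x) * J) :=
    le_mul_of_one_le_left (by positivity) hw1
  calc _ ≤ Real.exp (w.im * x) * ‖deriv y 0‖ + ‖w‖ * Real.exp (w.im * x) * ‖y 0‖ +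
        ‖w‖ * (Real.exp (w.im * x) * J) := by linarith
    _ = _ := by
      field_simp
      ring

/-- `tr D(w²) = 2 cos(a w) + O(e^{a Im w} / |w|)`, stated for any pair of solutions with the
Cauchy data of the canonical ones. -/
lemma exists_trace_asymptotics (ha : 0 < a) (hq : ∀ s t, IntervalIntegrable q volume s t) :
    ∃ C : ℝ, 0 < C ∧ ∀ (w : ℂ) (y₁ y₂ : ℝ → ℂ), 0 ≤ w.im → 1 ≤ ‖w‖ →
      IsSolution q (w ^ 2) y₁ → IsSolution q (w ^ 2) y₂ → y₁ 0 = 1 → deriv y₁ 0 = 0 →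
      y₂ 0 = 0 → deriv y₂ 0 = 1 →
      ‖y₁ a + deriv y₂ a - 2 * Complex.cos (w * a)‖ ≤ C * Real.exp (a * w.im) / ‖w‖ := by
  obtain ⟨C, hC, hb⟩ := exists_solution_bound ha hq
  have hq1 : 0 ≤ ∫ t in (0 : ℝ)..a, |q t| :=
    intervalIntegral.integral_nonneg ha.le fun t _ => abs_nonneg _
  refine ⟨2 * C * (∫ t in (0 : ℝ)..a, |q t|) + 1, by positivity,
    fun w y₁ y₂ hw hw1 h₁ h₂ h10 h10' h20 h20' => ?_⟩
  have hw0 : 0 < ‖w‖ := by linarith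
  have hwne : w ≠ 0 := norm_pos_iff.1 hw0
  have hint : ∀ (T : ℂ → ℂ) (y : ℝ → ℂ) (B : ℝ), (∀ v, ‖T v‖ ≤ Real.exp |v.im|) →
      (∀ x ∈ Icc 0 a, ‖y x‖ ≤ B * Real.exp (w.im * x)) →
      ‖∫ t in (0 : ℝ)..a, T (w * (a - t)) * (q t * y t)‖ ≤
        (∫ t in (0 : ℝ)..a, |q t|) * (B * Real.exp (a * w.im)) := by
    intro T y B hT hy
    rw [← intervalIntegral.integral_mul_const]
    refine intervalIntegral.norm_integral_le_of_norm_le ha.le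
      (Eventually.of_forall fun t ht => ?_) ((hq 0 a).abs.mul_const _)
    rw [norm_mul, norm_mul, Complex.norm_real, Real.norm_eq_abs]
    have h1 := hT (w * ((a : ℂ) - t))
    rw [← Complex.ofReal_sub, Complex.im_mul_ofReal, abs_of_nonneg
      (mul_nonneg hw (by linarith [ht.2])), Complex.ofReal_sub] at h1
    have h2 := hy t ⟨ht.1.le, ht.2⟩
    calc _ ≤ Real.exp (w.im * (a - t)) * (|q t| * (B * Real.exp (w.im * t))) := by gcongr
      _ = |q t| * (B * (Real.exp (w.im * (a - t)) * Real.exp (w.im * t))) := by ring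
      _ = _ := by rw [← Real.exp_add]; ring_nf
  have e1 := (h₁.variation_of_constants hq a).1
  have e2 := (h₂.variation_of_constants hq a).2
  rw [h10, h10'] at e1
  rw [h20, h20'] at e2
  have b1 := hint Complex.sin y₁ C (fun v => (norm_cos_sin_le v).2) (fun x hx => by
    simpa [h10, h10'] using hb w y₁ hw hw1 h₁ x hx)
  have b2 := hint Complex.cos y₂ (C / ‖w‖) (fun v => (norm_cos_sin_le v).1) (fun x hx => by
    simpa [h20, h20', div_eq_mul_inv] using hb w y₂ hw hw1 h₂ x hx)
  set I₁ := ∫ t in (0 : ℝ)..a, Complex.sin (w * (a - t)) * (q t * y₁ t)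
  set I₂ := ∫ t in (0 : ℝ)..a, Complex.cos (w * (a - t)) * (q t * y₂ t)
  have e3 : y₁ a + deriv y₂ a - 2 * Complex.cos (w * a) = I₁ / w + I₂ := by
    have : y₁ a = Complex.cos (w * a) + I₁ / w := by
      field_simp
      linear_combination e1
    rw [this, e2]
    ring
  rw [e3]
  refine (norm_add_le _ _).trans ?_
  rw [norm_div, le_div_iff₀ hw0, add_mul, div_mul_cancel₀ _ hw0.ne']
  have b3 : ‖I₂‖ * ‖w‖ ≤ (∫ t in (0 : ℝ)..a, |q t|) * (C * Real.exp (a * w.im)) := by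
    calc _ ≤ (∫ t in (0 : ℝ)..a, |q t|) * (C / ‖w‖ * Real.exp (a * w.im)) * ‖w‖ := by gcongr
      _ = _ := by field_simp
  have := Real.exp_pos (a * w.im)
  nlinarith

end Asymptotics

/-! ### The discriminant in the closed upper half-plane -/

section Discriminant

variable {q : ℝ → ℝ} {a : ℝ} {z : ℂ} {k : ℂ → ℂ}

/-- The Cauchy problem at `0` is solvable for the spectral parameter `z`. Where it is, the value of
`cauchySolution`, which is a choice of a solution, is meaningful. -/
def CauchySolvable (q : ℝ → ℝ) (z : ℂ) : Prop :=
  ∀ y₀ y₁ : ℂ, ∃ y, IsSolution q z y ∧ y 0 = y₀ ∧ deriv y 0 = y₁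

lemma CauchySolvable.spec (h : CauchySolvable q z) (y₀ y₁ : ℂ) :
    IsSolution q z (cauchySolution q z y₀ y₁) ∧ cauchySolution q z y₀ y₁ 0 = y₀ ∧
      deriv (cauchySolution q z y₀ y₁) 0 = y₁ :=
  Classical.epsilon_spec (h y₀ y₁)

lemma discriminant_eq : discriminant q a z =
    cauchySolution q z 1 0 a + deriv (cauchySolution q z 0 1) a := by
  simp [discriminant, monodromy, Matrix.trace_fin_two]

/-- Two Bloch solutions with nonzero Wronskian span the solution space. -/
lemma IsBlochPair.cauchySolvable {S : Set ℂ} {ψp ψm : ℝ → ℂ → ℂ}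
    (hq : ∀ s t, IntervalIntegrable q volume s t) (h : IsBlochPair q a k S ψp ψm)
    (hz : z ∈ blochDomain q a S) : CauchySolvable q z := by
  intro y₀ y₁
  have hW := h.wronskian_ne_zero z hz
  have hp := h.solution_p z hz
  have hm := h.solution_m z hz
  have hsol := fun c c' => hp.linear_combination hq hm c c'
  have hd : ∀ c c' : ℂ, deriv (fun x => c * ψp x z + c' * ψm x z) 0 =
      c * deriv (fun x => ψp x z) 0 + c' * deriv (fun x => ψm x z) 0 := fun c c' =>
    (((hp.1 0).hasDerivAt.const_mul c).add ((hm.1 0).hasDerivAt.const_mul c')).deriv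
  set W := wronskian ψp ψm z with hWdef
  rw [wronskian] at hWdef
  refine ⟨_, hsol ((y₁ * ψm 0 z - y₀ * deriv (fun x => ψm x z) 0) / W)
    ((y₀ * deriv (fun x => ψp x z) 0 - y₁ * ψp 0 z) / W), ?_, ?_⟩
  · field_simp
    rw [hWdef]
    ring
  · rw [hd]
    field_simp
    rw [hWdef]
    ring

lemma IsQuasimomentum.continuousOn_discriminant (hk : IsQuasimomentum q a k) :
    ContinuousOn (discriminant q a) {z | 0 ≤ z.im} := by
  have h1 : ContinuousOn (fun z => Complex.exp (Complex.I * k z) +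
      Complex.exp (-(Complex.I * k z))) {z | 0 ≤ z.im} :=
    ((continuousOn_const.mul hk.continuousOn).cexp).add
      ((continuousOn_const.mul hk.continuousOn).neg.cexp)
  exact h1.congr fun z hz => (hk.exp_add_exp z hz).symm

/-- The asymptotics of the discriminant, in terms of the quasi-momentum, in the closed quadrant that
the square maps onto the closed upper half-plane. -/
lemma IsQuasimomentum.exists_asymptotics (ha : 0 < a)
    (hq : ∀ s t, IntervalIntegrable q volume s t) (hk : IsQuasimomentum q a k)
    (hE : ∀ z : ℂ, 0 < z.im → CauchySolvable q z) :
    ∃ C : ℝ, 0 < C ∧ ∀ w : ℂ, 0 ≤ w.re → 0 ≤ w.im → 1 ≤ ‖w‖ →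
      ‖discriminant q a (w ^ 2) - 2 * Complex.cos (w * a)‖ ≤ C * Real.exp (a * w.im) / ‖w‖ := by
  obtain ⟨C, hC, hb⟩ := exists_trace_asymptotics ha hq
  refine ⟨C, hC, fun w hre him hw => ?_⟩
  -- Approach `w` from the open quadrant, where the Cauchy problem is solvable.
  let p : ℝ → ℂ := fun ε => w + ε * (1 + Complex.I)
  have hp : Continuous p := by fun_prop
  have hp0 : p 0 = w := by simp [p]
  have hpre : ∀ ε : ℝ, (p ε).re = w.re + ε := fun ε => by simp [p]
  have hpim : ∀ ε : ℝ, (p ε).im = w.im + ε := fun ε => by simp [p]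
  have hsq : ∀ v : ℂ, (v ^ 2).im = 2 * v.re * v.im := fun v => by
    rw [sq, Complex.mul_im]
    ring
  have hnorm : ∀ ε : ℝ, 0 ≤ ε → ‖w‖ ≤ ‖p ε‖ := fun ε hε => by
    rw [← sq_le_sq₀ (norm_nonneg _) (norm_nonneg _), Complex.sq_norm, Complex.sq_norm,
      Complex.normSq_apply, Complex.normSq_apply, hpre, hpim]
    nlinarith
  have htend : Tendsto (fun ε => discriminant q a (p ε ^ 2)) (𝓝[>] 0)
      (𝓝 (discriminant q a (w ^ 2))) := by
    have h1 := hk.continuousOn_discriminant (w ^ 2) (by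
      simp only [mem_ofPred_eq, hsq]
      positivity)
    refine h1.tendsto.comp (tendsto_nhdsWithin_iff.2 ⟨?_, ?_⟩)
    · have : Tendsto (fun ε => p ε ^ 2) (𝓝 0) (𝓝 (p 0 ^ 2)) := (hp.pow 2).tendsto 0
      rw [hp0] at this
      exact this.mono_left nhdsWithin_le_nhds
    · filter_upwards [self_mem_nhdsWithin] with ε hε
      have hε' : (0 : ℝ) < ε := hε
      simp only [hsq, hpre, hpim]
      positivity
  have hl : Tendsto (fun ε => ‖discriminant q a (p ε ^ 2) - 2 * Complex.cos (p ε * a)‖) (𝓝[>] 0)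
      (𝓝 ‖discriminant q a (w ^ 2) - 2 * Complex.cos (w * a)‖) := by
    have h2 : Tendsto (fun ε => 2 * Complex.cos (p ε * a)) (𝓝[>] 0)
        (𝓝 (2 * Complex.cos (w * a))) := by
      have : Continuous fun ε => 2 * Complex.cos (p ε * a) := by fun_prop
      have h3 := this.tendsto 0
      rw [hp0] at h3
      exact h3.mono_left nhdsWithin_le_nhds
    exact (htend.sub h2).norm
  have hr : Tendsto (fun ε => C * Real.exp (a * (p ε).im) / ‖w‖) (𝓝[>] 0)
      (𝓝 (C * Real.exp (a * w.im) / ‖w‖)) := by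
    have : Continuous fun ε => C * Real.exp (a * (p ε).im) / ‖w‖ := by
      simp only [hpim]
      fun_prop
    have h3 := this.tendsto 0
    rw [hp0] at h3
    exact h3.mono_left nhdsWithin_le_nhds
  refine le_of_tendsto_of_tendsto hl hr ?_
  filter_upwards [self_mem_nhdsWithin] with ε hε
  have hε' : (0 : ℝ) < ε := hε
  have hz : 0 < (p ε ^ 2).im := by
    rw [hsq, hpre, hpim]
    positivity
  obtain ⟨h1, h10, h11⟩ := (hE _ hz).spec 1 0
  obtain ⟨h2, h20, h21⟩ := (hE _ hz).spec 0 1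
  have h3 := hnorm ε hε'.le
  rw [discriminant_eq]
  refine (hb (p ε) _ _ (by rw [hpim]; positivity) (hw.trans h3) h1 h2 h10 h11 h20 h21).trans ?_
  have : 0 < ‖w‖ := by linarith
  gcongr

lemma tendsto_discriminant_vertical (hk : IsQuasimomentum q a k) (l : ℝ) :
    Tendsto (fun ε : ℝ => discriminant q a (l + ε * Complex.I)) (𝓝[>] 0)
      (𝓝 (discriminant q a l)) := by
  refine (hk.continuousOn_discriminant (l : ℂ) (by simp)).tendsto.comp
    (tendsto_nhdsWithin_iff.2 ⟨?_, ?_⟩)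
  · have : Continuous fun ε : ℝ => (l : ℂ) + ε * Complex.I := by fun_prop
    have h3 := this.tendsto 0
    simp only [Complex.ofReal_zero, zero_mul, add_zero] at h3
    exact h3.mono_left nhdsWithin_le_nhds
  · filter_upwards [self_mem_nhdsWithin] with ε hε
    have hε' : (0 : ℝ) < ε := hε
    simpa using hε'.le

lemma norm_vertical_le {l ε : ℝ} (h0 : 0 < ε) (h1 : ε < 1) :
    ‖(l : ℂ) + ε * Complex.I‖ ≤ |l| + 1 := by
  refine (norm_add_le _ _).trans ?_
  rw [norm_mul, Complex.norm_I, Complex.norm_real, Complex.norm_real, Real.norm_eq_abs,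
    Real.norm_eq_abs, abs_of_pos h0]
  linarith

/-- The discriminant is real on the real axis. It is the limit of its values at `l + iε`, and there
it differs little from its conjugate because conjugation turns solutions at `l + iε` into solutions
at `l - iε`. -/
lemma IsQuasimomentum.discriminant_im_eq_zero (ha : 0 < a)
    (hq : ∀ s t, IntervalIntegrable q volume s t) (hk : IsQuasimomentum q a k)
    (hE : ∀ z : ℂ, 0 < z.im → CauchySolvable q z) (l : ℝ) : (discriminant q a l).im = 0 := by
  obtain ⟨C, hC, hst⟩ := exists_stability ha hq (|l| + 1)
  have htend := tendsto_discriminant_vertical hk l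
  have hlim : Tendsto (fun ε : ℝ => discriminant q a (l + ε * Complex.I) -
      (starRingEnd ℂ) (discriminant q a (l + ε * Complex.I))) (𝓝[>] 0) (𝓝 0) := by
    refine squeeze_zero_norm' (a := fun ε : ℝ => C * (2 * ε) + C * (2 * ε)) ?_ ?_
    · filter_upwards [Ioo_mem_nhdsGT (zero_lt_one (α := ℝ))] with ε hε
      have hz : 0 < ((l : ℂ) + ε * Complex.I).im := by simpa using hε.1
      have hn := norm_vertical_le (l := l) hε.1 hε.2
      have hn' : ‖(starRingEnd ℂ) ((l : ℂ) + ε * Complex.I)‖ ≤ |l| + 1 := by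
        rwa [RCLike.norm_conj]
      have hd : ‖((l : ℂ) + ε * Complex.I) - (starRingEnd ℂ) ((l : ℂ) + ε * Complex.I)‖ =
          2 * ε := by
        have : ((l : ℂ) + ε * Complex.I) - (starRingEnd ℂ) ((l : ℂ) + ε * Complex.I) =
            ((2 * ε : ℝ) : ℂ) * Complex.I := by
          simp
          ring
        rw [this, norm_mul, Complex.norm_I, mul_one, Complex.norm_real, Real.norm_eq_abs,
          abs_of_pos (by linarith [hε.1])]
      have hdc : ∀ (y : ℝ → ℂ) (x : ℝ), deriv (fun x => (starRingEnd ℂ) (y x)) x =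
          (starRingEnd ℂ) (deriv y x) := fun y x => deriv.star (f := y) (x := x)
      obtain ⟨h1, h10, h11⟩ := (hE _ hz).spec 1 0
      obtain ⟨h2, h20, h21⟩ := (hE _ hz).spec 0 1
      have s1 := hst _ _ _ _ hn hn' h1 h1.conj a ⟨ha.le, le_rfl⟩
      have s2 := hst _ _ _ _ hn hn' h2 h2.conj a ⟨ha.le, le_rfl⟩
      simp only [hdc, h10, h11, h20, h21, hd, map_one, map_zero, sub_self, norm_zero, norm_one,
        zero_add, add_zero, mul_one] at s1 s2
      rw [discriminant_eq, map_add, add_sub_add_comm]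
      refine (norm_add_le _ _).trans (add_le_add ?_ ?_)
      · exact (le_add_of_nonneg_right (norm_nonneg _)).trans s1
      · exact (le_add_of_nonneg_left (norm_nonneg _)).trans s2
    · have : Continuous fun ε : ℝ => C * (2 * ε) + C * (2 * ε) := by fun_prop
      have h3 := this.tendsto 0
      simp only [mul_zero, add_zero] at h3
      exact h3.mono_left nhdsWithin_le_nhds
  have h0 := tendsto_nhds_unique hlim (htend.sub ((Complex.continuous_conj.tendsto _).comp htend))
  have h1 := congrArg Complex.im h0
  simp only [Complex.zero_im, Complex.sub_im, Complex.conj_im] at h1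
  linarith

lemma IsSolution.comp_neg {y : ℝ → ℂ} (h : IsSolution q z y) :
    IsSolution (fun x => q (-x)) z (fun x => y (-x)) := by
  have hd : ∀ x, HasDerivAt (fun x => y (-x)) (-deriv y (-x)) x := fun x => by
    simpa [Function.comp_def] using (h.1 (-x)).hasDerivAt.scomp x (hasDerivAt_neg x)
  refine ⟨fun x => (hd x).differentiableAt, fun x => ?_⟩
  rw [(hd x).deriv, (hd 0).deriv, h.2 (-x), neg_zero,
    intervalIntegral.integral_comp_neg (fun t => ((q t : ℂ) - z) * y t), neg_zero,
    intervalIntegral.integral_symm]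
  ring

/-- A solution with vanishing Cauchy data vanishes. -/
lemma IsSolution.eq_zero {y : ℝ → ℂ} (hq : ∀ s t, IntervalIntegrable q volume s t)
    (h : IsSolution q z y) (h0 : y 0 = 0) (h1 : deriv y 0 = 0) : y = 0 := by
  have pos : ∀ (q : ℝ → ℝ) (y : ℝ → ℂ), (∀ s t, IntervalIntegrable q volume s t) →
      IsSolution q z y → y 0 = 0 → deriv y 0 = 0 → ∀ x, 0 < x → y x = 0 := by
    intro q y hq h h0 h1 x hx
    obtain ⟨C, -, hst⟩ := exists_stability hx hq ‖z‖
    have := hst z z y (fun _ => 0) le_rfl le_rfl h isSolution_zero x ⟨hx.le, le_rfl⟩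
    simp only [h0, h1, sub_zero, deriv_const, sub_self, norm_zero, add_zero,
      mul_zero] at this
    exact norm_eq_zero.1 (le_antisymm (by linarith [norm_nonneg (deriv y x)]) (norm_nonneg _))
  funext x
  rcases lt_trichotomy x 0 with hx | rfl | hx
  · have hd : deriv (fun x => y (-x)) 0 = 0 := by
      rw [deriv_comp_neg, neg_zero, h1, neg_zero]
    have hq' : ∀ s t, IntervalIntegrable (fun x => q (-x)) volume s t := fun s t =>
      (IntervalIntegrable.iff_comp_neg (f := fun x => q (-x))).2 (by simpa using hq (-s) (-t))
    simpa using pos _ _ hq' h.comp_neg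
      (by simpa using h0) hd (-x) (by linarith)
  · exact h0
  · exact pos q y hq h h0 h1 x hx

/-- At an antiperiodic eigenvalue the discriminant equals `-2`. The monodromy matrix at `l + iε` has
determinant `1`, and adding the identity to it almost annihilates the Cauchy data of the
antiperiodic eigenfunction. -/
lemma IsQuasimomentum.discriminant_eq_neg_two (ha : 0 < a)
    (hq : ∀ s t, IntervalIntegrable q volume s t) (hk : IsQuasimomentum q a k)
    (hE : ∀ z : ℂ, 0 < z.im → CauchySolvable q z) {l : ℝ}
    (hl : l ∈ antiperiodicEigenvalues q a) : discriminant q a l = -2 := by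
  obtain ⟨y, hy, hy0, hya, hya'⟩ := hl
  obtain ⟨C, hC, hst⟩ := exists_stability ha hq (|l| + 1)
  set v := ‖y 0‖ + ‖deriv y 0‖ with hv
  have hvpos : 0 < v := by
    by_contra hcon
    have h1 := norm_nonneg (y 0)
    have h2 := norm_nonneg (deriv y 0)
    exact hy0 (hy.eq_zero hq (norm_eq_zero.1 (by linarith)) (norm_eq_zero.1 (by linarith)))
  have hlim : Tendsto (fun ε : ℝ => discriminant q a (l + ε * Complex.I) - (-2)) (𝓝[>] 0)
      (𝓝 0) := by
    refine squeeze_zero_norm' (a := fun ε : ℝ => 2 * (2 * C + 1) * (C * ε)) ?_ ?_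
    · filter_upwards [Ioo_mem_nhdsGT (zero_lt_one (α := ℝ))] with ε hε
      have hz : 0 < ((l : ℂ) + ε * Complex.I).im := by simpa using hε.1
      have hn := norm_vertical_le (l := l) hε.1 hε.2
      have hn' : ‖(l : ℂ)‖ ≤ |l| + 1 := by
        rw [Complex.norm_real, Real.norm_eq_abs]
        linarith
      have hd : ‖(l : ℂ) + ε * Complex.I - l‖ = ε := by
        rw [add_sub_cancel_left, norm_mul, Complex.norm_I, mul_one, Complex.norm_real,
          Real.norm_eq_abs, abs_of_pos hε.1]
      obtain ⟨h1, h10, h11⟩ := (hE _ hz).spec 1 0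
      obtain ⟨h2, h20, h21⟩ := (hE _ hz).spec 0 1
      have haa : a ∈ Icc 0 a := ⟨ha.le, le_rfl⟩
      have s1 := hst _ _ _ _ hn hn h1 isSolution_zero a haa
      have s2 := hst _ _ _ _ hn hn h2 isSolution_zero a haa
      have s3 := hst _ _ _ _ hn hn' (h1.linear_combination hq h2 (y 0) (deriv y 0)) hy a haa
      have hw := h1.wronskian_const hq h2 a
      have hderiv : ∀ x, deriv (fun x => y 0 * cauchySolution q (l + ε * Complex.I) 1 0 x +
          deriv y 0 * cauchySolution q (l + ε * Complex.I) 0 1 x) x =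
          y 0 * deriv (cauchySolution q (l + ε * Complex.I) 1 0) x +
          deriv y 0 * deriv (cauchySolution q (l + ε * Complex.I) 0 1) x := fun x =>
        (((h1.1 x).hasDerivAt.const_mul _).add ((h2.1 x).hasDerivAt.const_mul _)).deriv
      simp only [hderiv, h10, h11, h20, h21, hya, hya', hd, deriv_const, sub_zero, sub_self,
        norm_zero, norm_one, zero_add, add_zero, mul_one, mul_zero, sub_neg_eq_add] at s1 s2 s3 hw
      rw [discriminant_eq]
      set c := cauchySolution q (l + ε * Complex.I) 1 0 a
      set s := cauchySolution q (l + ε * Complex.I) 0 1 a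
      set c' := deriv (cauchySolution q (l + ε * Complex.I) 1 0) a
      set s' := deriv (cauchySolution q (l + ε * Complex.I) 0 1) a
      set e₁ := y 0 * c + deriv y 0 * s + y 0
      set e₂ := y 0 * c' + deriv y 0 * s' + deriv y 0
      rw [← hv] at s3
      -- With `D` the monodromy matrix, `(e₁, e₂)` is `D + 1` applied to the Cauchy data of `y`, and
      -- the adjugate of `D + 1` times `D + 1` is `det (D + 1) = tr D + 2`.
      have i1 : (c + s' - -2) * y 0 = (s' + 1) * e₁ - s * e₂ := by
        simp only [e₁, e₂]
        linear_combination -y 0 * hw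
      have i2 : (c + s' - -2) * deriv y 0 = (c + 1) * e₂ - c' * e₁ := by
        simp only [e₁, e₂]
        linear_combination -deriv y 0 * hw
      have hc := norm_nonneg c
      have hc' := norm_nonneg c'
      have hs := norm_nonneg s
      have hs' := norm_nonneg s'
      have he₁ := norm_nonneg e₁
      have he₂ := norm_nonneg e₂
      have j1 : ‖c + s' - -2‖ * ‖y 0‖ ≤ (2 * C + 1) * (C * (ε * v)) := by
        rw [← norm_mul, i1]
        calc _ ≤ ‖s' + 1‖ * ‖e₁‖ + ‖s‖ * ‖e₂‖ := by
              rw [← norm_mul, ← norm_mul]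
              exact norm_sub_le _ _
          _ ≤ (C + 1) * ‖e₁‖ + C * ‖e₂‖ := by
              gcongr
              · refine (norm_add_le _ _).trans ?_
                rw [norm_one]
                linarith
              · linarith
          _ ≤ _ := by nlinarith
      have j2 : ‖c + s' - -2‖ * ‖deriv y 0‖ ≤ (2 * C + 1) * (C * (ε * v)) := by
        rw [← norm_mul, i2]
        calc _ ≤ ‖c + 1‖ * ‖e₂‖ + ‖c'‖ * ‖e₁‖ := by
              rw [← norm_mul, ← norm_mul]
              exact norm_sub_le _ _
          _ ≤ (C + 1) * ‖e₂‖ + C * ‖e₁‖ := by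
              gcongr
              · refine (norm_add_le _ _).trans ?_
                rw [norm_one]
                linarith
              · linarith
          _ ≤ _ := by nlinarith
      refine le_of_mul_le_mul_right ?_ hvpos
      rw [hv, mul_add, ← hv]
      linarith
    · have : Continuous fun ε : ℝ => 2 * (2 * C + 1) * (C * ε) := by fun_prop
      have h3 := this.tendsto 0
      simp only [mul_zero] at h3
      exact h3.mono_left nhdsWithin_le_nhds
  have h0 := tendsto_nhds_unique hlim
    ((tendsto_discriminant_vertical hk l).sub tendsto_const_nhds)
  linear_combination -h0

end Discriminant

/-! ### The quasi-momentum on the real axis -/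

section RealAxis

variable {q : ℝ → ℝ} {a : ℝ} {k : ℂ → ℂ}

lemma re_im_two_mul_cos (v : ℂ) : (2 * Complex.cos v).re = 2 * (Real.cos v.re * Real.cosh v.im) ∧
    (2 * Complex.cos v).im = -(2 * (Real.sin v.re * Real.sinh v.im)) := by
  rw [Complex.cos_eq v, ← Complex.ofReal_cos, ← Complex.ofReal_cosh, ← Complex.ofReal_sin,
    ← Complex.ofReal_sinh, ← Complex.ofReal_mul, ← Complex.ofReal_mul]
  constructor <;> simp [-Complex.ofReal_mul, -Complex.ofReal_cos, -Complex.ofReal_cosh,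
    -Complex.ofReal_sin, -Complex.ofReal_sinh]

lemma IsQuasimomentum.discriminant_eq_two_mul_cos (hk : IsQuasimomentum q a k) {z : ℂ}
    (hz : 0 ≤ z.im) : discriminant q a z = 2 * Complex.cos (k z) := by
  rw [← hk.exp_add_exp z hz, Complex.cos]
  ring_nf

lemma IsQuasimomentum.continuous_real (hk : IsQuasimomentum q a k) :
    Continuous fun x : ℝ => k x :=
  continuousOn_univ.1 (hk.continuousOn.comp Complex.continuous_ofReal.continuousOn
    fun x _ => by simp)

lemma IsQuasimomentum.im_nonneg (hk : IsQuasimomentum q a k) {z : ℂ} (hz : 0 ≤ z.im) :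
    0 ≤ (k z).im := by
  have h1 : Tendsto (fun ε : ℝ => (k (z + ε * Complex.I)).im) (𝓝[>] 0) (𝓝 (k z).im) := by
    refine (Complex.continuous_im.tendsto _).comp ((hk.continuousOn z hz).tendsto.comp
      (tendsto_nhdsWithin_iff.2 ⟨?_, ?_⟩))
    · have : Continuous fun ε : ℝ => z + ε * Complex.I := by fun_prop
      have h3 := this.tendsto 0
      simp only [Complex.ofReal_zero, zero_mul, add_zero] at h3
      exact h3.mono_left nhdsWithin_le_nhds
    · filter_upwards [self_mem_nhdsWithin] with ε hε
      have hε' : (0 : ℝ) < ε := hε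
      simp only [Complex.add_im, Complex.mul_im, Complex.ofReal_re, Complex.I_im,
        mul_one, Complex.ofReal_im, Complex.I_re, mul_zero, add_zero]
      linarith
  refine ge_of_tendsto h1 ?_
  filter_upwards [self_mem_nhdsWithin] with ε hε
  have hε' : (0 : ℝ) < ε := hε
  exact (hk.im_pos _ (by simp; linarith)).le

/-- The imaginary part of the discriminant `2 cos k` vanishes on the real axis. -/
lemma IsQuasimomentum.sin_mul_sinh_eq_zero (hk : IsQuasimomentum q a k)
    (hreal : ∀ l : ℝ, (discriminant q a l).im = 0) (l : ℝ) :
    Real.sin (k l).re * Real.sinh (k l).im = 0 := by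
  have h1 := hreal l
  rw [hk.discriminant_eq_two_mul_cos (by simp), (re_im_two_mul_cos _).2] at h1
  linarith

lemma IsQuasimomentum.im_eq_zero_of_mem_bands (hk : IsQuasimomentum q a k) {l : ℝ}
    (hl : l ∈ bands q a) : (k l).im = 0 := by
  obtain ⟨d, hd, hd2⟩ := hl
  rw [hk.discriminant_eq_two_mul_cos (by simp)] at hd
  have h1 := congrArg Complex.re hd
  have h2 := congrArg Complex.im hd
  rw [(re_im_two_mul_cos _).1, Complex.ofReal_re] at h1
  rw [(re_im_two_mul_cos _).2, Complex.ofReal_im] at h2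
  by_contra him
  have h3 : Real.sin (k l).re = 0 := by
    have : Real.sinh (k l).im ≠ 0 := fun h => him (Real.sinh_eq_zero.1 h)
    have h4 : Real.sin (k l).re * Real.sinh (k l).im = 0 := by linarith
    exact (mul_eq_zero.1 h4).resolve_right this
  have h4 : 1 < Real.cosh (k l).im := Real.one_lt_cosh.2 him
  have h5 : |Real.cos (k l).re| = 1 := Real.abs_cos_eq_one_iff.2 (by
    obtain ⟨n, hn⟩ := Real.sin_eq_zero_iff.1 h3
    exact ⟨n, hn⟩)
  rw [← h1, abs_mul, abs_mul, h5, abs_two, abs_of_pos (by linarith)] at hd2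
  linarith

/-- Where the quasi-momentum is real, it is nondecreasing. Integrating `k` around the rectangle
`[x₁, x₂] × [0, h]`, the two horizontal sides contribute to the imaginary part with a sign, because
`Im k ≥ 0` on the upper one and `Im k = 0` on the lower one; then `h → 0`. -/
lemma IsQuasimomentum.re_le_re (hk : IsQuasimomentum q a k) {x₁ x₂ : ℝ} (hx : x₁ ≤ x₂)
    (him : ∀ x ∈ Icc x₁ x₂, (k x).im = 0) : (k x₁).re ≤ (k x₂).re := by
  have hvert : ∀ x : ℝ, ContinuousOn (fun y : ℝ => k (x + y * Complex.I)) (Ici 0) := fun x =>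
    hk.continuousOn.comp (Continuous.continuousOn (by fun_prop)) fun y hy => by simpa using hy
  have hhor : ∀ h : ℝ, 0 ≤ h → Continuous (fun x : ℝ => k (x + h * Complex.I)) := fun h hh =>
    continuousOn_univ.1 (hk.continuousOn.comp (Continuous.continuousOn (by fun_prop))
      fun x _ => by simpa using hh)
  have hint : ∀ h : ℝ, 0 < h →
      0 ≤ ∫ y in (0 : ℝ)..h, ((k (x₂ + y * Complex.I)).re - (k (x₁ + y * Complex.I)).re) := by
    intro h hh
    have hv : ∀ x : ℝ, IntervalIntegrable (fun y : ℝ => k (x + y * Complex.I)) volume 0 h :=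
      fun x => ((hvert x).mono (by
        rw [uIcc_of_le hh.le]
        exact Icc_subset_Ici_self)).intervalIntegrable
    have hc := Complex.integral_boundary_rect_eq_zero_of_continuousOn_of_differentiableOn k
      (x₁ : ℂ) (x₂ + h * Complex.I)
      (hk.continuousOn.mono fun z hz => by
        have := hz.2
        simp only [Complex.ofReal_im, Complex.add_im, Complex.mul_im, Complex.ofReal_re,
          Complex.I_im, mul_one, Complex.I_re, mul_zero, add_zero, zero_add,
          uIcc_of_le hh.le, mem_preimage] at this
        exact this.1)
      (hk.differentiableOn.mono fun z hz => by
        have := hz.2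
        simp only [Complex.ofReal_im, Complex.add_im, Complex.mul_im, Complex.ofReal_re,
          Complex.I_im, mul_one, Complex.I_re, mul_zero, add_zero, zero_add,
          min_eq_left hh.le, mem_preimage] at this
        exact this.1)
    have him' := congrArg Complex.im hc
    simp only [Complex.ofReal_re, Complex.ofReal_im, Complex.add_re, Complex.add_im,
      Complex.mul_re, Complex.mul_im, Complex.I_re, Complex.I_im, mul_zero, mul_one, sub_zero,
      add_zero, zero_add, zero_mul, Complex.ofReal_zero, Complex.sub_im, smul_eq_mul, one_mul,
      Complex.zero_im] at him'
    have c1 := Complex.imCLM.intervalIntegral_comp_comm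
      (hk.continuous_real.intervalIntegrable (μ := volume) x₁ x₂)
    have c2 := Complex.imCLM.intervalIntegral_comp_comm
      ((hhor h hh.le).intervalIntegrable (μ := volume) x₁ x₂)
    have c3 := Complex.reCLM.intervalIntegral_comp_comm (hv x₁)
    have c4 := Complex.reCLM.intervalIntegral_comp_comm (hv x₂)
    simp only [Complex.imCLM_apply, Complex.reCLM_apply] at c1 c2 c3 c4
    rw [← c1, ← c2, ← c3, ← c4] at him'
    have z1 : ∫ x in x₁..x₂, (k x).im = 0 := by
      rw [intervalIntegral.integral_congr (g := fun _ => 0)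
        (fun x hx' => him x (by rwa [uIcc_of_le hx] at hx'))]
      simp
    have z2 : 0 ≤ ∫ x in x₁..x₂, (k (x + h * Complex.I)).im :=
      intervalIntegral.integral_nonneg hx fun x _ => hk.im_nonneg (by simpa using hh.le)
    have hre : ∀ x : ℝ, IntervalIntegrable (fun y : ℝ => (k (x + y * Complex.I)).re) volume 0 h :=
      fun x => ⟨(hv x).1.re, (hv x).2.re⟩
    rw [intervalIntegral.integral_sub (hre x₂) (hre x₁)]
    linarith
  by_contra! hlt
  set Φ : ℝ → ℝ := fun y => (k (x₂ + y * Complex.I)).re - (k (x₁ + y * Complex.I)).re with hΦ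
  have hΦc : ContinuousOn Φ (Ici 0) :=
    (Complex.continuous_re.comp_continuousOn (hvert x₂)).sub
      (Complex.continuous_re.comp_continuousOn (hvert x₁))
  have hΦ0 : Φ 0 < 0 := by
    simp only [hΦ, Complex.ofReal_zero, zero_mul, add_zero]
    linarith
  have hev := (hΦc 0 self_mem_Ici).eventually (gt_mem_nhds hΦ0)
  obtain ⟨h, hh, hneg⟩ := mem_nhdsGE_iff_exists_Icc_subset.1 hev
  have hh' : (0 : ℝ) < h := hh
  have h1 := hint h hh'
  have h2 : 0 < ∫ y in (0 : ℝ)..h, -Φ y :=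
    intervalIntegral.intervalIntegral_pos_of_pos_on
      ((hΦc.mono (by
        rw [uIcc_of_le hh'.le]
        exact Icc_subset_Ici_self)).intervalIntegrable.neg)
      (fun y hy => neg_pos.2 (hneg ⟨hy.1.le, hy.2.le⟩)) hh'
  rw [intervalIntegral.integral_neg] at h2
  linarith

/-- `Re k` cannot become negative to the right of a zero of `k`: on the way down it would cross an
interval free of points of `π ℤ`, above which `k` is real, hence nondecreasing. -/
lemma IsQuasimomentum.re_nonneg_of_le (hk : IsQuasimomentum q a k)
    (hreal : ∀ l : ℝ, (discriminant q a l).im = 0) {l₀ x : ℝ} (h0 : k l₀ = 0) (hx : l₀ ≤ x) :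
    0 ≤ (k x).re := by
  by_contra! hneg
  set r : ℝ → ℝ := fun x => (k x).re with hr
  have hrc : Continuous r := Complex.continuous_re.comp hk.continuous_real
  have hr0 : r l₀ = 0 := by simp [hr, h0]
  have hm1 : r x ≤ max (r x) (-Real.pi) := le_max_left _ _
  have hm2 : -Real.pi ≤ max (r x) (-Real.pi) := le_max_right _ _
  have hm3 : max (r x) (-Real.pi) < 0 := max_lt hneg (by linarith [Real.pi_pos])
  obtain ⟨v₂, hv2, hv2'⟩ := exists_between hm3
  obtain ⟨v₁, hv1, hv1'⟩ := exists_between hv2'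
  -- the last point where `r = v₁`, and the first one after it where `r = v₂`
  have hne1 : (Icc l₀ x ∩ r ⁻¹' {v₁}).Nonempty := by
    obtain ⟨y, hy, hy'⟩ := intermediate_value_Icc' hx hrc.continuousOn
      (show v₁ ∈ Icc (r x) (r l₀) from ⟨by linarith, by linarith⟩)
    exact ⟨y, hy, hy'⟩
  obtain ⟨x₁, ⟨hx1, hrx1⟩, hmax⟩ := (isCompact_Icc.inter_right
    (isClosed_singleton.preimage hrc)).exists_isGreatest hne1
  simp only [mem_preimage, mem_singleton_iff] at hrx1
  have hne2 : (Icc x₁ x ∩ r ⁻¹' {v₂}).Nonempty := by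
    obtain ⟨y, hy, hy'⟩ := intermediate_value_Icc' hx1.2 hrc.continuousOn
      (show v₂ ∈ Icc (r x) (r x₁) from ⟨by linarith, by linarith⟩)
    exact ⟨y, hy, hy'⟩
  obtain ⟨x₂, ⟨hx2, hrx2⟩, hmin⟩ := (isCompact_Icc.inter_right
    (isClosed_singleton.preimage hrc)).exists_isLeast hne2
  simp only [mem_preimage, mem_singleton_iff] at hrx2
  have hmem : ∀ y ∈ Icc x₁ x₂, r y ∈ Icc v₂ v₁ := by
    intro y hy
    constructor
    · by_contra! hlt
      obtain ⟨s, hs, hs'⟩ := intermediate_value_Icc' hy.1 hrc.continuousOn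
        (show v₂ ∈ Icc (r y) (r x₁) from ⟨hlt.le, by linarith⟩)
      have h1 := hmin ⟨⟨hs.1, hs.2.trans (hy.2.trans hx2.2)⟩, hs'⟩
      have h2 : y = x₂ := by linarith [hs.2, hy.2]
      rw [h2, hrx2] at hlt
      exact lt_irrefl _ hlt
    · by_contra! hlt
      obtain ⟨s, hs, hs'⟩ := intermediate_value_Icc' (hy.2.trans hx2.2) hrc.continuousOn
        (show v₁ ∈ Icc (r x) (r y) from ⟨by linarith, hlt.le⟩)
      have h1 := hmax ⟨⟨hx1.1.trans (hy.1.trans hs.1), hs.2⟩, hs'⟩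
      have h2 : y = x₁ := by linarith [hs.1, hy.1]
      rw [h2, hrx1] at hlt
      exact lt_irrefl _ hlt
  have h1 := hk.re_le_re hx2.1 fun y hy => by
    obtain ⟨h2, h3⟩ := hmem y hy
    have hs : Real.sin (k y).re < 0 := Real.sin_neg_of_neg_of_neg_pi_lt (by linarith [hv1'])
      (by linarith)
    exact Real.sinh_eq_zero.1 ((mul_eq_zero.1 (hk.sin_mul_sinh_eq_zero hreal y)).resolve_left hs.ne)
  change r x₁ ≤ r x₂ at h1
  linarith

/-- The bands lie to the right of the lowest periodic eigenvalue: the discriminant tends to `+∞` at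
`-∞`, so to the left of a band point there is a point at which it equals `2`, and such a point is a
periodic eigenvalue. -/
lemma IsQuasimomentum.lowest_lt (ha : 0 < a) (hq : ∀ s t, IntervalIntegrable q volume s t)
    (hk : IsQuasimomentum q a k) {S : Set ℂ} {ψp ψm : ℝ → ℂ → ℂ}
    (hψ : IsBlochPair q a k S ψp ψm) {l₀ μ : ℝ} (hl₀ : IsLeast (periodicEigenvalues q a) l₀)
    (hμ : μ ∈ bands q a \ bandEdges q a) : l₀ < μ := by
  have hE : ∀ z : ℂ, 0 < z.im → CauchySolvable q z := fun z hz =>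
    hψ.cauchySolvable hq (Or.inl (Or.inl hz))
  by_contra! hle
  have hlt : μ < l₀ := lt_of_le_of_ne hle fun h => hμ.2 (Or.inl (h ▸ hl₀.1))
  obtain ⟨C, hC, hasym⟩ := hk.exists_asymptotics ha hq hE
  have hDc : Continuous fun x : ℝ => (discriminant q a x).re :=
    Complex.continuous_re.comp (continuousOn_univ.1 (hk.continuousOn_discriminant.comp
      Complex.continuous_ofReal.continuousOn fun x _ => by simp))
  set s : ℝ := 1 + 2 * C + 4 / a + |μ| with hs
  have h4a : 0 < 4 / a := by positivity
  have hs1 : 1 ≤ s := by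
    rw [hs]
    linarith [abs_nonneg μ]
  have hsC : 2 * C ≤ s := by
    rw [hs]
    linarith [abs_nonneg μ]
  have hsa : 4 ≤ a * s := by
    have : 4 / a ≤ s := by
      rw [hs]
      linarith [abs_nonneg μ]
    rwa [div_le_iff₀' ha] at this
  have hsμ : -s ^ 2 ≤ μ := by
    have h1 : |μ| ≤ s := by
      rw [hs]
      linarith
    nlinarith [neg_abs_le μ]
  have hbig : 2 ≤ (discriminant q a ((-s ^ 2 : ℝ) : ℂ)).re := by
    have h1 := hasym (s * Complex.I) (by simp) (by simp; linarith)
      (by simpa [abs_of_nonneg (by linarith : 0 ≤ s)] using hs1)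
    have h2 : ((s : ℂ) * Complex.I) ^ 2 = ((-s ^ 2 : ℝ) : ℂ) := by
      rw [mul_pow, Complex.I_sq]
      push_cast
      ring
    have h3 : (2 * Complex.cos ((s : ℂ) * Complex.I * a)).re = 2 * Real.cosh (s * a) := by
      rw [(re_im_two_mul_cos _).1]
      simp
    have h4 : ‖(s : ℂ) * Complex.I‖ = s := by
      simp [abs_of_nonneg (by linarith : 0 ≤ s)]
    have h5 : ((s : ℂ) * Complex.I).im = s := by simp
    rw [h2, h4, h5] at h1
    have h6 := (Complex.abs_re_le_norm _).trans h1
    rw [Complex.sub_re, h3] at h6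
    have h7 := (abs_le.1 h6).1
    have h8 : C * Real.exp (a * s) / s ≤ Real.exp (a * s) / 2 := by
      rw [div_le_div_iff₀ (by linarith) two_pos]
      nlinarith [Real.exp_pos (a * s)]
    have h9 : Real.exp (a * s) ≤ 2 * Real.cosh (s * a) := by
      rw [Real.cosh_eq, mul_comm s a]
      linarith [Real.exp_pos (-(a * s))]
    linarith [Real.add_one_le_exp (a * s)]
  have hsmall : (discriminant q a (μ : ℂ)).re ≤ 2 := by
    obtain ⟨d, hd, hd2⟩ := hμ.1
    rw [hd, Complex.ofReal_re]
    exact (abs_le.1 hd2).2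
  obtain ⟨l, hl, hl2⟩ := intermediate_value_Icc' hsμ hDc.continuousOn
    (show (2 : ℝ) ∈ Icc _ _ from ⟨hsmall, hbig⟩)
  have hD : discriminant q a l = 2 :=
    Complex.ext (by simpa using hl2) (by simpa using hk.discriminant_im_eq_zero ha hq hE l)
  have hband : l ∈ bands q a := ⟨2, by simpa using hD, by simp⟩
  have hedge : l ∈ bandEdges q a := by
    by_contra hne
    have hz : (l : ℂ) ∈ blochDomain q a S := Or.inl (Or.inr ⟨l, ⟨hband, hne⟩, rfl⟩)
    -- a root of `w + 1 / w = 2` is `1`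
    have hexp : Complex.exp (Complex.I * k l) = 1 := by
      have h1 := hk.exp_add_exp l (by simp)
      rw [hD, Complex.exp_neg] at h1
      have h2 := Complex.exp_ne_zero (Complex.I * k l)
      field_simp at h1
      have h3 : (Complex.exp (Complex.I * k l) - 1) ^ 2 = 0 := by linear_combination h1
      exact sub_eq_zero.1 (pow_eq_zero_iff two_ne_zero |>.1 h3)
    have hper : ∀ x : ℝ, ψp (x + a) l = ψp x l := fun x => by
      rw [hψ.floquet_p l hz x, hexp, one_mul]
    refine hne (Or.inl ⟨fun x => ψp x l, hψ.solution_p l hz, fun h => ?_, ?_, ?_⟩)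
    · refine hψ.wronskian_ne_zero l hz ?_
      rw [wronskian, h, show ψp 0 l = 0 from congrFun h 0]
      simp
    · simpa using hper 0
    · have h1 : (fun x : ℝ => ψp (x + a) l) = fun x => ψp x l := funext hper
      have h2 := congrArg (fun f => deriv f 0) h1
      simpa [deriv_comp_add_const (fun x => ψp x l)] using h2
  rcases hedge with h | h
  · exact absurd (hl₀.2 h) (not_le.2 (hl.2.trans_lt hlt))
  · rw [hk.discriminant_eq_neg_two ha hq hE h] at hD
    norm_num at hD

lemma IsQuasimomentum.re_nonneg_of_mem_bands (ha : 0 < a)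
    (hq : ∀ s t, IntervalIntegrable q volume s t)
    (hk : IsQuasimomentum q a k) {S : Set ℂ} {ψp ψm : ℝ → ℂ → ℂ}
    (hψ : IsBlochPair q a k S ψp ψm) {μ : ℝ} (hμ : μ ∈ bands q a \ bandEdges q a) :
    0 ≤ (k μ).re := by
  obtain ⟨l₀, hl₀, hkl₀⟩ := hk.lowest
  exact hk.re_nonneg_of_le (hk.discriminant_im_eq_zero ha hq fun z hz =>
    hψ.cauchySolvable hq (Or.inl (Or.inl hz))) hkl₀ (hk.lowest_lt ha hq hψ hl₀ hμ).le

end RealAxis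

/-! ### The quasi-momentum at infinity -/

section Proper

variable {q : ℝ → ℝ} {a : ℝ} {k : ℂ → ℂ}

/-- If `e^{iu}` is relatively close to `e^{iv}`, then their arguments differ by less than a quarter
of a turn. -/
lemma cos_re_sub_re_pos {u v : ℂ}
    (h : ‖Complex.exp (Complex.I * u) - Complex.exp (Complex.I * v)‖ <
      ‖Complex.exp (Complex.I * v)‖) : 0 < Real.cos (u.re - v.re) := by
  have hv := norm_pos_iff.2 (Complex.exp_ne_zero (Complex.I * v))
  have h1 : ‖Complex.exp (Complex.I * (u - v)) - 1‖ < 1 := by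
    rw [mul_sub, Complex.exp_sub, div_sub_one (Complex.exp_ne_zero _), norm_div, div_lt_one hv]
    exact h
  have h2 := (Complex.abs_re_le_norm _).trans_lt h1
  rw [Complex.sub_re, Complex.one_re, Complex.exp_re] at h2
  have h3 := (abs_lt.1 h2).1
  have h4 : (Complex.I * (u - v)).im = u.re - v.re := by simp
  rw [h4] at h3
  exact pos_of_mul_pos_right (by linarith) (Real.exp_pos _).le

/-- A continuous function that avoids a coset of `2π ℤ` varies by at most `2π`. -/
lemma abs_sub_le_two_pi_of_avoids {r : ℝ → ℝ} {s t v : ℝ} (hr : ContinuousOn r (uIcc s t))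
    (hv : ∀ x ∈ uIcc s t, ∀ m : ℤ, r x ≠ v + m * (2 * Real.pi)) : |r s - r t| ≤ 2 * Real.pi := by
  by_contra! hlt
  have hpi : 0 < 2 * Real.pi := by positivity
  set m := ⌈(min (r s) (r t) - v) / (2 * Real.pi)⌉ with hm
  have h1 := Int.le_ceil ((min (r s) (r t) - v) / (2 * Real.pi))
  have h2 := Int.ceil_lt_add_one ((min (r s) (r t) - v) / (2 * Real.pi))
  rw [← hm] at h1 h2
  rw [div_le_iff₀ hpi] at h1
  rw [← sub_lt_iff_lt_add, lt_div_iff₀ hpi] at h2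
  have h3 : |r s - r t| = max (r s) (r t) - min (r s) (r t) := (max_sub_min_eq_abs' _ _).symm
  obtain ⟨x, hx, hx'⟩ := intermediate_value_uIcc hr
    (show v + m * (2 * Real.pi) ∈ uIcc (r s) (r t) from ⟨by linarith, by linarith⟩)
  exact hv x hx m hx'

lemma exists_sq_eq_of_im_nonneg {z : ℂ} (hz : 0 ≤ z.im) :
    ∃ w : ℂ, 0 ≤ w.re ∧ 0 ≤ w.im ∧ w ^ 2 = z := by
  obtain ⟨w, hw⟩ := IsAlgClosed.exists_pow_nat_eq z two_pos
  have him : 0 ≤ w.re * w.im := by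
    rw [← hw, sq, Complex.mul_im] at hz
    linarith
  rcases mul_nonneg_iff.1 him with ⟨h1, h2⟩ | ⟨h1, h2⟩
  · exact ⟨w, h1, h2, hw⟩
  · exact ⟨-w, by simpa using h1, by simpa using h2, by rw [neg_sq, hw]⟩

lemma norm_exp_I_mul (v : ℂ) : ‖Complex.exp (Complex.I * v)‖ = Real.exp (-v.im) := by
  rw [Complex.norm_exp]
  simp

/-- Sublevel sets of the quasi-momentum are bounded. Let `F w = k (w²)`, for `w` in the closed first
quadrant. A bound on `Im k` confines `w` to a strip, where the asymptotics of the discriminant give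
`|e^{iF} - e^{iaw}| |e^{iF} - e^{-iaw}| = O(1 / |w|)`, so that `Re F` is close to `± a Re w` modulo
`2π`. On vertical lines this leaves a coset of `2π ℤ` that `Re F` cannot meet. On the upper edge of
the strip only the sign `+` is possible, since `Im F ≥ 0`, and `Re F - a Re w` avoids `π + 2π ℤ`.
Thus `Re F ≥ a Re w - const`. -/
lemma IsQuasimomentum.exists_norm_le (ha : 0 < a) (hq : ∀ s t, IntervalIntegrable q volume s t)
    (hk : IsQuasimomentum q a k) (hE : ∀ z : ℂ, 0 < z.im → CauchySolvable q z) (B : ℝ) :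
    ∃ R : ℝ, ∀ z : ℂ, 0 ≤ z.im → (k z).im ≤ a / 2 → |(k z).re| ≤ B → ‖z‖ ≤ R := by
  obtain ⟨C, hC, hasym⟩ := hk.exists_asymptotics ha hq hE
  have hsq : ∀ v : ℂ, 0 ≤ v.re → 0 ≤ v.im → 0 ≤ (v ^ 2).im := fun v h1 h2 => by
    rw [sq, Complex.mul_im]
    positivity
  set E : ℝ := 2 * (2 * Real.exp (a / 2) + 1) with hEdef
  have hE2 : 2 ≤ E := by
    rw [hEdef]
    linarith [Real.exp_pos (a / 2)]
  set H : ℝ := E / a with hHdef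
  have haH : a * H = E := by
    rw [hHdef]
    field_simp
  have hH0 : 0 < H := by positivity
  set R : ℝ := 1 + 2 * C + 2 * (C * Real.exp E * Real.exp (2 * E)) with hRdef
  have hCe : 0 < C * Real.exp E * Real.exp (2 * E) := by positivity
  have hR1 : 1 ≤ R := by linarith
  have him_mul : ∀ w : ℂ, (w * (a : ℂ)).im = a * w.im := fun w => by
    rw [Complex.im_mul_ofReal, mul_comm]
  have hre_mul : ∀ w : ℂ, (w * (a : ℂ)).re = a * w.re := fun w => by
    rw [Complex.re_mul_ofReal, mul_comm]
  have hcos : ∀ v : ℂ, 2 * Complex.cos v = Complex.exp (Complex.I * v) +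
      Complex.exp (Complex.I * -v) := fun v => by
    rw [Complex.cos]
    ring_nf
  -- If `Im k ≤ a / 2` then `2 cos k` is bounded, and the asymptotics bound `Im w`.
  have hstrip : ∀ w : ℂ, 0 ≤ w.re → 0 ≤ w.im → R ≤ ‖w‖ → (k (w ^ 2)).im ≤ a / 2 →
      w.im ≤ H := by
    intro w h1 h2 h3 h4
    have hw0 : 0 < ‖w‖ := by linarith
    have h5 := hasym w h1 h2 (hR1.trans h3)
    rw [hk.discriminant_eq_two_mul_cos (hsq w h1 h2)] at h5
    have h6 : ‖2 * Complex.cos (k (w ^ 2))‖ ≤ 2 * Real.exp (a / 2) := by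
      rw [norm_mul, Complex.norm_two]
      have h7 := (norm_cos_sin_le (k (w ^ 2))).1
      rw [abs_of_nonneg (hk.im_nonneg (hsq w h1 h2))] at h7
      have h8 := h7.trans (Real.exp_le_exp.2 h4)
      linarith
    have h7 : Real.exp (a * w.im) - 1 ≤ ‖2 * Complex.cos (w * a)‖ := by
      have h8 := norm_sub_le (2 * Complex.cos (w * a)) (Complex.exp (Complex.I * (w * a)))
      rw [hcos, add_sub_cancel_left, norm_exp_I_mul, norm_exp_I_mul, Complex.neg_im, neg_neg,
        him_mul, ← hcos] at h8
      have h9 : Real.exp (-(a * w.im)) ≤ 1 := Real.exp_le_one_iff.2 (by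
        have := mul_nonneg ha.le h2
        linarith)
      linarith
    have h8 : C * Real.exp (a * w.im) / ‖w‖ ≤ Real.exp (a * w.im) / 2 := by
      rw [div_le_div_iff₀ hw0 two_pos]
      nlinarith [Real.exp_pos (a * w.im)]
    have h9 : ‖2 * Complex.cos (w * a)‖ ≤ ‖2 * Complex.cos (k (w ^ 2))‖ +
        ‖2 * Complex.cos (k (w ^ 2)) - 2 * Complex.cos (w * a)‖ := by
      rw [norm_sub_rev]
      exact norm_le_norm_add_norm_sub' _ _
    have h10 : Real.exp (a * w.im) ≤ E := by
      rw [hEdef]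
      linarith
    have h11 := Real.add_one_le_exp (a * w.im)
    rw [hHdef, le_div_iff₀ ha, mul_comm]
    linarith
  -- The product of the two distances is `|e^{ik}| |2 cos k - 2 cos (aw)|`.
  have hclose : ∀ w : ℂ, 0 ≤ w.re → 0 ≤ w.im → w.im ≤ H → R ≤ ‖w‖ →
      ‖Complex.exp (Complex.I * k (w ^ 2)) - Complex.exp (Complex.I * (w * a))‖ < Real.exp (-E) ∨
      ‖Complex.exp (Complex.I * k (w ^ 2)) - Complex.exp (Complex.I * -(w * a))‖ <
        Real.exp (-E) := by
    intro w h1 h2 h3 h4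
    have hw0 : 0 < ‖w‖ := by linarith
    by_contra! hcon
    have h5 := hasym w h1 h2 (hR1.trans h4)
    rw [hk.discriminant_eq_two_mul_cos (hsq w h1 h2)] at h5
    have h6 : (Complex.exp (Complex.I * k (w ^ 2)) - Complex.exp (Complex.I * (w * a))) *
        (Complex.exp (Complex.I * k (w ^ 2)) - Complex.exp (Complex.I * -(w * a))) =
        Complex.exp (Complex.I * k (w ^ 2)) *
          (2 * Complex.cos (k (w ^ 2)) - 2 * Complex.cos (w * a)) := by
      rw [hcos, hcos]
      have e1 : Complex.exp (Complex.I * k (w ^ 2)) * Complex.exp (Complex.I * -k (w ^ 2)) = 1 := by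
        rw [← Complex.exp_add]
        simp
      have e2 : Complex.exp (Complex.I * (w * a)) * Complex.exp (Complex.I * -(w * a)) = 1 := by
        rw [← Complex.exp_add]
        simp
      linear_combination e2 - e1
    have h7 := congrArg norm h6
    rw [norm_mul, norm_mul, norm_exp_I_mul] at h7
    have h8 : Real.exp (-(k (w ^ 2)).im) ≤ 1 :=
      Real.exp_le_one_iff.2 (by linarith [hk.im_nonneg (hsq w h1 h2)])
    have h9 : Real.exp (-E) * Real.exp (-E) ≤ C * Real.exp (a * w.im) / ‖w‖ := by
      calc _ ≤ _ := mul_le_mul hcon.1 hcon.2 (Real.exp_pos _).le (norm_nonneg _)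
        _ = _ := h7
        _ ≤ 1 * (C * Real.exp (a * w.im) / ‖w‖) :=
          mul_le_mul h8 h5 (norm_nonneg _) zero_le_one
        _ = _ := one_mul _
    rw [le_div_iff₀ hw0, ← Real.exp_add] at h9
    have h10 : Real.exp (a * w.im) ≤ Real.exp E := by
      rw [← haH]
      gcongr
    have h11 : Real.exp (2 * E) * (Real.exp (-E + -E) * ‖w‖) = ‖w‖ := by
      rw [← mul_assoc, ← Real.exp_add]
      ring_nf
      simp
    have h12 : ‖w‖ ≤ C * Real.exp E * Real.exp (2 * E) := by
      rw [← h11]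
      calc _ ≤ Real.exp (2 * E) * (C * Real.exp E) :=
            mul_le_mul_of_nonneg_left (h9.trans (by gcongr)) (Real.exp_pos _).le
        _ = _ := by ring
    linarith
  -- `e^{-E}` is a lower bound for `|e^{± iaw}|` in the strip `Im w ≤ H`
  have hsmall : ∀ x : ℝ, -E ≤ x → Real.exp (-E) ≤ Real.exp x := fun x hx => Real.exp_le_exp.2 hx
  have hcospos : ∀ w : ℂ, 0 ≤ w.re → 0 ≤ w.im → w.im ≤ H → R ≤ ‖w‖ →
      0 < Real.cos ((k (w ^ 2)).re - a * w.re) ∨ 0 < Real.cos ((k (w ^ 2)).re + a * w.re) := by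
    intro w h1 h2 h3 h4
    have h5 : a * w.im ≤ E := by
      rw [← haH]
      gcongr
    have h6 := mul_nonneg ha.le h2
    rcases hclose w h1 h2 h3 h4 with h | h
    · left
      have := cos_re_sub_re_pos (h.trans_le (by
        rw [norm_exp_I_mul, him_mul]
        exact hsmall _ (by linarith)))
      rwa [hre_mul] at this
    · right
      have := cos_re_sub_re_pos (h.trans_le (by
        rw [norm_exp_I_mul, Complex.neg_im, him_mul]
        exact hsmall _ (by linarith)))
      rwa [Complex.neg_re, hre_mul, sub_neg_eq_add] at this
  have hcospos_top : ∀ w : ℂ, 0 ≤ w.re → w.im = H → R ≤ ‖w‖ →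
      0 < Real.cos ((k (w ^ 2)).re - a * w.re) := by
    intro w h1 h2 h4
    rcases hclose w h1 (h2 ▸ hH0.le) h2.le h4 with h | h
    · have := cos_re_sub_re_pos (h.trans_le (by
        rw [norm_exp_I_mul, him_mul, h2, haH]))
      rwa [hre_mul] at this
    · exfalso
      have h5 := norm_sub_norm_le (Complex.exp (Complex.I * -(w * a)))
        (Complex.exp (Complex.I * k (w ^ 2)))
      rw [norm_sub_rev, norm_exp_I_mul, norm_exp_I_mul, Complex.neg_im, neg_neg, him_mul, h2,
        haH] at h5
      have h6 : Real.exp (-(k (w ^ 2)).im) ≤ 1 :=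
        Real.exp_le_one_iff.2 (by linarith [hk.im_nonneg (hsq w h1 (h2 ▸ hH0.le))])
      have h7 : Real.exp (-E) ≤ 1 := Real.exp_le_one_iff.2 (by linarith)
      linarith [Real.add_one_le_exp E]
  set F : ℝ → ℝ → ℝ := fun ξ η => (k (((ξ : ℂ) + η * Complex.I) ^ 2)).re with hF
  have hwre : ∀ ξ η : ℝ, ((ξ : ℂ) + η * Complex.I).re = ξ := fun ξ η => by simp
  have hwim : ∀ ξ η : ℝ, ((ξ : ℂ) + η * Complex.I).im = η := fun ξ η => by simp
  have hnorm : ∀ ξ η : ℝ, R ≤ ξ → R ≤ ‖(ξ : ℂ) + η * Complex.I‖ := fun ξ η h => by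
    have := Complex.abs_re_le_norm ((ξ : ℂ) + η * Complex.I)
    rw [hwre] at this
    exact h.trans ((le_abs_self _).trans this)
  have hvert : ∀ ξ η : ℝ, R ≤ ξ → 0 ≤ η → η ≤ H → |F ξ η - F ξ H| ≤ 2 * Real.pi := by
    intro ξ η hξ hη hηH
    -- one of the cosets of `0` and `π` stays away from both `a ξ` and `-a ξ`
    obtain ⟨v, hv1, hv2⟩ : ∃ v : ℝ, Real.cos (v - a * ξ) ≤ 0 ∧ Real.cos (v + a * ξ) ≤ 0 := by
      rcases le_total (Real.cos (a * ξ)) 0 with h | h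
      · exact ⟨0, by simpa using h, by simpa using h⟩
      · refine ⟨Real.pi, ?_, ?_⟩
        · rw [Real.cos_pi_sub]
          linarith
        · rw [add_comm, Real.cos_add_pi]
          linarith
    refine abs_sub_le_two_pi_of_avoids (r := F ξ) (v := v) ?_ ?_
    · refine Complex.continuous_re.comp_continuousOn (hk.continuousOn.comp
        (Continuous.continuousOn (by fun_prop)) fun t ht => ?_)
      rw [uIcc_of_le hηH] at ht
      exact hsq _ (by rw [hwre]; linarith) (by rw [hwim]; linarith [ht.1])
    · intro t ht m hm
      rw [uIcc_of_le hηH] at ht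
      have := hcospos ((ξ : ℂ) + t * Complex.I) (by rw [hwre]; linarith)
        (by rw [hwim]; linarith [ht.1]) (by rw [hwim]; exact ht.2) (hnorm _ _ hξ)
      rw [hwre] at this
      change 0 < Real.cos (F ξ t - a * ξ) ∨ 0 < Real.cos (F ξ t + a * ξ) at this
      rw [hm, show v + m * (2 * Real.pi) - a * ξ = v - a * ξ + m * (2 * Real.pi) by ring,
        show v + m * (2 * Real.pi) + a * ξ = v + a * ξ + m * (2 * Real.pi) by ring,
        Real.cos_add_int_mul_two_pi, Real.cos_add_int_mul_two_pi] at this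
      rcases this with h | h <;> linarith
  have hhor : ∀ ξ : ℝ, R ≤ ξ → |(F R H - a * R) - (F ξ H - a * ξ)| ≤ 2 * Real.pi := by
    intro ξ hξ
    refine abs_sub_le_two_pi_of_avoids (r := fun ξ => F ξ H - a * ξ) (v := Real.pi) ?_ ?_
    · refine ContinuousOn.sub (Complex.continuous_re.comp_continuousOn (hk.continuousOn.comp
        (Continuous.continuousOn (by fun_prop)) fun t ht => ?_))
        (Continuous.continuousOn (by fun_prop))
      rw [uIcc_of_le hξ] at ht
      exact hsq _ (by rw [hwre]; linarith [ht.1]) (by rw [hwim]; exact hH0.le)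
    · intro t ht m hm
      rw [uIcc_of_le hξ] at ht
      have := hcospos_top ((t : ℂ) + H * Complex.I) (by rw [hwre]; linarith [ht.1])
        (by rw [hwim]) (hnorm _ _ ht.1)
      rw [hwre] at this
      change 0 < Real.cos (F t H - a * t) at this
      rw [hm, Real.cos_add_int_mul_two_pi, Real.cos_pi] at this
      linarith
  set X : ℝ := (B + 4 * Real.pi - (F R H - a * R)) / a with hX
  refine ⟨(|X| + R + H) ^ 2, fun z hz hz1 hz2 => ?_⟩
  obtain ⟨w, hw1, hw2, rfl⟩ := exists_sq_eq_of_im_nonneg hz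
  rw [norm_pow]
  refine pow_le_pow_left₀ (norm_nonneg _) ?_ 2
  rcases le_total R ‖w‖ with hwR | hwR
  · have hwH := hstrip w hw1 hw2 hwR hz1
    have hre : w.re ≤ |X| + R := by
      rcases le_total R w.re with h | h
      · have h1 := (abs_le.1 (hvert w.re w.im h hw2 hwH)).1
        have h2 := (abs_le.1 (hhor w.re h)).2
        have h3 : F w.re w.im = (k (w ^ 2)).re := by simp only [hF, Complex.re_add_im]
        have h4 := (abs_le.1 hz2).2
        have h5 : w.re ≤ X := by
          rw [hX, le_div_iff₀ ha]
          linarith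
        linarith [le_abs_self X]
      · linarith [abs_nonneg X]
    have h1 := Complex.norm_le_abs_re_add_abs_im w
    rw [abs_of_nonneg hw1, abs_of_nonneg hw2] at h1
    linarith
  · linarith [abs_nonneg X]

end Proper

/-! ### The sector around a point of a band -/

section Sector

variable {q : ℝ → ℝ} {a ω β μ : ℝ} {k : ℂ → ℂ}

lemma two_mul_eps_le (a ω : ℝ) (k : ℂ → ℂ) (z : ℂ) (n : ℤ) :
    2 * eps a ω k z ≤ ‖2 * k z / a + 2 * ω + 2 * Real.pi * n / a‖ ∧
      2 * eps a ω k z ≤ ‖2 * k z / a - 2 * ω + 2 * Real.pi * n / a‖ := by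
  have h : 2 * eps a ω k z ≤ min ‖2 * k z / a + 2 * ω + 2 * Real.pi * n / a‖
      ‖2 * k z / a - 2 * ω + 2 * Real.pi * n / a‖ := by
    rw [eps, ← mul_assoc, show (2 : ℝ) * (1 / 2) = 1 by norm_num, one_mul]
    refine ciInf_le ⟨0, ?_⟩ n
    rintro _ ⟨m, rfl⟩
    positivity
  exact le_min_iff.1 h

/-- The function `eps` depends Lipschitz continuously on the quasi-momentum. -/
lemma eps_le_add (ha : 0 < a) (ω : ℝ) (k k' : ℂ → ℂ) (z z' : ℂ) :
    eps a ω k z ≤ eps a ω k' z' + a⁻¹ * ‖k z - k' z'‖ := by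
  have h : 2 * eps a ω k z - 2 * a⁻¹ * ‖k z - k' z'‖ ≤
      ⨅ n : ℤ, min ‖2 * k' z' / a + 2 * ω + 2 * Real.pi * n / a‖
        ‖2 * k' z' / a - 2 * ω + 2 * Real.pi * n / a‖ := by
    have hd : ‖2 * k z / a - 2 * k' z' / a‖ = 2 * a⁻¹ * ‖k z - k' z'‖ := by
      rw [← sub_div, ← mul_sub, norm_div, norm_mul, Complex.norm_two, Complex.norm_real,
        Real.norm_eq_abs, abs_of_pos ha]
      ring
    refine le_ciInf fun n => le_min ?_ ?_
    · have h1 := (two_mul_eps_le a ω k z n).1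
      have h2 := norm_sub_norm_le (2 * k z / a + 2 * ω + 2 * Real.pi * n / a)
        (2 * k' z' / a + 2 * ω + 2 * Real.pi * n / a)
      rw [show 2 * k z / a + 2 * ω + 2 * Real.pi * n / a -
        (2 * k' z' / a + 2 * ω + 2 * Real.pi * n / a) = 2 * k z / a - 2 * k' z' / a by ring,
        hd] at h2
      linarith
    · have h1 := (two_mul_eps_le a ω k z n).2
      have h2 := norm_sub_norm_le (2 * k z / a - 2 * ω + 2 * Real.pi * n / a)
        (2 * k' z' / a - 2 * ω + 2 * Real.pi * n / a)
      rw [show 2 * k z / a - 2 * ω + 2 * Real.pi * n / a -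
        (2 * k' z' / a - 2 * ω + 2 * Real.pi * n / a) = 2 * k z / a - 2 * k' z' / a by ring,
        hd] at h2
      linarith
  rw [eps.eq_def a ω k' z']
  linarith

/-- A nonnegative quasi-momentum congruent to `± a ω` modulo `π` belongs to a critical point, and
the infimum defining `eps` is bounded below by the distance to the nearest of these values. -/
lemma eps_pos (ha : 0 < a) (him : (k μ).im = 0) (hre : 0 ≤ (k μ).re) (hb : μ ∈ bands q a)
    (hcrit : μ ∉ criticalPoints q a ω k) : 0 < eps a ω k μ := by
  have hpi := Real.pi_pos
  have ha' : (a : ℂ) ≠ 0 := Complex.ofReal_ne_zero.2 ha.ne'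
  set κ := (k μ).re with hκ
  have hkμ : k μ = (κ : ℂ) := Complex.ext (by simp [hκ]) (by simpa using him)
  have hfr := Int.self_sub_floor (a * ω / Real.pi)
  have hfr0 := Int.fract_nonneg (a * ω / Real.pi)
  have hfr1 := Int.fract_lt_one (a * ω / Real.pi)
  have haω : a * ω = Real.pi * (a * ω / Real.pi) := by field_simp
  -- The critical points are indexed by natural numbers; `0 ≤ κ` excludes negative `m`.
  have key : ∀ m : ℤ, κ ≠ Real.pi * (m + Int.fract (a * ω / Real.pi)) ∧
      κ ≠ Real.pi * (m - Int.fract (a * ω / Real.pi)) := by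
    intro m
    constructor
    · intro h
      have h1 : (-1 : ℝ) < m := by
        by_contra! hcon
        have : Real.pi * (m + Int.fract (a * ω / Real.pi)) < 0 :=
          mul_neg_of_pos_of_neg hpi (by linarith)
        linarith
      have h2 : 0 ≤ m := by
        have : (-1 : ℤ) < m := by exact_mod_cast h1
        omega
      lift m to ℕ using h2
      exact hcrit ⟨hb, m, Or.inr (by rw [hkμ, h]; simp)⟩
    · intro h
      have h1 : (-1 : ℝ) < m := by
        by_contra! hcon
        have : Real.pi * (m - Int.fract (a * ω / Real.pi)) < 0 :=
          mul_neg_of_pos_of_neg hpi (by linarith)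
        linarith
      have h2 : 0 ≤ m := by
        have : (-1 : ℤ) < m := by exact_mod_cast h1
        omega
      lift m to ℕ using h2
      rcases m with _ | m
      · have h3 : Int.fract (a * ω / Real.pi) = 0 := by
          by_contra hne
          have : 0 < Real.pi * Int.fract (a * ω / Real.pi) :=
            mul_pos hpi (lt_of_le_of_ne hfr0 (Ne.symm hne))
          simp only [Nat.cast_zero, Int.cast_zero] at h
          linarith
        refine hcrit ⟨hb, 0, Or.inr ?_⟩
        rw [hkμ, h, h3]
        simp
      · refine hcrit ⟨hb, m, Or.inl ?_⟩
        rw [hkμ, h]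
        push_cast
        ring
  set x := (κ + a * ω) / Real.pi with hx
  set y := (κ - a * ω) / Real.pi with hy
  have hxne : x - round x ≠ 0 := by
    intro h0
    have h1 : κ + a * ω = Real.pi * round x := by
      rw [← sub_eq_zero.1 h0, hx]
      field_simp
    refine (key (round x - ⌊a * ω / Real.pi⌋)).2 ?_
    push_cast
    linear_combination h1 - haω - Real.pi * hfr
  have hyne : y - round y ≠ 0 := by
    intro h0
    have h1 : κ - a * ω = Real.pi * round y := by
      rw [← sub_eq_zero.1 h0, hy]
      field_simp
    refine (key (round y + ⌊a * ω / Real.pi⌋)).1 ?_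
    push_cast
    linear_combination h1 + haω + Real.pi * hfr
  have hlow : 2 * Real.pi / a * min |x - round x| |y - round y| ≤ ⨅ n : ℤ,
      min ‖2 * k μ / a + 2 * ω + 2 * Real.pi * n / a‖
        ‖2 * k μ / a - 2 * ω + 2 * Real.pi * n / a‖ := by
    have hc : 0 < 2 * Real.pi / a := by positivity
    refine le_ciInf fun n => ?_
    rw [mul_min_of_nonneg _ _ hc.le]
    refine min_le_min ?_ ?_
    · have h1 : 2 * k μ / a + 2 * ω + 2 * Real.pi * n / a =
          ((2 * Real.pi / a * (x - (-n : ℤ)) : ℝ) : ℂ) := by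
        rw [hkμ, hx]
        push_cast
        field_simp
        ring
      rw [h1, Complex.norm_real, Real.norm_eq_abs, abs_mul, abs_of_pos hc]
      exact mul_le_mul_of_nonneg_left (round_le x (-n)) hc.le
    · have h1 : 2 * k μ / a - 2 * ω + 2 * Real.pi * n / a =
          ((2 * Real.pi / a * (y - (-n : ℤ)) : ℝ) : ℂ) := by
        rw [hkμ, hy]
        push_cast
        field_simp
        ring
      rw [h1, Complex.norm_real, Real.norm_eq_abs, abs_mul, abs_of_pos hc]
      exact mul_le_mul_of_nonneg_left (round_le y (-n)) hc.le
  have h2 : 0 < min |x - round x| |y - round y| :=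
    lt_min (abs_pos.2 hxne) (abs_pos.2 hyne)
  have h3 : 0 < 2 * Real.pi / a * min |x - round x| |y - round y| := by positivity
  rw [eps]
  linarith

lemma im_two_mul_div (a : ℝ) (κ : ℂ) : (2 * κ / (a : ℂ)).im = 2 * κ.im / a := by
  rw [Complex.div_ofReal_im, Complex.mul_im]
  simp

lemma im_le_of_mem_sector (ha : 0 < a) {z : ℂ} (hz : z ∈ sector a ω k β μ) :
    0 ≤ (k z).im ∧ (k z).im ≤ a / 2 := by
  obtain ⟨-, -, h1, h2, -⟩ := hz
  rw [im_two_mul_div] at h1 h2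
  rw [div_le_one ha] at h2
  rw [le_div_iff₀ ha] at h1
  constructor <;> linarith

lemma IsQuasimomentum.isCompact_sector (ha : 0 < a)
    (hq : ∀ s t, IntervalIntegrable q volume s t) (hk : IsQuasimomentum q a k)
    (hE : ∀ z : ℂ, 0 < z.im → CauchySolvable q z) (hβ : 0 < β) :
    IsCompact (sector a ω k β μ) := by
  refine Metric.isCompact_of_isClosed_isBounded ?_ ?_
  · have hcl : IsClosed {z : ℂ | 0 ≤ z.im} := isClosed_le continuous_const Complex.continuous_im
    -- `eps` as a function of the value of the quasi-momentum
    have heps : Continuous fun κ : ℂ => eps a ω id κ := by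
      have hL : LipschitzWith (Real.toNNReal a⁻¹) fun κ : ℂ => eps a ω id κ := by
        refine LipschitzWith.of_le_add_mul _ fun x y => ?_
        rw [Real.coe_toNNReal _ (by positivity), dist_eq_norm]
        exact eps_le_add ha ω id id x y
      exact hL.continuous
    have hK : IsClosed {κ : ℂ | eps a ω k μ ≤ 2 * eps a ω id κ ∧ 0 ≤ (2 * κ / a).im ∧
        (2 * κ / a).im ≤ 1 ∧ |κ.re - (k μ).re| ≤ β * κ.im} := by
      simp only [im_two_mul_div]
      have c1 : IsClosed {κ : ℂ | eps a ω k μ ≤ 2 * eps a ω id κ} :=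
        isClosed_le continuous_const (continuous_const.mul heps)
      have c2 : IsClosed {κ : ℂ | 0 ≤ 2 * κ.im / a} :=
        isClosed_le continuous_const (by fun_prop)
      have c3 : IsClosed {κ : ℂ | 2 * κ.im / a ≤ 1} :=
        isClosed_le (by fun_prop) continuous_const
      have c4 : IsClosed {κ : ℂ | |κ.re - (k μ).re| ≤ β * κ.im} :=
        isClosed_le (by fun_prop) (by fun_prop)
      exact c1.inter (c2.inter (c3.inter c4))
    exact hk.continuousOn.preimage_isClosed_of_isClosed hcl hK
  · obtain ⟨R, hR⟩ := hk.exists_norm_le ha hq hE (|(k μ).re| + β * (a / 2))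
    refine (Metric.isBounded_closedBall (x := (0 : ℂ)) (r := R)).subset fun z hz => ?_
    obtain ⟨h1, h2⟩ := im_le_of_mem_sector ha hz
    have h3 := hz.2.2.2.2
    rw [mem_closedBall_zero_iff]
    refine hR z hz.1 h2 ?_
    have h4 : β * (k z).im ≤ β * (a / 2) := by gcongr
    have h5 := abs_sub_abs_le_abs_sub (k z).re (k μ).re
    linarith

/-- On the sector the frequencies `2k/a ± 2ω` stay away from `(2π/a) ℤ`. -/
lemma exp_ne_one_of_mem_sector (ha : 0 < a) (hμ : 0 < eps a ω k μ) {z : ℂ}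
    (hz : eps a ω k μ ≤ 2 * eps a ω k z) {s : ℝ} (hs : s = 2 * ω ∨ s = -(2 * ω)) :
    Complex.exp (Complex.I * (2 * k z / a + s) * a) ≠ 1 := by
  intro h
  have ha' : (a : ℂ) ≠ 0 := Complex.ofReal_ne_zero.2 ha.ne'
  obtain ⟨n, hn⟩ := Complex.exp_eq_one_iff.1 h
  have h1 : 2 * k z / a + s + 2 * Real.pi * (-n : ℤ) / a = 0 := by
    have h2 : Complex.I * ((2 * k z / a + s) * a - n * (2 * Real.pi)) = 0 := by
      linear_combination hn
    have h3 := (mul_eq_zero.1 h2).resolve_left Complex.I_ne_zero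
    have h4 : (2 * k z / a + s + 2 * Real.pi * (-n : ℤ) / a) * a = 0 := by
      push_cast
      rw [add_mul, div_mul_cancel₀ _ ha']
      linear_combination h3
    exact (mul_eq_zero.1 h4).resolve_right ha'
  have h5 := two_mul_eps_le a ω k z (-n)
  rcases hs with rfl | rfl
  · have h6 := h5.1
    push_cast at h1 h6
    rw [h1, norm_zero] at h6
    linarith
  · have h6 := h5.2
    push_cast at h1 h6
    rw [sub_eq_add_neg, h1, norm_zero] at h6
    linarith

lemma exists_norm_lower_bound {K : Set ℂ} (hK : IsCompact K) {f : ℂ → ℂ} (hf : ContinuousOn f K)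
    (h0 : ∀ z ∈ K, f z ≠ 0) : ∃ m : ℝ, 0 < m ∧ ∀ z ∈ K, m ≤ ‖f z‖ := by
  rcases K.eq_empty_or_nonempty with rfl | hne
  · exact ⟨1, one_pos, by simp⟩
  · obtain ⟨z₀, hz₀, hmin⟩ := hK.exists_isMinOn hne hf.norm
    exact ⟨‖f z₀‖, norm_pos_iff.2 (h0 z₀ hz₀), fun z hz => hmin hz⟩

end Sector

/-! ### Oscillatory integrals with a slowly decaying weight -/

section Weight

/-- The weight `(t + 1)^{-s}`. -/
noncomputable def weight (s t : ℝ) : ℝ := (t + 1) ^ (-s)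

variable {s t x X : ℝ}

lemma weight_pos (s : ℝ) (ht : 0 ≤ t) : 0 < weight s t := Real.rpow_pos_of_pos (by linarith) _

lemma hasDerivAt_weight (s : ℝ) (ht : 0 ≤ t) :
    HasDerivAt (weight s) (-s * weight (s + 1) t) t := by
  have h := ((hasDerivAt_id t).add_const 1).rpow_const (p := -s) (Or.inl (by
    simp only [id]
    linarith))
  simp only [id, one_mul] at h
  rwa [show -s - 1 = -(s + 1) by ring] at h

lemma continuousOn_weight (s : ℝ) : ContinuousOn (weight s) (Ici 0) := fun _ ht =>
  (hasDerivAt_weight s ht).continuousAt.continuousWithinAt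

lemma continuousOn_mul_weight {f : ℝ → ℂ} (hf : Continuous f) (s : ℝ) :
    ContinuousOn (fun t => f t * (weight s t : ℂ)) (Ici 0) :=
  hf.continuousOn.mul (Complex.continuous_ofReal.comp_continuousOn (continuousOn_weight s))

lemma uIcc_subset_Ici (hx : 0 ≤ x) (hX : 0 ≤ X) : uIcc x X ⊆ Ici 0 := fun _ ht =>
  (le_min hx hX).trans ht.1

lemma intervalIntegrable_mul_weight {f : ℝ → ℂ} (hf : Continuous f) (s : ℝ) (hx : 0 ≤ x)
    (hX : 0 ≤ X) : IntervalIntegrable (fun t => f t * (weight s t : ℂ)) volume x X :=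
  ((continuousOn_mul_weight hf s).mono (uIcc_subset_Ici hx hX)).intervalIntegrable

lemma intervalIntegrable_weight (s : ℝ) (hx : 0 ≤ x) (hX : 0 ≤ X) :
    IntervalIntegrable (weight s) volume x X :=
  ((continuousOn_weight s).mono (uIcc_subset_Ici hx hX)).intervalIntegrable

lemma mul_integral_weight (s : ℝ) (hx : 0 ≤ x) (hX : 0 ≤ X) :
    s * ∫ t in x..X, weight (s + 1) t = weight s x - weight s X := by
  have h := intervalIntegral.integral_eq_sub_of_hasDerivAt (a := x) (b := X)
    (fun t ht => hasDerivAt_weight s (uIcc_subset_Ici hx hX ht))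
    ((intervalIntegrable_weight (s + 1) hx hX).const_mul (-s))
  rw [intervalIntegral.integral_const_mul] at h
  linarith

lemma weight_add_one (s : ℝ) (ht : 0 ≤ t) : weight (s + 1) t = weight s t / (t + 1) := by
  rw [weight, weight, neg_add, ← sub_eq_add_neg, Real.rpow_sub_one (by linarith)]

lemma inv_le_weight (hs : s ≤ 1) (ht : 0 ≤ t) : 1 / (t + 1) ≤ weight s t := by
  rw [one_div, ← Real.rpow_neg_one, weight]
  exact Real.rpow_le_rpow_of_exponent_le (by linarith) (by linarith)

lemma tendsto_weight (hs : 0 < s) : Tendsto (weight s) atTop (𝓝 0) :=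
  (tendsto_rpow_neg_atTop hs).comp (tendsto_atTop_add_const_right _ _ tendsto_id)

/-- Integration by parts against the weight. -/
lemma integral_mul_weight_eq {Ψ ψ : ℝ → ℂ} (hΨ : ∀ t, HasDerivAt Ψ (ψ t) t) (hψ : Continuous ψ)
    (s : ℝ) (hx : 0 ≤ x) (hX : 0 ≤ X) :
    ∫ t in x..X, ψ t * (weight s t : ℂ) = Ψ X * weight s X - Ψ x * weight s x +
      s * ∫ t in x..X, Ψ t * (weight (s + 1) t : ℂ) := by
  have hΨc : Continuous Ψ := continuous_iff_continuousAt.2 fun t => (hΨ t).continuousAt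
  have h := intervalIntegral.integral_eq_sub_of_hasDerivAt (a := x) (b := X)
    (f := fun t => Ψ t * (weight s t : ℂ))
    (fun t ht => (hΨ t).mul (hasDerivAt_weight s (uIcc_subset_Ici hx hX ht)).ofReal_comp)
    ((intervalIntegrable_mul_weight hψ s hx hX).add (by
      have := (intervalIntegrable_mul_weight hΨc (s + 1) hx hX).const_mul (-s : ℂ)
      refine this.congr (fun t _ => ?_)
      push_cast
      ring))
  have h2 : (fun t => ψ t * (weight s t : ℂ) + Ψ t * ((-s * weight (s + 1) t : ℝ) : ℂ)) =
      fun t => ψ t * (weight s t : ℂ) - s * (Ψ t * (weight (s + 1) t : ℂ)) := by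
    funext t
    push_cast
    ring
  rw [h2, intervalIntegral.integral_sub (intervalIntegrable_mul_weight hψ s hx hX)
    ((intervalIntegrable_mul_weight hΨc (s + 1) hx hX).const_mul _),
    intervalIntegral.integral_const_mul] at h
  linear_combination h

/-- If `ψ` has a primitive bounded by `B` then its weighted integrals are small at infinity. -/
lemma norm_integral_mul_weight_le {Ψ ψ : ℝ → ℂ} (hΨ : ∀ t, HasDerivAt Ψ (ψ t) t)
    (hψ : Continuous ψ) (hs : 0 ≤ s) (hx : 0 ≤ x) (hxX : x ≤ X) {B : ℝ}
    (hB : ∀ t, x ≤ t → ‖Ψ t‖ ≤ B) :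
    ‖∫ t in x..X, ψ t * (weight s t : ℂ)‖ ≤ 2 * B * weight s x := by
  have hX := hx.trans hxX
  have h1 : ‖∫ t in x..X, Ψ t * (weight (s + 1) t : ℂ)‖ ≤ ∫ t in x..X, B * weight (s + 1) t := by
    refine intervalIntegral.norm_integral_le_of_norm_le hxX
      (Eventually.of_forall fun t ht => ?_) ((intervalIntegrable_weight _ hx hX).const_mul _)
    have hw := weight_pos (s + 1) (hx.trans ht.1.le)
    rw [norm_mul, Complex.norm_real, Real.norm_eq_abs, abs_of_pos hw]
    exact mul_le_mul_of_nonneg_right (hB t ht.1.le) hw.le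
  rw [intervalIntegral.integral_const_mul] at h1
  have hwx := weight_pos s hx
  have hwX := weight_pos s hX
  rw [integral_mul_weight_eq hΨ hψ s hx hX]
  calc _ ≤ ‖Ψ X‖ * weight s X + ‖Ψ x‖ * weight s x +
        s * ‖∫ t in x..X, Ψ t * (weight (s + 1) t : ℂ)‖ := by
        refine (norm_add_le _ _).trans (add_le_add ((norm_sub_le _ _).trans_eq ?_) ?_)
        · rw [norm_mul, norm_mul, Complex.norm_real, Complex.norm_real, Real.norm_eq_abs,
            Real.norm_eq_abs, abs_of_pos hwx, abs_of_pos hwX]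
        · rw [norm_mul, Complex.norm_real, Real.norm_eq_abs, abs_of_nonneg hs]
    _ ≤ B * weight s X + B * weight s x + s * (B * ∫ t in x..X, weight (s + 1) t) := by
        gcongr
        · exact hB X hxX
        · exact hB x le_rfl
    _ = B * weight s X + B * weight s x + B * (s * ∫ t in x..X, weight (s + 1) t) := by ring
    _ = _ := by
        rw [mul_integral_weight s hx hX]
        ring

/-- Dirichlet's test for improper integrals against the weight. -/
lemma exists_tendsto_integral_mul_weight {Ψ ψ : ℝ → ℂ} (hΨ : ∀ t, HasDerivAt Ψ (ψ t) t)
    (hψ : Continuous ψ) (hs : 0 < s) (hx : 0 ≤ x) {B : ℝ} (hB : ∀ t, x ≤ t → ‖Ψ t‖ ≤ B) :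
    ∃ L : ℂ, Tendsto (fun X => ∫ t in x..X, ψ t * (weight s t : ℂ)) atTop (𝓝 L) ∧
      ‖L‖ ≤ 2 * B * weight s x := by
  have hcauchy : CauchySeq fun X => ∫ t in x..max x X, ψ t * (weight s t : ℂ) := by
    refine cauchySeq_of_le_tendsto_0' (fun X => 2 * B * weight s (max x X)) (fun X Y hXY => ?_) ?_
    · have hX : x ≤ max x X := le_max_left _ _
      have hX0 := hx.trans hX
      have hXY' : max x X ≤ max x Y := max_le_max_left _ hXY
      rw [dist_comm, dist_eq_norm, intervalIntegral.integral_interval_sub_left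
        (intervalIntegrable_mul_weight hψ s hx (hX0.trans hXY'))
        (intervalIntegrable_mul_weight hψ s hx hX0)]
      exact norm_integral_mul_weight_le hΨ hψ hs.le hX0 hXY' fun t ht => hB t (hX.trans ht)
    · have := ((tendsto_weight hs).comp (tendsto_atTop_mono (fun X => le_max_right x X)
        tendsto_id)).const_mul (2 * B)
      simpa using this
  obtain ⟨L, hL⟩ := cauchySeq_tendsto_of_complete hcauchy
  have hL' : Tendsto (fun X => ∫ t in x..X, ψ t * (weight s t : ℂ)) atTop (𝓝 L) := by
    refine hL.congr' ?_
    filter_upwards [eventually_ge_atTop x] with X hX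
    rw [max_eq_right hX]
  refine ⟨L, hL', le_of_tendsto hL'.norm ?_⟩
  filter_upwards [eventually_ge_atTop x] with X hX
  exact norm_integral_mul_weight_le hΨ hψ hs.le hx hX hB

lemma mul_exp_neg_le {τ u : ℝ} (hτ1 : τ ≤ 1) (hu : 0 ≤ u) :
    τ ≤ Real.exp (τ * u) * (1 / (u + 1)) := by
  rw [mul_one_div, le_div_iff₀ (by linarith)]
  linarith [Real.add_one_le_exp (τ * u)]

/-- The key estimate. Here `ψ = Ψ₁' = Ψ₂''` grows at most like `e^{τt}`, and is of size `τ` near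
`0`. Two integrations by parts are performed, because after one of them `τ ∫₀ˣ e^{τt} (t+1)^{-γ} dt`
would remain, which for `γ = 1` exceeds the bound by a logarithm. The factor `τ` is exchanged for
decay by `τ ≤ e^{τu} / (u + 1)`. -/
lemma norm_integral_mul_weight_le_exp {Ψ₂ Ψ₁ ψ : ℝ → ℂ} (hΨ₁ : ∀ t, HasDerivAt Ψ₁ (ψ t) t)
    (hΨ₂ : ∀ t, HasDerivAt Ψ₂ (Ψ₁ t) t) (hψ : Continuous ψ) {γ τ K : ℝ} (hγ : 0 < γ)
    (hγ1 : γ ≤ 1) (hτ0 : 0 ≤ τ) (hτ1 : τ ≤ 1) (hK : 0 ≤ K)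
    (h1 : ∀ t, 0 ≤ t → ‖Ψ₁ t‖ ≤ K * Real.exp (τ * t))
    (h2 : ∀ t, 0 ≤ t → ‖Ψ₂ t‖ ≤ K * Real.exp (τ * t)) (h10 : ‖Ψ₁ 0‖ ≤ K * τ)
    (h2τ : ∀ t, 0 ≤ t → ‖Ψ₂ t‖ ≤ K * (τ * (t + 1)) * Real.exp (τ * t)) (hx : 0 ≤ x) :
    ‖∫ t in (0 : ℝ)..x, ψ t * (weight γ t : ℂ)‖ ≤ 16 * K * Real.exp (τ * x) * weight γ x := by
  have hΨ₁c : Continuous Ψ₁ := continuous_iff_continuousAt.2 fun t => (hΨ₁ t).continuousAt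
  set e := Real.exp (τ * x) with he
  have he0 : 0 < e := Real.exp_pos _
  set W := weight γ x with hW
  have hW0 : 0 < W := weight_pos γ hx
  have hinv : 1 / (x + 1) ≤ W := inv_le_weight hγ1 hx
  have hτe : τ ≤ e * W := (mul_exp_neg_le hτ1 hx).trans (by gcongr)
  have hW1 : weight (γ + 1) x ≤ W := by
    rw [weight_add_one γ hx]
    exact div_le_self hW0.le (by linarith)
  have hw0 : ∀ s, weight s 0 = 1 := fun s => by simp [weight]
  -- the remaining integral, split at `t = x / 2`
  have hpt : ∀ t ∈ Icc 0 x, ‖Ψ₂ t * (weight (γ + 2) t : ℂ)‖ ≤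
      K * e * (2 / (x + 1) * weight (γ + 1) t + 4 * (W / (x + 1))) := by
    intro t ht
    have hwt := weight_pos (γ + 1) ht.1
    have hw2 : weight (γ + 2) t * (t + 1) = weight (γ + 1) t := by
      rw [show γ + 2 = γ + 1 + 1 by ring, weight_add_one (γ + 1) ht.1,
        div_mul_cancel₀ _ (by linarith [ht.1])]
    have hb : ‖Ψ₂ t * (weight (γ + 2) t : ℂ)‖ ≤
        K * (τ * Real.exp (τ * t)) * weight (γ + 1) t := by
      rw [norm_mul, Complex.norm_real, Real.norm_eq_abs, abs_of_pos (weight_pos _ ht.1), ← hw2]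
      calc _ ≤ K * (τ * (t + 1)) * Real.exp (τ * t) * weight (γ + 2) t :=
            mul_le_mul_of_nonneg_right (h2τ t ht.1) (weight_pos _ ht.1).le
        _ = _ := by ring
    refine hb.trans ?_
    have hWx : 0 ≤ W / (x + 1) := by positivity
    have hx2 : 0 ≤ 2 / (x + 1) := by positivity
    rw [mul_assoc K, mul_assoc K]
    refine mul_le_mul_of_nonneg_left ?_ hK
    rcases le_total t (x / 2) with h | h
    · have h3 : τ * Real.exp (τ * t) ≤ e * (2 / (x + 1)) := by
        calc τ * Real.exp (τ * t)
            ≤ Real.exp (τ * (x - t)) * (1 / (x - t + 1)) * Real.exp (τ * t) := by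
              gcongr
              exact mul_exp_neg_le hτ1 (by linarith [ht.2])
          _ = e * (1 / (x - t + 1)) := by
              rw [mul_right_comm, ← Real.exp_add, he]
              ring_nf
          _ ≤ e * (2 / (x + 1)) := by
              refine mul_le_mul_of_nonneg_left ?_ he0.le
              rw [div_le_div_iff₀ (by linarith [ht.2]) (by linarith)]
              linarith
      calc _ ≤ e * (2 / (x + 1)) * weight (γ + 1) t := by gcongr
        _ = e * (2 / (x + 1) * weight (γ + 1) t) := by ring
        _ ≤ _ := by
            refine mul_le_mul_of_nonneg_left ?_ he0.le
            linarith
    · have h3 : τ * Real.exp (τ * t) ≤ e := by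
        calc τ * Real.exp (τ * t) ≤ 1 * Real.exp (τ * x) := by
              gcongr
              exact ht.2
          _ = e := one_mul _
      have h4 : weight (γ + 1) t ≤ 4 * (W / (x + 1)) := by
        have h5 : weight (γ + 1) t ≤ ((x + 1) / 2) ^ (-(γ + 1)) :=
          Real.rpow_le_rpow_of_nonpos (by linarith) (by linarith) (by linarith)
        have h6 : ((x + 1) / 2) ^ (-(γ + 1)) = W / (x + 1) * 2 ^ (γ + 1) := by
          rw [Real.div_rpow (by linarith) zero_le_two, ← weight_add_one γ hx, weight,
            Real.rpow_neg zero_le_two (γ + 1), div_inv_eq_mul]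
        have h7 : (2 : ℝ) ^ (γ + 1) ≤ 2 ^ (2 : ℝ) :=
          Real.rpow_le_rpow_of_exponent_le one_le_two (by linarith)
        have h8 : (2 : ℝ) ^ (2 : ℝ) = 4 := by
          rw [Real.rpow_two]
          norm_num
        rw [h6] at h5
        nlinarith
      calc _ ≤ e * (4 * (W / (x + 1))) := mul_le_mul h3 h4 hwt.le he0.le
        _ ≤ _ := by
            refine mul_le_mul_of_nonneg_left ?_ he0.le
            have : 0 ≤ 2 / (x + 1) * weight (γ + 1) t := by positivity
            linarith
  have hI : ‖∫ t in (0 : ℝ)..x, Ψ₂ t * (weight (γ + 2) t : ℂ)‖ ≤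
      K * e * (2 / (x + 1) * (∫ t in (0 : ℝ)..x, weight (γ + 1) t) + 4 * W) := by
    have h3 : ‖∫ t in (0 : ℝ)..x, Ψ₂ t * (weight (γ + 2) t : ℂ)‖ ≤
        ∫ t in (0 : ℝ)..x, K * e * (2 / (x + 1) * weight (γ + 1) t + 4 * (W / (x + 1))) :=
      intervalIntegral.norm_integral_le_of_norm_le hx
        (Eventually.of_forall fun t ht => hpt t ⟨ht.1.le, ht.2⟩)
        ((((intervalIntegrable_weight _ le_rfl hx).const_mul _).add
          intervalIntegrable_const).const_mul _)
    rw [intervalIntegral.integral_const_mul, intervalIntegral.integral_add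
      ((intervalIntegrable_weight _ le_rfl hx).const_mul _) intervalIntegrable_const,
      intervalIntegral.integral_const_mul, intervalIntegral.integral_const, smul_eq_mul,
      sub_zero] at h3
    refine h3.trans (mul_le_mul_of_nonneg_left (add_le_add le_rfl ?_) (by positivity))
    have h4 : x * (W / (x + 1)) ≤ W := by
      rw [← mul_div_assoc, div_le_iff₀ (by linarith)]
      linarith
    linarith
  have hJ := mul_integral_weight γ le_rfl hx
  rw [hw0] at hJ
  have hγI : γ * ((γ + 1) * ‖∫ t in (0 : ℝ)..x, Ψ₂ t * (weight (γ + 2) t : ℂ)‖) ≤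
      12 * K * e * W := by
    have h3 : γ * (2 / (x + 1) * (∫ t in (0 : ℝ)..x, weight (γ + 1) t) + 4 * W) ≤ 6 * W := by
      have h4 : γ * (2 / (x + 1) * ∫ t in (0 : ℝ)..x, weight (γ + 1) t) ≤ 2 * W := by
        calc _ = 2 * (1 / (x + 1)) * (γ * ∫ t in (0 : ℝ)..x, weight (γ + 1) t) := by ring
          _ = 2 * (1 / (x + 1)) * (1 - W) := by rw [hJ]
          _ ≤ 2 * (1 / (x + 1)) * 1 := by
              gcongr
              linarith
          _ ≤ 2 * W := by linarith
      nlinarith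
    calc _ ≤ γ * ((γ + 1) * (K * e * (2 / (x + 1) * (∫ t in (0 : ℝ)..x, weight (γ + 1) t) +
          4 * W))) := by gcongr
      _ = (γ + 1) * (K * e) * (γ * (2 / (x + 1) * (∫ t in (0 : ℝ)..x, weight (γ + 1) t) +
          4 * W)) := by ring
      _ ≤ 2 * (K * e) * (6 * W) := by
          gcongr
          · have hJ0 : 0 ≤ ∫ t in (0 : ℝ)..x, weight (γ + 1) t :=
              intervalIntegral.integral_nonneg hx fun t ht => (weight_pos _ ht.1).le
            positivity
          · linarith
      _ = _ := by ring
  rw [integral_mul_weight_eq hΨ₁ hψ γ le_rfl hx, integral_mul_weight_eq hΨ₂ hΨ₁c (γ + 1) le_rfl hx,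
    show γ + 1 + 1 = γ + 2 by ring, hw0, hw0]
  have hKe : 0 ≤ K * e := by positivity
  have t1 : ‖Ψ₁ x * (W : ℂ)‖ ≤ K * e * W := by
    rw [norm_mul, Complex.norm_real, Real.norm_eq_abs, abs_of_pos hW0]
    exact mul_le_mul_of_nonneg_right (h1 x hx) hW0.le
  have t2 : ‖Ψ₁ 0 * ((1 : ℝ) : ℂ)‖ ≤ K * e * W := by
    rw [Complex.ofReal_one, mul_one, mul_assoc]
    exact h10.trans (by gcongr)
  have t3 : ‖Ψ₂ x * (weight (γ + 1) x : ℂ)‖ ≤ K * e * W := by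
    rw [norm_mul, Complex.norm_real, Real.norm_eq_abs, abs_of_pos (weight_pos _ hx)]
    exact mul_le_mul (h2 x hx) hW1 (weight_pos _ hx).le hKe
  have t4 : ‖Ψ₂ 0 * ((1 : ℝ) : ℂ)‖ ≤ K * e * W := by
    rw [Complex.ofReal_one, mul_one, mul_assoc]
    have := h2τ 0 le_rfl
    simp only [zero_add, mul_one, mul_zero, Real.exp_zero] at this
    exact this.trans (by gcongr)
  calc _ ≤ (‖Ψ₁ x * (W : ℂ)‖ + ‖Ψ₁ 0 * ((1 : ℝ) : ℂ)‖) + γ * ((‖Ψ₂ x * (weight (γ + 1) x : ℂ)‖ +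
        ‖Ψ₂ 0 * ((1 : ℝ) : ℂ)‖) + (γ + 1) *
          ‖∫ t in (0 : ℝ)..x, Ψ₂ t * (weight (γ + 2) t : ℂ)‖) := by
        refine (norm_add_le _ _).trans (add_le_add (norm_sub_le _ _) ?_)
        rw [norm_mul, Complex.norm_real, Real.norm_eq_abs, abs_of_pos hγ]
        refine mul_le_mul_of_nonneg_left ?_ hγ.le
        refine (norm_add_le _ _).trans (add_le_add (norm_sub_le _ _) ?_)
        rw [norm_mul, Complex.norm_real, Real.norm_eq_abs, abs_of_pos (by linarith)]
    _ ≤ (K * e * W + K * e * W) + (γ * (K * e * W + K * e * W) + 12 * K * e * W) := by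
        rw [mul_add γ]
        gcongr
    _ ≤ _ := by
        have : 0 ≤ K * e * W := by positivity
        nlinarith

end Weight

/-! ### Primitives of quasi-periodic functions -/

section Floquet

/-- The periodic factor of the quasi-periodic primitive of `e^{iκt} h(t)`, for an `a`-periodic
function `h` and `e^{iκa} ≠ 1`. -/
noncomputable def floquetPrimitive (a : ℝ) (κ : ℂ) (h : ℝ → ℂ) (t : ℝ) : ℂ :=
  (Complex.exp (Complex.I * κ * a) - 1)⁻¹ *
    ∫ s in (0 : ℝ)..a, Complex.exp (Complex.I * κ * s) * h (t + s)

variable {a m M : ℝ} {κ κ' : ℂ} {h h' : ℝ → ℂ}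

lemma hasDerivAt_exp_mul_floquetPrimitive (hc : Continuous h) (hp : ∀ t, h (t + a) = h t)
    (hκ : Complex.exp (Complex.I * κ * a) ≠ 1) (t : ℝ) :
    HasDerivAt (fun t : ℝ => Complex.exp (Complex.I * κ * t) * floquetPrimitive a κ h t)
      (Complex.exp (Complex.I * κ * t) * h t) t := by
  set G : ℝ → ℂ := fun u => Complex.exp (Complex.I * κ * u) * h u with hG
  have hGc : Continuous G := by fun_prop
  have hGa : G (t + a) = Complex.exp (Complex.I * κ * a) * G t := by
    simp only [hG, hp]
    rw [← mul_assoc, ← Complex.exp_add]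
    push_cast
    ring_nf
  have hform : (fun t : ℝ => Complex.exp (Complex.I * κ * t) * floquetPrimitive a κ h t) =
      fun t : ℝ => (Complex.exp (Complex.I * κ * a) - 1)⁻¹ *
        ((∫ u in (0 : ℝ)..t + a, G u) - ∫ u in (0 : ℝ)..t, G u) := by
    funext t
    rw [intervalIntegral.integral_interval_sub_left (hGc.intervalIntegrable _ _)
      (hGc.intervalIntegrable _ _), floquetPrimitive, mul_left_comm,
      ← intervalIntegral.integral_const_mul]
    have h1 := intervalIntegral.integral_comp_add_left (a := 0) (b := a) G t
    rw [add_zero] at h1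
    rw [← h1]
    congr 1
    refine intervalIntegral.integral_congr fun s _ => ?_
    simp only [hG]
    rw [← mul_assoc, ← Complex.exp_add]
    push_cast
    ring_nf
  rw [hform]
  have hF : ∀ x, HasDerivAt (fun x => ∫ u in (0 : ℝ)..x, G u) (G x) x := fun x =>
    intervalIntegral.integral_hasDerivAt_right (hGc.intervalIntegrable _ _)
      (hGc.stronglyMeasurableAtFilter _ _) hGc.continuousAt
  have hd := (((hF (t + a)).comp_add_const t a).sub (hF t)).const_mul
    (Complex.exp (Complex.I * κ * a) - 1)⁻¹
  refine hd.congr_deriv ?_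
  have hne : Complex.exp (Complex.I * κ * a) - 1 ≠ 0 := sub_ne_zero.2 hκ
  rw [hGa, ← sub_one_mul, inv_mul_cancel_left₀ hne]

lemma floquetPrimitive_periodic (hp : ∀ t, h (t + a) = h t) (t : ℝ) :
    floquetPrimitive a κ h (t + a) = floquetPrimitive a κ h t := by
  rw [floquetPrimitive, floquetPrimitive]
  congr 1
  refine intervalIntegral.integral_congr fun s _ => ?_
  simp only [add_right_comm t a s, hp]

lemma continuous_floquetPrimitive (hc : Continuous h) (hp : ∀ t, h (t + a) = h t)
    (hκ : Complex.exp (Complex.I * κ * a) ≠ 1) : Continuous (floquetPrimitive a κ h) := by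
  have h1 : Continuous fun t : ℝ => Complex.exp (Complex.I * κ * t) * floquetPrimitive a κ h t :=
    continuous_iff_continuousAt.2 fun t =>
      (hasDerivAt_exp_mul_floquetPrimitive hc hp hκ t).continuousAt
  have h2 : floquetPrimitive a κ h = fun t : ℝ => Complex.exp (-(Complex.I * κ * t)) *
      (Complex.exp (Complex.I * κ * t) * floquetPrimitive a κ h t) := by
    funext t
    rw [← mul_assoc, ← Complex.exp_add]
    simp
  rw [h2]
  fun_prop

lemma norm_exp_I_mul_mul (κ : ℂ) (t : ℝ) :
    ‖Complex.exp (Complex.I * κ * t)‖ = Real.exp (-κ.im * t) := by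
  rw [Complex.norm_exp]
  simp

lemma norm_exp_I_mul_mul_le (hκ : |κ.im| ≤ 1) {s : ℝ} (hs : s ∈ Icc 0 a) :
    ‖Complex.exp (Complex.I * κ * s)‖ ≤ Real.exp a := by
  rw [norm_exp_I_mul_mul]
  refine Real.exp_le_exp.2 ?_
  have := (abs_le.1 hκ).1
  nlinarith [hs.1, hs.2]

lemma norm_exp_sub_exp_le {u v : ℂ} {c : ℝ} (hu : u.re ≤ c) (hv : v.re ≤ c) :
    ‖Complex.exp u - Complex.exp v‖ ≤ Real.exp c * ‖u - v‖ := by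
  refine Convex.norm_image_sub_le_of_norm_hasDerivWithin_le (s := {z : ℂ | z.re ≤ c})
    (fun z _ => (Complex.hasDerivAt_exp z).hasDerivWithinAt) (fun z hz => ?_)
    (convex_halfSpace_re_le c) hv hu
  rw [Complex.norm_exp]
  exact Real.exp_le_exp.2 hz

/-- The factor `c = max (-Im κ) (-Im κ')` governs the growth of both exponentials. -/
lemma norm_exp_I_mul_sub_le {c t : ℝ} (ht : 0 ≤ t) (hκ : -κ.im ≤ c) (hκ' : -κ'.im ≤ c) :
    ‖Complex.exp (Complex.I * κ * t) - Complex.exp (Complex.I * κ' * t)‖ ≤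
      Real.exp (c * t) * (‖κ - κ'‖ * t) := by
  have hre : ∀ κ : ℂ, (Complex.I * κ * t).re = -κ.im * t := fun κ => by simp
  have h1 := norm_exp_sub_exp_le (u := Complex.I * κ * t) (v := Complex.I * κ' * t) (c := c * t)
    (by rw [hre]; gcongr) (by rw [hre]; gcongr)
  rwa [← sub_mul, ← mul_sub, norm_mul, norm_mul, Complex.norm_I, one_mul, Complex.norm_real,
    Real.norm_eq_abs, abs_of_nonneg ht] at h1

lemma norm_integral_exp_mul_le (ha : 0 ≤ a) (hκ : |κ.im| ≤ 1) (hM : ∀ t, ‖h t‖ ≤ M) (t : ℝ) :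
    ‖∫ s in (0 : ℝ)..a, Complex.exp (Complex.I * κ * s) * h (t + s)‖ ≤ Real.exp a * M * a := by
  have h1 := intervalIntegral.norm_integral_le_of_norm_le_const (a := 0) (b := a)
    (f := fun s : ℝ => Complex.exp (Complex.I * κ * s) * h (t + s)) (C := Real.exp a * M)
    (fun s hs => by
      rw [uIoc_of_le ha] at hs
      rw [norm_mul]
      exact mul_le_mul (norm_exp_I_mul_mul_le hκ ⟨hs.1.le, hs.2⟩) (hM _) (norm_nonneg _)
        (Real.exp_pos _).le)
  rwa [sub_zero, abs_of_nonneg ha] at h1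

lemma norm_floquetPrimitive_le (ha : 0 ≤ a) (hm : 0 < m) (hκ : |κ.im| ≤ 1)
    (hκm : m ≤ ‖Complex.exp (Complex.I * κ * a) - 1‖) (hM : ∀ t, ‖h t‖ ≤ M) (t : ℝ) :
    ‖floquetPrimitive a κ h t‖ ≤ Real.exp a * a / m * M := by
  have hM0 : 0 ≤ M := (norm_nonneg _).trans (hM 0)
  rw [floquetPrimitive, norm_mul, norm_inv]
  calc _ ≤ m⁻¹ * (Real.exp a * M * a) :=
        mul_le_mul (inv_anti₀ hm hκm) (norm_integral_exp_mul_le ha hκ hM t) (norm_nonneg _)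
          (by positivity)
    _ = _ := by ring

lemma floquetPrimitive_sub (hc : Continuous h) (hc' : Continuous h') (t : ℝ) :
    floquetPrimitive a κ h t - floquetPrimitive a κ h' t =
      floquetPrimitive a κ (fun t => h t - h' t) t := by
  simp only [floquetPrimitive, mul_sub]
  rw [intervalIntegral.integral_sub
    (Continuous.intervalIntegrable (by fun_prop) _ _)
    (Continuous.intervalIntegrable (by fun_prop) _ _), mul_sub]

lemma norm_floquetPrimitive_sub_le (ha : 0 ≤ a) (hm : 0 < m) (hc : Continuous h)
    (hκ : |κ.im| ≤ 1) (hκ' : |κ'.im| ≤ 1)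
    (hκm : m ≤ ‖Complex.exp (Complex.I * κ * a) - 1‖)
    (hκm' : m ≤ ‖Complex.exp (Complex.I * κ' * a) - 1‖) (hM : ∀ t, ‖h t‖ ≤ M) (t : ℝ) :
    ‖floquetPrimitive a κ h t - floquetPrimitive a κ' h t‖ ≤
      (Real.exp a * a / m * a + (Real.exp a * a / m) ^ 2) * M * ‖κ - κ'‖ := by
  have hM0 : 0 ≤ M := (norm_nonneg _).trans (hM 0)
  have hlip : ∀ s ∈ Icc 0 a, ‖Complex.exp (Complex.I * κ * s) - Complex.exp (Complex.I * κ' * s)‖ ≤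
      Real.exp a * (‖κ - κ'‖ * a) := fun s hs => by
    refine (norm_exp_I_mul_sub_le (c := 1) hs.1 (by linarith [(abs_le.1 hκ).1])
      (by linarith [(abs_le.1 hκ').1])).trans ?_
    rw [one_mul]
    have h1 := hs.1
    have h2 := hs.2
    gcongr
  set A := ∫ s in (0 : ℝ)..a, Complex.exp (Complex.I * κ * s) * h (t + s) with hA
  set A' := ∫ s in (0 : ℝ)..a, Complex.exp (Complex.I * κ' * s) * h (t + s) with hA'
  have hAA : ‖A - A'‖ ≤ Real.exp a * (‖κ - κ'‖ * a) * M * a := by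
    rw [hA, hA', ← intervalIntegral.integral_sub
      (Continuous.intervalIntegrable (by fun_prop) _ _)
      (Continuous.intervalIntegrable (by fun_prop) _ _)]
    have h1 := intervalIntegral.norm_integral_le_of_norm_le_const (a := 0) (b := a)
      (f := fun s : ℝ => Complex.exp (Complex.I * κ * s) * h (t + s) -
        Complex.exp (Complex.I * κ' * s) * h (t + s))
      (C := Real.exp a * (‖κ - κ'‖ * a) * M)
      (fun s hs => by
        rw [uIoc_of_le ha] at hs
        rw [← sub_mul, norm_mul]
        exact mul_le_mul (hlip s ⟨hs.1.le, hs.2⟩) (hM _) (norm_nonneg _) (by positivity))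
    rwa [sub_zero, abs_of_nonneg ha] at h1
  set ρ := Complex.exp (Complex.I * κ * a) with hρ
  set ρ' := Complex.exp (Complex.I * κ' * a) with hρ'
  have hne : ρ - 1 ≠ 0 := norm_pos_iff.1 (hm.trans_le hκm)
  have hne' : ρ' - 1 ≠ 0 := norm_pos_iff.1 (hm.trans_le hκm')
  have hsplit : (ρ - 1)⁻¹ * A - (ρ' - 1)⁻¹ * A' =
      (ρ - 1)⁻¹ * (A - A') + (ρ - 1)⁻¹ * (ρ' - 1)⁻¹ * (ρ' - ρ) * A' := by
    field_simp
    ring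
  have hi := inv_anti₀ hm hκm
  have hi' := inv_anti₀ hm hκm'
  have hρρ : ‖ρ' - ρ‖ ≤ Real.exp a * (‖κ - κ'‖ * a) := by
    rw [norm_sub_rev]
    exact hlip a ⟨ha, le_rfl⟩
  have hA'b := norm_integral_exp_mul_le ha hκ' hM t
  rw [← hA'] at hA'b
  simp only [floquetPrimitive]
  rw [hsplit]
  calc _ ≤ ‖ρ - 1‖⁻¹ * ‖A - A'‖ + ‖ρ - 1‖⁻¹ * ‖ρ' - 1‖⁻¹ * ‖ρ' - ρ‖ * ‖A'‖ := by
        refine (norm_add_le _ _).trans_eq ?_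
        simp only [norm_mul, norm_inv]
    _ ≤ m⁻¹ * (Real.exp a * (‖κ - κ'‖ * a) * M * a) +
        m⁻¹ * m⁻¹ * (Real.exp a * (‖κ - κ'‖ * a)) * (Real.exp a * M * a) := by
        gcongr
    _ = _ := by ring

/-- Weighted integrals of a quasi-periodic function that does not grow. -/
lemma exists_tendsto_integral_exp (ha : 0 ≤ a) (hm : 0 < m) (hc : Continuous h)
    (hp : ∀ t, h (t + a) = h t) (hM : ∀ t, ‖h t‖ ≤ M) (hκ0 : 0 ≤ κ.im) (hκ1 : κ.im ≤ 1)
    (hκm : m ≤ ‖Complex.exp (Complex.I * κ * a) - 1‖) {γ x : ℝ} (hγ : 0 < γ) (hx : 0 ≤ x) :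
    ∃ L : ℂ, Tendsto (fun X => ∫ t in x..X, Complex.exp (Complex.I * κ * t) * h t *
      (weight γ t : ℂ)) atTop (𝓝 L) ∧
      ‖L‖ ≤ 2 * (Real.exp a * a / m * M) * Real.exp (-κ.im * x) * weight γ x := by
  have hM0 : 0 ≤ M := (norm_nonneg _).trans (hM 0)
  have hκa : |κ.im| ≤ 1 := by rwa [abs_of_nonneg hκ0]
  have hne : Complex.exp (Complex.I * κ * a) ≠ 1 := sub_ne_zero.1
    (norm_pos_iff.1 (hm.trans_le hκm))
  obtain ⟨L, hL, hLn⟩ := exists_tendsto_integral_mul_weight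
    (hasDerivAt_exp_mul_floquetPrimitive hc hp hne) (by fun_prop) hγ hx
    (B := Real.exp a * a / m * M * Real.exp (-κ.im * x)) (fun t ht => by
      rw [norm_mul, norm_exp_I_mul_mul, mul_comm]
      refine mul_le_mul (norm_floquetPrimitive_le ha hm hκa hκm hM t) (Real.exp_le_exp.2 ?_)
        (Real.exp_pos _).le (by positivity)
      nlinarith)
  exact ⟨L, hL, hLn.trans_eq (by ring)⟩

/-- Weighted integrals over `[0, x]` of a quasi-periodic function that grows like `e^{τx}`,
`τ = -Im κ`, after subtraction of the limit for a real frequency `κ'` at distance `O(τ)`. -/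
lemma exists_norm_integral_exp_sub_le (ha : 0 ≤ a) (hm : 0 < m) {B : ℝ} (hB : 0 ≤ B) :
    ∃ C : ℝ, 0 ≤ C ∧ ∀ (κ κ' : ℂ) (h : ℝ → ℂ) (M γ : ℝ), Continuous h →
      (∀ t, h (t + a) = h t) → (∀ t, ‖h t‖ ≤ M) → κ.im ≤ 0 → -1 ≤ κ.im → κ'.im = 0 →
      ‖κ - κ'‖ ≤ B * -κ.im → m ≤ ‖Complex.exp (Complex.I * κ * a) - 1‖ →
      m ≤ ‖Complex.exp (Complex.I * κ' * a) - 1‖ → 0 < γ → γ ≤ 1 →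
      ∃ L : ℂ, Tendsto (fun X => ∫ t in (0 : ℝ)..X, Complex.exp (Complex.I * κ' * t) * h t *
        (weight γ t : ℂ)) atTop (𝓝 L) ∧ ∀ x, 0 ≤ x →
        ‖(∫ t in (0 : ℝ)..x, Complex.exp (Complex.I * κ * t) * h t * (weight γ t : ℂ)) - L‖ ≤
          C * M * Real.exp (-κ.im * x) * weight γ x := by
  set N := Real.exp a * a / m with hN
  have hN0 : 0 ≤ N := by positivity
  set Λ := N * a + N ^ 2 with hΛ
  have hΛ0 : 0 ≤ Λ := by positivity
  set K := 2 * N + 2 * N ^ 2 + Λ * B + 2 * N * Λ * B + B * N + B * N ^ 2 with hK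
  have hK0 : 0 ≤ K := by positivity
  refine ⟨16 * K + 2 * N, by positivity, ?_⟩
  intro κ κ' h M γ hc hp hM hκ0 hκ1 hκ'0 hκκ hκm hκm' hγ hγ1
  have hM0 : 0 ≤ M := (norm_nonneg _).trans (hM 0)
  set τ := -κ.im with hτ
  have hτ0 : 0 ≤ τ := by linarith
  have hτ1 : τ ≤ 1 := by linarith
  have hκa : |κ.im| ≤ 1 := abs_le.2 ⟨hκ1, by linarith⟩
  have hκ'a : |κ'.im| ≤ 1 := by simp [hκ'0]
  have hne : Complex.exp (Complex.I * κ * a) ≠ 1 := sub_ne_zero.1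
    (norm_pos_iff.1 (hm.trans_le hκm))
  have hne' : Complex.exp (Complex.I * κ' * a) ≠ 1 := sub_ne_zero.1
    (norm_pos_iff.1 (hm.trans_le hκm'))
  -- iterated periodic factors for the two frequencies
  set h₁ := floquetPrimitive a κ h with hh₁
  set h₁' := floquetPrimitive a κ' h with hh₁'
  set h₂ := floquetPrimitive a κ h₁ with hh₂
  set h₂' := floquetPrimitive a κ' h₁' with hh₂'
  have c₁ : Continuous h₁ := continuous_floquetPrimitive hc hp hne
  have c₁' : Continuous h₁' := continuous_floquetPrimitive hc hp hne'
  have p₁ : ∀ t, h₁ (t + a) = h₁ t := floquetPrimitive_periodic hp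
  have p₁' : ∀ t, h₁' (t + a) = h₁' t := floquetPrimitive_periodic hp
  have b₁ : ∀ t, ‖h₁ t‖ ≤ N * M := norm_floquetPrimitive_le ha hm hκa hκm hM
  have b₁' : ∀ t, ‖h₁' t‖ ≤ N * M := norm_floquetPrimitive_le ha hm hκ'a hκm' hM
  have b₂ : ∀ t, ‖h₂ t‖ ≤ N * (N * M) := norm_floquetPrimitive_le ha hm hκa hκm b₁
  have b₂' : ∀ t, ‖h₂' t‖ ≤ N * (N * M) := norm_floquetPrimitive_le ha hm hκ'a hκm' b₁'
  have d₁ : ∀ t, ‖h₁ t - h₁' t‖ ≤ Λ * M * (B * τ) := fun t =>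
    (norm_floquetPrimitive_sub_le ha hm hc hκa hκ'a hκm hκm' hM t).trans (by gcongr)
  have d₂ : ∀ t, ‖h₂ t - h₂' t‖ ≤ 2 * (N * (Λ * M * (B * τ))) := fun t => by
    have e1 := norm_floquetPrimitive_le (h := fun t => h₁ t - h₁' t) ha hm hκa hκm d₁ t
    rw [← floquetPrimitive_sub c₁ c₁'] at e1
    have e2 := norm_floquetPrimitive_sub_le ha hm c₁' hκa hκ'a hκm hκm' b₁' t
    have e3 : ‖h₂ t - h₂' t‖ ≤ N * (Λ * M * (B * τ)) + Λ * (N * M) * ‖κ - κ'‖ := by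
      have : h₂ t - h₂' t = (floquetPrimitive a κ h₁ t - floquetPrimitive a κ h₁' t) +
          (floquetPrimitive a κ h₁' t - floquetPrimitive a κ' h₁' t) := by
        rw [hh₂, hh₂']
        ring
      rw [this]
      exact (norm_add_le _ _).trans (add_le_add e1 e2)
    have e4 : Λ * (N * M) * ‖κ - κ'‖ ≤ Λ * (N * M) * (B * τ) := by gcongr
    calc _ ≤ _ := e3
      _ ≤ N * (Λ * M * (B * τ)) + Λ * (N * M) * (B * τ) := by linarith
      _ = _ := by ring
  have hexp' : ∀ t : ℝ, ‖Complex.exp (Complex.I * κ' * t)‖ = 1 := fun t => by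
    rw [norm_exp_I_mul_mul, hκ'0]
    simp
  have hexpd : ∀ t : ℝ, 0 ≤ t →
      ‖Complex.exp (Complex.I * κ * t) - Complex.exp (Complex.I * κ' * t)‖ ≤
        Real.exp (τ * t) * (B * τ * t) := fun t ht =>
    (norm_exp_I_mul_sub_le ht le_rfl (by rw [hκ'0, neg_zero]; exact hτ0)).trans (by gcongr)
  -- the two ways of bounding the difference of two quasi-periodic functions
  have crude : ∀ (u u' : ℝ → ℂ) (P : ℝ), (∀ t, ‖u t‖ ≤ P) → (∀ t, ‖u' t‖ ≤ P) → ∀ t : ℝ, 0 ≤ t →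
      ‖Complex.exp (Complex.I * κ * t) * u t - Complex.exp (Complex.I * κ' * t) * u' t‖ ≤
        2 * P * Real.exp (τ * t) := by
    intro u u' P hu hu' t ht
    have hP : 0 ≤ P := (norm_nonneg _).trans (hu 0)
    refine (norm_sub_le _ _).trans ?_
    rw [norm_mul, norm_mul, hexp', norm_exp_I_mul_mul, one_mul, ← hτ]
    have e1 : 1 ≤ Real.exp (τ * t) := Real.one_le_exp (by positivity)
    have e2 := hu t
    have e3 := hu' t
    have e4 := mul_le_mul_of_nonneg_left e2 (Real.exp_pos (τ * t)).le
    nlinarith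
  have fine : ∀ (u u' : ℝ → ℂ) (P D : ℝ), (∀ t, ‖u' t‖ ≤ P) → (∀ t, ‖u t - u' t‖ ≤ D * τ) →
      0 ≤ D → ∀ t : ℝ, 0 ≤ t →
      ‖Complex.exp (Complex.I * κ * t) * u t - Complex.exp (Complex.I * κ' * t) * u' t‖ ≤
        (D + B * P) * (τ * (t + 1)) * Real.exp (τ * t) := by
    intro u u' P D hu' hd hD t ht
    have hP : 0 ≤ P := (norm_nonneg _).trans (hu' 0)
    rw [show Complex.exp (Complex.I * κ * t) * u t - Complex.exp (Complex.I * κ' * t) * u' t =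
      Complex.exp (Complex.I * κ * t) * (u t - u' t) + (Complex.exp (Complex.I * κ * t) -
        Complex.exp (Complex.I * κ' * t)) * u' t by ring]
    refine (norm_add_le _ _).trans ?_
    rw [norm_mul, norm_mul, norm_exp_I_mul_mul, ← hτ]
    calc _ ≤ Real.exp (τ * t) * (D * τ) + Real.exp (τ * t) * (B * τ * t) * P :=
          add_le_add (mul_le_mul_of_nonneg_left (hd t) (Real.exp_pos _).le)
            (mul_le_mul (hexpd t ht) (hu' t) (norm_nonneg _) (by positivity))
      _ ≤ Real.exp (τ * t) * (D * τ) + Real.exp (τ * t) * (B * τ * t) * P +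
          Real.exp (τ * t) * (D * τ * t + B * P * τ) := by
          have : 0 ≤ Real.exp (τ * t) * (D * τ * t + B * P * τ) := by positivity
          linarith
      _ = _ := by ring
  obtain ⟨L, hL, -⟩ := exists_tendsto_integral_exp ha hm hc hp hM hκ'0.ge (by simp [hκ'0]) hκm'
    hγ le_rfl
  refine ⟨L, hL, fun x hx => ?_⟩
  obtain ⟨Lx, hLx, hLxn⟩ := exists_tendsto_integral_exp ha hm hc hp hM hκ'0.ge (by simp [hκ'0])
    hκm' hγ hx
  have hcont : ∀ κ : ℂ, Continuous fun t : ℝ => Complex.exp (Complex.I * κ * t) * h t :=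
    fun κ => by fun_prop
  -- the tail of the integral for `κ'` is small by itself
  have hLsplit : L = (∫ t in (0 : ℝ)..x, Complex.exp (Complex.I * κ' * t) * h t *
      (weight γ t : ℂ)) + Lx := by
    refine tendsto_nhds_unique hL ((hLx.const_add _).congr' ?_)
    filter_upwards [eventually_ge_atTop x] with X hX
    exact intervalIntegral.integral_add_adjacent_intervals
      (intervalIntegrable_mul_weight (hcont κ') γ le_rfl hx)
      (intervalIntegrable_mul_weight (hcont κ') γ hx (hx.trans hX))
  have hmain := norm_integral_mul_weight_le_exp (γ := γ) (τ := τ) (K := K * M) (x := x)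
    (fun t => (hasDerivAt_exp_mul_floquetPrimitive hc hp hne t).sub
      (hasDerivAt_exp_mul_floquetPrimitive hc hp hne' t))
    (fun t => (hasDerivAt_exp_mul_floquetPrimitive c₁ p₁ hne t).sub
      (hasDerivAt_exp_mul_floquetPrimitive c₁' p₁' hne' t))
    ((hcont κ).sub (hcont κ')) hγ hγ1 hτ0 hτ1 (by positivity)
    (fun t ht => (crude h₁ h₁' (N * M) b₁ b₁' t ht).trans (by
      refine mul_le_mul_of_nonneg_right ?_ (Real.exp_pos _).le
      rw [hK, ← mul_assoc]
      refine mul_le_mul_of_nonneg_right ?_ hM0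
      have : 0 ≤ 2 * N ^ 2 + Λ * B + 2 * N * Λ * B + B * N + B * N ^ 2 := by positivity
      linarith))
    (fun t ht => (crude h₂ h₂' (N * (N * M)) b₂ b₂' t ht).trans (by
      refine mul_le_mul_of_nonneg_right ?_ (Real.exp_pos _).le
      rw [hK, show 2 * (N * (N * M)) = 2 * N ^ 2 * M by ring]
      refine mul_le_mul_of_nonneg_right ?_ hM0
      have : 0 ≤ 2 * N + Λ * B + 2 * N * Λ * B + B * N + B * N ^ 2 := by positivity
      linarith))
    (by
      have e1 := fine h₁ h₁' (N * M) (Λ * M * B) b₁' (fun t => (d₁ t).trans_eq (by ring))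
        (by positivity) 0 le_rfl
      refine e1.trans ?_
      simp only [zero_add, mul_one, mul_zero, Real.exp_zero]
      refine mul_le_mul_of_nonneg_right ?_ hτ0
      rw [hK, show Λ * M * B + B * (N * M) = (Λ * B + B * N) * M by ring]
      refine mul_le_mul_of_nonneg_right ?_ hM0
      have : 0 ≤ 2 * N + 2 * N ^ 2 + 2 * N * Λ * B + B * N ^ 2 := by positivity
      linarith)
    (fun t ht => (fine h₂ h₂' (N * (N * M)) (2 * N * Λ * M * B) b₂'
      (fun t => (d₂ t).trans_eq (by ring)) (by positivity) t ht).trans (by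
      refine mul_le_mul_of_nonneg_right (mul_le_mul_of_nonneg_right ?_ (by positivity))
        (Real.exp_pos _).le
      rw [hK, show 2 * N * Λ * M * B + B * (N * (N * M)) = (2 * N * Λ * B + B * N ^ 2) * M by ring]
      refine mul_le_mul_of_nonneg_right ?_ hM0
      have : 0 ≤ 2 * N + 2 * N ^ 2 + Λ * B + B * N := by positivity
      linarith)) hx
  have hint : ∀ κ : ℂ, IntervalIntegrable (fun t : ℝ => Complex.exp (Complex.I * κ * t) * h t *
      (weight γ t : ℂ)) volume 0 x := fun κ => intervalIntegrable_mul_weight (hcont κ) γ le_rfl hx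
  simp only [sub_mul] at hmain
  rw [intervalIntegral.integral_sub (hint κ) (hint κ')] at hmain
  rw [hLsplit, ← sub_sub]
  refine (norm_sub_le _ _).trans ((add_le_add hmain hLxn).trans ?_)
  have hw := weight_pos γ hx
  have e1 : 1 ≤ Real.exp (τ * x) := Real.one_le_exp (by positivity)
  have e2 : 2 * (N * M) * weight γ x ≤ 2 * (N * M) * weight γ x * Real.exp (τ * x) :=
    le_mul_of_one_le_right (by positivity) e1
  rw [hκ'0]
  simp only [neg_zero, zero_mul, Real.exp_zero, mul_one]
  calc _ ≤ 16 * (K * M) * Real.exp (τ * x) * weight γ x +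
        2 * (N * M) * weight γ x * Real.exp (τ * x) := by linarith
    _ = _ := by ring

end Floquet

/-! ### The integrands with the sine factor -/

section Sine

/-- `sin(2ωt + δ) h(t) e^{iκt} / (t + 1)^γ`. -/
noncomputable def sineIntegrand (ω δ γ : ℝ) (h : ℝ → ℂ) (κ : ℂ) (t : ℝ) : ℂ :=
  ((Real.sin (2 * ω * t + δ) / (t + 1) ^ γ : ℝ) : ℂ) * h t * Complex.exp (Complex.I * κ * t)

variable {a m M ω δ γ : ℝ} {κ κ' : ℂ} {h : ℝ → ℂ}

/-- The sine splits the integrand into two exponentials, with frequencies shifted by `± 2ω`. -/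
lemma exists_sineIntegrand_eq (ω δ γ : ℝ) : ∃ c c' : ℂ, ‖c‖ ≤ 1 ∧ ‖c'‖ ≤ 1 ∧
    ∀ (h : ℝ → ℂ) (κ : ℂ) (t : ℝ), 0 ≤ t → sineIntegrand ω δ γ h κ t =
      c * (Complex.exp (Complex.I * (κ + (2 * ω : ℝ)) * t) * h t * (weight γ t : ℂ)) +
      c' * (Complex.exp (Complex.I * (κ + (-(2 * ω) : ℝ)) * t) * h t * (weight γ t : ℂ)) := by
  have hn : ∀ θ : ℝ, ‖Complex.exp (Complex.I * θ)‖ = 1 := fun θ => by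
    rw [norm_exp_I_mul]
    simp
  refine ⟨Complex.exp (Complex.I * δ) / (2 * Complex.I),
    -(Complex.exp (Complex.I * (-δ : ℝ)) / (2 * Complex.I)), ?_, ?_, fun h κ t ht => ?_⟩
  · rw [norm_div, hn]
    norm_num
  · rw [norm_neg, norm_div, hn]
    norm_num
  · have hsin : (Real.sin (2 * ω * t + δ) : ℂ) = Complex.exp (Complex.I * δ) / (2 * Complex.I) *
        Complex.exp (Complex.I * (2 * ω : ℝ) * t) -
        Complex.exp (Complex.I * (-δ : ℝ)) / (2 * Complex.I) *
        Complex.exp (Complex.I * (-(2 * ω) : ℝ) * t) := by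
      rw [Complex.ofReal_sin, Complex.sin, div_mul_eq_mul_div, div_mul_eq_mul_div,
        ← Complex.exp_add, ← Complex.exp_add, ← sub_div]
      have e1 : ((2 * ω * t + δ : ℝ) : ℂ) * Complex.I =
          Complex.I * δ + Complex.I * (2 * ω : ℝ) * t := by
        push_cast
        ring
      have e2 : -((2 * ω * t + δ : ℝ) : ℂ) * Complex.I =
          Complex.I * (-δ : ℝ) + Complex.I * (-(2 * ω) : ℝ) * t := by
        push_cast
        ring
      rw [e1, e2, div_eq_div_iff two_ne_zero (mul_ne_zero two_ne_zero Complex.I_ne_zero)]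
      linear_combination (2 * Complex.exp (Complex.I * (-δ : ℝ) + Complex.I * (-(2 * ω) : ℝ) * t) -
        2 * Complex.exp (Complex.I * δ + Complex.I * (2 * ω : ℝ) * t)) * Complex.I_sq
    have hw : ((t + 1) ^ γ : ℝ)⁻¹ = weight γ t := by
      rw [weight, Real.rpow_neg (by linarith)]
    have hexp : ∀ s : ℝ, Complex.exp (Complex.I * (κ + s) * t) =
        Complex.exp (Complex.I * s * t) * Complex.exp (Complex.I * κ * t) := fun s => by
      rw [← Complex.exp_add]
      ring_nf
    rw [sineIntegrand, div_eq_mul_inv, hw, Complex.ofReal_mul, hsin, hexp, hexp]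
    ring

lemma continuousOn_sineIntegrand (hc : Continuous h) :
    ContinuousOn (sineIntegrand ω δ γ h κ) (Ioi (-1)) := by
  have h1 : ContinuousOn (fun t : ℝ => Real.sin (2 * ω * t + δ) / (t + 1) ^ γ) (Ioi (-1)) := by
    refine ContinuousOn.div (Continuous.continuousOn (by fun_prop)) ?_ fun t ht => ?_
    · refine ContinuousOn.rpow_const (Continuous.continuousOn (by fun_prop)) fun t ht => Or.inl ?_
      have : (-1 : ℝ) < t := ht
      linarith
    · have : (-1 : ℝ) < t := ht
      exact (Real.rpow_pos_of_pos (by linarith) _).ne'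
  exact ((Complex.continuous_ofReal.comp_continuousOn h1).mul hc.continuousOn).mul
    (Continuous.continuousOn (by fun_prop))

lemma intervalIntegrable_sineIntegrand (hc : Continuous h) {x X : ℝ} (hx : 0 ≤ x) (hX : 0 ≤ X) :
    IntervalIntegrable (sineIntegrand ω δ γ h κ) volume x X :=
  ((continuousOn_sineIntegrand hc).mono fun t ht => by
    have : (0 : ℝ) ≤ t := uIcc_subset_Ici hx hX ht
    exact lt_of_lt_of_le (by norm_num) this).intervalIntegrable

lemma hasDerivAt_integral_sineIntegrand (hc : Continuous h) {x : ℝ} (hx : 0 ≤ x) :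
    HasDerivAt (fun s => ∫ t in (0 : ℝ)..s, sineIntegrand ω δ γ h κ t)
      (sineIntegrand ω δ γ h κ x) x := by
  have hmem : x ∈ Ioi (-1 : ℝ) := lt_of_lt_of_le (by norm_num) hx
  exact intervalIntegral.integral_hasDerivAt_right
    (intervalIntegrable_sineIntegrand hc le_rfl hx)
    ((continuousOn_sineIntegrand hc).stronglyMeasurableAtFilter isOpen_Ioi x hmem)
    ((continuousOn_sineIntegrand hc).continuousAt (isOpen_Ioi.mem_nhds hmem))

lemma norm_sineIntegrand_le (hM : ∀ t, ‖h t‖ ≤ M) {x : ℝ} (hx : 0 ≤ x) :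
    ‖sineIntegrand ω δ γ h κ x‖ ≤ M * Real.exp (-κ.im * x) * weight γ x := by
  have hpow : 0 < (x + 1) ^ γ := Real.rpow_pos_of_pos (by linarith) _
  rw [sineIntegrand, norm_mul, norm_mul, norm_exp_I_mul_mul, Complex.norm_real, Real.norm_eq_abs,
    abs_div, abs_of_pos hpow, weight, Real.rpow_neg (by linarith)]
  have h1 : |Real.sin (2 * ω * x + δ)| / (x + 1) ^ γ ≤ ((x + 1) ^ γ)⁻¹ := by
    rw [div_eq_mul_inv]
    exact mul_le_of_le_one_left (by positivity) (Real.abs_sin_le_one _)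
  calc _ ≤ ((x + 1) ^ γ)⁻¹ * M * Real.exp (-κ.im * x) := by
        have := hM x
        gcongr
    _ = _ := by ring

lemma intervalIntegral_sineIntegrand_eq {c c' : ℂ}
    (he : ∀ t : ℝ, 0 ≤ t → sineIntegrand ω δ γ h κ t =
      c * (Complex.exp (Complex.I * (κ + (2 * ω : ℝ)) * t) * h t * (weight γ t : ℂ)) +
      c' * (Complex.exp (Complex.I * (κ + (-(2 * ω) : ℝ)) * t) * h t * (weight γ t : ℂ)))
    (hc : Continuous h) {x X : ℝ} (hx : 0 ≤ x) (hX : 0 ≤ X) :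
    ∫ t in x..X, sineIntegrand ω δ γ h κ t =
      c * (∫ t in x..X, Complex.exp (Complex.I * (κ + (2 * ω : ℝ)) * t) * h t * (weight γ t : ℂ)) +
      c' * ∫ t in x..X, Complex.exp (Complex.I * (κ + (-(2 * ω) : ℝ)) * t) * h t *
        (weight γ t : ℂ) := by
  rw [intervalIntegral.integral_congr (g := fun t : ℝ => _)
    (fun t ht => he t (uIcc_subset_Ici hx hX ht)), intervalIntegral.integral_add,
    intervalIntegral.integral_const_mul, intervalIntegral.integral_const_mul]
  · exact (intervalIntegrable_mul_weight (by fun_prop) γ hx hX).const_mul _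
  · exact (intervalIntegrable_mul_weight (by fun_prop) γ hx hX).const_mul _

lemma exists_tendsto_integral_sineIntegrand (ha : 0 ≤ a) (hm : 0 < m) (hc : Continuous h)
    (hp : ∀ t, h (t + a) = h t) (hM : ∀ t, ‖h t‖ ≤ M) (hκ0 : 0 ≤ κ.im) (hκ1 : κ.im ≤ 1)
    (hκm : ∀ s : ℝ, s = 2 * ω ∨ s = -(2 * ω) →
      m ≤ ‖Complex.exp (Complex.I * (κ + s) * a) - 1‖) (hγ : 0 < γ) {x : ℝ} (hx : 0 ≤ x) :
    ∃ L : ℂ, Tendsto (fun X => ∫ t in x..X, sineIntegrand ω δ γ h κ t) atTop (𝓝 L) ∧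
      ‖L‖ ≤ 4 * (Real.exp a * a / m * M) * Real.exp (-κ.im * x) * weight γ x := by
  obtain ⟨c, c', hc1, hc1', he⟩ := exists_sineIntegrand_eq ω δ γ
  have him : ∀ s : ℝ, (κ + s).im = κ.im := fun s => by simp
  obtain ⟨L, hL, hLn⟩ := exists_tendsto_integral_exp (κ := κ + (2 * ω : ℝ)) ha hm hc hp hM
    (by rwa [him]) (by rwa [him]) (hκm _ (Or.inl rfl)) hγ hx
  obtain ⟨L', hL', hLn'⟩ := exists_tendsto_integral_exp (κ := κ + (-(2 * ω) : ℝ)) ha hm hc hp hM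
    (by rwa [him]) (by rwa [him]) (hκm _ (Or.inr rfl)) hγ hx
  rw [him] at hLn hLn'
  refine ⟨c * L + c' * L', ?_, ?_⟩
  · refine ((hL.const_mul c).add (hL'.const_mul c')).congr' ?_
    filter_upwards [eventually_ge_atTop 0] with X hX
    exact (intervalIntegral_sineIntegrand_eq (he h κ) hc hx hX).symm
  · refine (norm_add_le _ _).trans ?_
    rw [norm_mul, norm_mul]
    have h1 := (mul_le_of_le_one_left (norm_nonneg L) hc1).trans hLn
    have h2 := (mul_le_of_le_one_left (norm_nonneg L') hc1').trans hLn'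
    linarith

lemma exists_norm_integral_sineIntegrand_sub_le (ha : 0 ≤ a) (hm : 0 < m) {B : ℝ} (hB : 0 ≤ B)
    (ω δ : ℝ) (hγ : 0 < γ) (hγ1 : γ ≤ 1) :
    ∃ C : ℝ, 0 ≤ C ∧ ∀ (κ κ' : ℂ) (h : ℝ → ℂ) (M : ℝ), Continuous h →
      (∀ t, h (t + a) = h t) → (∀ t, ‖h t‖ ≤ M) → κ.im ≤ 0 → -1 ≤ κ.im → κ'.im = 0 →
      ‖κ - κ'‖ ≤ B * -κ.im →
      (∀ s : ℝ, s = 2 * ω ∨ s = -(2 * ω) → m ≤ ‖Complex.exp (Complex.I * (κ + s) * a) - 1‖) →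
      (∀ s : ℝ, s = 2 * ω ∨ s = -(2 * ω) → m ≤ ‖Complex.exp (Complex.I * (κ' + s) * a) - 1‖) →
      ∃ L : ℂ, Tendsto (fun X => ∫ t in (0 : ℝ)..X, sineIntegrand ω δ γ h κ' t) atTop (𝓝 L) ∧
        ∀ x, 0 ≤ x → ‖(∫ t in (0 : ℝ)..x, sineIntegrand ω δ γ h κ t) - L‖ ≤
          C * M * Real.exp (-κ.im * x) * weight γ x := by
  obtain ⟨C, hC, hmain⟩ := exists_norm_integral_exp_sub_le ha hm hB
  refine ⟨2 * C, by positivity, ?_⟩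
  intro κ κ' h M hc hp hM hκ0 hκ1 hκ'0 hκκ hκm hκm'
  obtain ⟨c, c', hc1, hc1', he⟩ := exists_sineIntegrand_eq ω δ γ
  have him : ∀ (κ : ℂ) (s : ℝ), (κ + s).im = κ.im := fun κ s => by simp
  have hone : ∀ s : ℝ, s = 2 * ω ∨ s = -(2 * ω) → _ := fun s hs =>
    hmain (κ + s) (κ' + s) h M γ hc hp hM (by rwa [him]) (by rwa [him]) (by rwa [him])
      (by rwa [him, add_sub_add_right_eq_sub]) (hκm s hs) (hκm' s hs) hγ hγ1
  obtain ⟨L, hL, hLn⟩ := hone (2 * ω) (Or.inl rfl)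
  obtain ⟨L', hL', hLn'⟩ := hone (-(2 * ω)) (Or.inr rfl)
  simp only [him] at hLn hLn'
  refine ⟨c * L + c' * L', ?_, fun x hx => ?_⟩
  · refine ((hL.const_mul c).add (hL'.const_mul c')).congr' ?_
    filter_upwards [eventually_ge_atTop 0] with X hX
    exact (intervalIntegral_sineIntegrand_eq (he h κ') hc le_rfl hX).symm
  · rw [intervalIntegral_sineIntegrand_eq (he h κ) hc le_rfl hx, add_sub_add_comm, ← mul_sub,
      ← mul_sub]
    refine (norm_add_le _ _).trans ?_
    rw [norm_mul, norm_mul]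
    have h1 := (mul_le_of_le_one_left (norm_nonneg _) hc1).trans (hLn x hx)
    have h2 := (mul_le_of_le_one_left (norm_nonneg _) hc1').trans (hLn' x hx)
    linarith

end Sine

/-! ### Uniform bounds for the Bloch solutions -/

section Uniform

variable {q : ℝ → ℝ} {a : ℝ} {k : ℂ → ℂ}

/-- On a short interval a solution is controlled by its values at the two end points. -/
lemma exists_step_bound (ha : 0 < a) (hq : ∀ s t, IntervalIntegrable q volume s t) (R : ℝ) :
    ∃ η : ℝ, 0 < η ∧ ∀ (z : ℂ) (y : ℝ → ℂ), ‖z‖ ≤ R → IsSolution q z y → ∀ x ∈ Icc 0 a,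
      ∀ t ∈ Icc x (x + η), ‖y t‖ ≤ 4 * ‖y x‖ + 2 * ‖y (x + η)‖ := by
  have hgi : ∀ s t, IntervalIntegrable (fun t => |q t| + |R|) volume s t := fun s t =>
    (hq s t).abs.add intervalIntegrable_const
  set Γ := ∫ t in (0 : ℝ)..2 * a, (|q t| + |R|) with hΓ
  have hΓ0 : 0 ≤ Γ := intervalIntegral.integral_nonneg (by linarith) fun t _ => by positivity
  set η := min a (1 / (4 * (Γ + 1))) with hη
  have hη0 : 0 < η := lt_min ha (by positivity)
  have hηa : η ≤ a := min_le_left _ _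
  have hηΓ : Γ * η ≤ 1 / 4 := by
    calc Γ * η ≤ Γ * (1 / (4 * (Γ + 1))) := by
          gcongr
          exact min_le_right _ _
      _ ≤ _ := by
          rw [mul_one_div, div_le_div_iff₀ (by positivity) (by norm_num)]
          linarith
  refine ⟨η, hη0, fun z y hz h x hx => ?_⟩
  obtain ⟨t₀, ht₀, hmax⟩ := (isCompact_Icc (a := x) (b := x + η)).exists_isMaxOn
    ⟨x, le_rfl, by linarith⟩ h.continuous.norm.continuousOn
  set S := ‖y t₀‖ with hS
  have hyS : ∀ t ∈ Icc x (x + η), ‖y t‖ ≤ S := fun t ht => hmax ht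
  have hprim := h.isPrimitive_deriv hq
  have hd : ∀ s ∈ Icc x (x + η), ‖deriv y s - deriv y x‖ ≤ Γ * S := by
    intro s hs
    rw [hprim.sub_eq_integral x s]
    have h1 : ‖∫ t in x..s, ((q t : ℂ) - z) * y t‖ ≤ ∫ t in x..s, (|q t| + |R|) * S := by
      refine intervalIntegral.norm_integral_le_of_norm_le hs.1
        (Eventually.of_forall fun t ht => ?_) ((hgi _ _).mul_const _)
      rw [norm_mul]
      refine mul_le_mul ((norm_sub_le _ _).trans ?_) (hyS t ⟨ht.1.le, ht.2.trans hs.2⟩)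
        (norm_nonneg _) (by positivity)
      rw [Complex.norm_real, Real.norm_eq_abs]
      linarith [le_abs_self R]
    rw [intervalIntegral.integral_mul_const] at h1
    refine h1.trans (mul_le_mul_of_nonneg_right ?_ (norm_nonneg _))
    exact intervalIntegral.integral_mono_interval hx.1 hs.1 (by linarith [hs.2, hx.2])
      (Eventually.of_forall fun t => by positivity) (hgi _ _)
  have htaylor : ∀ t ∈ Icc x (x + η), ‖y t - y x - (t - x) * deriv y x‖ ≤ S / 4 := by
    intro t ht
    have h1 : y t - y x - (t - x) * deriv y x = ∫ s in x..t, (deriv y s - deriv y x) := by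
      rw [intervalIntegral.integral_sub (hprim.continuous.intervalIntegrable _ _)
        intervalIntegrable_const, (h.isPrimitive hq).sub_eq_integral x t]
      simp
    have h2 := intervalIntegral.norm_integral_le_of_norm_le_const (a := x) (b := t)
      (f := fun s => deriv y s - deriv y x) (C := Γ * S) (fun s hs => by
        rw [uIoc_of_le ht.1] at hs
        exact hd s ⟨hs.1.le, hs.2.trans ht.2⟩)
    rw [h1]
    refine h2.trans ?_
    rw [abs_of_nonneg (by linarith [ht.1])]
    have hS0 : 0 ≤ S := norm_nonneg _
    calc Γ * S * (t - x) ≤ Γ * S * η := by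
          gcongr
          linarith [ht.2]
      _ = Γ * η * S := by ring
      _ ≤ 1 / 4 * S := by gcongr
      _ = S / 4 := by ring
  have hslope : η * ‖deriv y x‖ ≤ ‖y (x + η)‖ + ‖y x‖ + S / 4 := by
    have h1 := htaylor (x + η) ⟨by linarith, le_rfl⟩
    have h2 : ((x + η : ℝ) - x : ℂ) * deriv y x =
        y (x + η) - y x - (y (x + η) - y x - ((x + η : ℝ) - x) * deriv y x) := by ring
    have h3 : ‖((x + η : ℝ) - x : ℂ) * deriv y x‖ = η * ‖deriv y x‖ := by
      rw [norm_mul, ← Complex.ofReal_sub, Complex.norm_real, Real.norm_eq_abs, add_sub_cancel_left,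
        abs_of_pos hη0]
    rw [← h3, h2]
    refine (norm_sub_le _ _).trans (add_le_add (norm_sub_le _ _) h1)
  have hall : ∀ t ∈ Icc x (x + η), ‖y t‖ ≤ 2 * ‖y x‖ + ‖y (x + η)‖ + S / 2 := by
    intro t ht
    have h1 := htaylor t ht
    have h2 : y t = y x + (t - x) * deriv y x + (y t - y x - (t - x) * deriv y x) := by ring
    have h3 : ‖((t : ℂ) - x) * deriv y x‖ ≤ η * ‖deriv y x‖ := by
      rw [norm_mul, ← Complex.ofReal_sub, Complex.norm_real, Real.norm_eq_abs,
        abs_of_nonneg (by linarith [ht.1])]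
      exact mul_le_mul_of_nonneg_right (by linarith [ht.2]) (norm_nonneg _)
    rw [h2]
    refine norm_add₃_le.trans ?_
    linarith
  intro t ht
  have h1 := hall t₀ ht₀
  have h2 := hyS t ht
  linarith

/-- Pointwise continuity in the spectral parameter bounds a family of solutions uniformly on
`[0, a]`: finitely many grid points suffice. -/
lemma exists_uniform_bound (ha : 0 < a) (hq : ∀ s t, IntervalIntegrable q volume s t) {K : Set ℂ}
    (hK : IsCompact K) {ψ : ℝ → ℂ → ℂ} (hsol : ∀ z ∈ K, IsSolution q z fun x => ψ x z)
    (hcont : ∀ x : ℝ, 0 ≤ x → ContinuousOn (ψ x) K) :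
    ∃ P : ℝ, ∀ z ∈ K, ∀ t ∈ Icc 0 a, ‖ψ t z‖ ≤ P := by
  obtain ⟨R, hR⟩ := hK.isBounded.exists_norm_le
  obtain ⟨η, hη, hstep⟩ := exists_step_bound ha hq R
  choose P hP using fun j : ℕ => hK.exists_bound_of_continuousOn
    (hcont (j * η) (by positivity))
  refine ⟨∑ j ∈ Finset.range (⌊a / η⌋₊ + 2), 4 * |P j|, fun z hz t ht => ?_⟩
  set j := ⌊t / η⌋₊ with hj
  have hj1 : j * η ≤ t := by
    have := Nat.floor_le (div_nonneg ht.1 hη.le)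
    rwa [le_div_iff₀ hη] at this
  have hj2 : t ≤ j * η + η := by
    have := (Nat.lt_floor_add_one (t / η)).le
    rw [div_le_iff₀ hη] at this
    rw [hj]
    linarith
  have hja : j ≤ ⌊a / η⌋₊ := Nat.floor_le_floor (by
    have := ht.2
    gcongr)
  have h1 := hstep z _ (hR z hz) (hsol z hz) (j * η) ⟨by positivity, hj1.trans ht.2⟩ t ⟨hj1, hj2⟩
  have h2 := (hP j z hz).trans (le_abs_self _)
  have h3 := (hP (j + 1) z hz).trans (le_abs_self _)
  rw [show ((j + 1 : ℕ) : ℝ) * η = j * η + η by push_cast; ring] at h3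
  have h4 : ∑ i ∈ {j, j + 1}, 4 * |P i| ≤ ∑ j ∈ Finset.range (⌊a / η⌋₊ + 2), 4 * |P j| := by
    refine Finset.sum_le_sum_of_subset_of_nonneg (fun i hi => ?_) fun i _ _ => by positivity
    simp only [Finset.mem_insert, Finset.mem_singleton] at hi
    rw [Finset.mem_range]
    omega
  rw [Finset.sum_pair (by omega)] at h4
  linarith [abs_nonneg (P (j + 1))]

/-- An `a`-periodic function is bounded by its bound on `[0, a]`. -/
lemma norm_le_of_periodic (ha : 0 < a) {p : ℝ → ℂ} (hp : ∀ t, p (t + a) = p t) {P : ℝ}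
    (hP : ∀ t ∈ Icc 0 a, ‖p t‖ ≤ P) (t : ℝ) : ‖p t‖ ≤ P := by
  obtain ⟨s, hs, hst⟩ := Function.Periodic.exists_mem_Ico₀ (f := p) hp ha t
  rw [hst]
  exact hP s ⟨hs.1, hs.2.le⟩

variable {S : Set ℂ} {ψp ψm : ℝ → ℂ → ℂ} {z : ℂ}

lemma periodicPartP_add (ha : 0 < a) (h : IsBlochPair q a k S ψp ψm) (hz : z ∈ blochDomain q a S)
    (t : ℝ) : periodicPartP a k ψp (t + a) z = periodicPartP a k ψp t z := by
  have ha' : (a : ℂ) ≠ 0 := Complex.ofReal_ne_zero.2 ha.ne'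
  rw [periodicPartP, periodicPartP, h.floquet_p z hz, ← mul_assoc, ← Complex.exp_add]
  congr 2
  push_cast
  field_simp
  ring

lemma periodicPartM_add (ha : 0 < a) (h : IsBlochPair q a k S ψp ψm) (hz : z ∈ blochDomain q a S)
    (t : ℝ) : periodicPartM a k ψm (t + a) z = periodicPartM a k ψm t z := by
  have ha' : (a : ℂ) ≠ 0 := Complex.ofReal_ne_zero.2 ha.ne'
  rw [periodicPartM, periodicPartM, h.floquet_m z hz, ← mul_assoc, ← Complex.exp_add]
  congr 2
  push_cast
  field_simp
  ring

lemma continuous_periodicPartP {ψ : ℝ → ℂ → ℂ} (h : Continuous fun x => ψ x z) :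
    Continuous fun t => periodicPartP a k ψ t z := by
  unfold periodicPartP
  fun_prop

lemma continuous_periodicPartM {ψ : ℝ → ℂ → ℂ} (h : Continuous fun x => ψ x z) :
    Continuous fun t => periodicPartM a k ψ t z := by
  unfold periodicPartM
  fun_prop

lemma norm_exp_mul_div_le (ha : 0 < a) {κ : ℂ} (h : |κ.im| ≤ a / 2) {t : ℝ} (ht : t ∈ Icc 0 a) :
    ‖Complex.exp (Complex.I * κ * t / a)‖ ≤ Real.exp (a / 2) := by
  rw [Complex.norm_exp]
  refine Real.exp_le_exp.2 ?_
  have h1 : (Complex.I * κ * t / a).re = -κ.im * (t / a) := by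
    rw [Complex.div_ofReal_re, Complex.re_mul_ofReal]
    simp
    ring
  have h2 : t / a ≤ 1 := (div_le_one ha).2 ht.2
  have h3 : 0 ≤ t / a := div_nonneg ht.1 ha.le
  rw [h1]
  nlinarith [(abs_le.1 h).1]

/-- The periodic factors are bounded uniformly in `x` and in `z` on compact sets. -/
lemma exists_periodicPart_bound (ha : 0 < a) (hq : ∀ s t, IntervalIntegrable q volume s t)
    {K : Set ℂ} (hK : IsCompact K) (hKS : K ⊆ blochDomain q a S)
    (hψ : IsBlochPair q a k S ψp ψm) (hk : ∀ z ∈ K, |(k z).im| ≤ a / 2) :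
    ∃ M : ℝ, ∀ z ∈ K, ∀ t : ℝ, ‖periodicPartP a k ψp t z ^ 2‖ ≤ M ∧
      ‖periodicPartM a k ψm t z ^ 2‖ ≤ M := by
  obtain ⟨P, hP⟩ := exists_uniform_bound ha hq hK (fun z hz => hψ.solution_p z (hKS hz))
    fun x hx => (hψ.continuous_p x hx).mono hKS
  obtain ⟨P', hP'⟩ := exists_uniform_bound ha hq hK (fun z hz => hψ.solution_m z (hKS hz))
    fun x hx => (hψ.continuous_m x hx).mono hKS
  refine ⟨max ((Real.exp (a / 2) * P) ^ 2) ((Real.exp (a / 2) * P') ^ 2), fun z hz t => ⟨?_, ?_⟩⟩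
  · rw [norm_pow]
    refine le_max_of_le_left (pow_le_pow_left₀ (norm_nonneg _) ?_ 2)
    refine norm_le_of_periodic ha (p := fun t => periodicPartP a k ψp t z)
      (periodicPartP_add ha hψ (hKS hz)) (fun t ht => ?_) t
    rw [periodicPartP, norm_mul]
    refine mul_le_mul ?_ (hP z hz t ht) (norm_nonneg _) (Real.exp_pos _).le
    have := norm_exp_mul_div_le ha (κ := -k z) (by simpa using hk z hz) ht
    rwa [show Complex.I * -k z * t / a = -(Complex.I * k z * t / a) by ring] at this
  · rw [norm_pow]
    refine le_max_of_le_right (pow_le_pow_left₀ (norm_nonneg _) ?_ 2)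
    refine norm_le_of_periodic ha (p := fun t => periodicPartM a k ψm t z)
      (periodicPartM_add ha hψ (hKS hz)) (fun t ht => ?_) t
    rw [periodicPartM, norm_mul]
    exact mul_le_mul (norm_exp_mul_div_le ha (hk z hz) ht) (hP' z hz t ht) (norm_nonneg _)
      (Real.exp_pos _).le

end Uniform

/-! ### The entries of the transformation matrix -/

section Entries

variable {a m M ω δ γ : ℝ} {κ κ' : ℂ} {h : ℝ → ℂ}

lemma ImproperConverges.improperIntegral_eq {f : ℝ → ℂ} {x : ℝ} {L : ℂ}
    (hL : Tendsto (fun X : ℝ => ∫ t in x..X, f t) atTop (𝓝 L)) : improperIntegral f x = L :=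
  hL.limUnder_eq

/-- The product rule for `e^{ls} J(s)`, with a bound for the derivative. -/
lemma exists_hasDerivWithinAt_exp_mul {l j : ℂ} {J : ℝ → ℂ} {x C C' w : ℝ}
    (hJ : HasDerivWithinAt J j (Ici 0) x) (hC : ‖Complex.exp (l * x) * J x‖ ≤ C * w)
    (hC' : ‖Complex.exp (l * x) * j‖ ≤ C' * w) :
    ∃ d, HasDerivWithinAt (fun s : ℝ => Complex.exp (l * s) * J s) d (Ici 0) x ∧
      ‖d‖ ≤ (‖l‖ * C + C') * w := by
  have h1 : HasDerivAt (fun s : ℝ => Complex.exp (l * s)) (Complex.exp (l * x) * l) x := by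
    have h2 : HasDerivAt (fun s : ℝ => l * (s : ℂ)) l x := by
      simpa using (Complex.ofRealCLM.hasDerivAt (x := x)).const_mul l
    exact (Complex.hasDerivAt_exp _).comp x h2
  refine ⟨_, h1.hasDerivWithinAt.mul hJ, ?_⟩
  calc _ ≤ ‖l‖ * ‖Complex.exp (l * x) * J x‖ + ‖Complex.exp (l * x) * j‖ := by
        refine (norm_add_le _ _).trans_eq ?_
        rw [mul_comm (Complex.exp (l * x)) l, mul_assoc, norm_mul l]
    _ ≤ ‖l‖ * (C * w) + C' * w := by gcongr
    _ = _ := by ring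

/-- The entry `Q₁₂` up to a constant factor, with `κ = 2k/a`: convergence, and bounds for it and its
derivative. -/
lemma upper_entry (ha : 0 ≤ a) (hm : 0 < m) (hc : Continuous h)
    (hp : ∀ t, h (t + a) = h t) (hM : ∀ t, ‖h t‖ ≤ M) (hκ0 : 0 ≤ κ.im) (hκ1 : κ.im ≤ 1)
    (hκm : ∀ s : ℝ, s = 2 * ω ∨ s = -(2 * ω) →
      m ≤ ‖Complex.exp (Complex.I * (κ + s) * a) - 1‖) (hγ : 0 < γ) {x : ℝ} (hx : 0 ≤ x) :
    ImproperConverges (sineIntegrand ω δ γ h κ) x ∧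
    ‖Complex.exp (-(Complex.I * κ) * x) * improperIntegral (sineIntegrand ω δ γ h κ) x‖ ≤
      4 * (Real.exp a * a / m * M) * weight γ x ∧
    ∃ d, HasDerivWithinAt (fun s : ℝ => Complex.exp (-(Complex.I * κ) * s) *
        improperIntegral (sineIntegrand ω δ γ h κ) s) d (Ici 0) x ∧
      ‖d‖ ≤ (‖κ‖ * (4 * (Real.exp a * a / m * M)) + M) * weight γ x := by
  set f := sineIntegrand ω δ γ h κ with hf
  have hL : ∀ x : ℝ, 0 ≤ x → _ := fun x hx =>
    exists_tendsto_integral_sineIntegrand (δ := δ) ha hm hc hp hM hκ0 hκ1 hκm hγ hx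
  have hexp : ‖Complex.exp (-(Complex.I * κ) * x)‖ = Real.exp (κ.im * x) := by
    rw [show -(Complex.I * κ) = Complex.I * -κ by ring, norm_exp_I_mul_mul]
    simp
  have hcancel : Real.exp (κ.im * x) * Real.exp (-κ.im * x) = 1 := by
    rw [← Real.exp_add]
    simp
  have hb : ‖Complex.exp (-(Complex.I * κ) * x) * improperIntegral f x‖ ≤
      4 * (Real.exp a * a / m * M) * weight γ x := by
    obtain ⟨L, hL, hLn⟩ := hL x hx
    rw [ImproperConverges.improperIntegral_eq hL, norm_mul, hexp]
    refine (mul_le_mul_of_nonneg_left hLn (Real.exp_pos _).le).trans_eq ?_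
    linear_combination 4 * (Real.exp a * a / m * M) * weight γ x * hcancel
  refine ⟨⟨_, (hL x hx).choose_spec.1⟩, hb, ?_⟩
  obtain ⟨L₀, hL₀, -⟩ := hL 0 le_rfl
  have hrep : ∀ s ∈ Ici (0 : ℝ), improperIntegral f s = L₀ - ∫ t in (0 : ℝ)..s, f t := by
    intro s hs
    have hs' : (0 : ℝ) ≤ s := hs
    refine ImproperConverges.improperIntegral_eq ((hL₀.sub_const _).congr' ?_)
    filter_upwards [eventually_ge_atTop 0] with X hX
    exact intervalIntegral.integral_interval_sub_left
      (intervalIntegrable_sineIntegrand hc le_rfl hX)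
      (intervalIntegrable_sineIntegrand hc le_rfl hs')
  have hJ : HasDerivWithinAt (improperIntegral f) (-f x) (Ici 0) x :=
    ((hasDerivAt_integral_sineIntegrand hc hx).const_sub L₀).hasDerivWithinAt.congr hrep
      (hrep x hx)
  have hd := exists_hasDerivWithinAt_exp_mul (C' := M) hJ hb (by
    rw [norm_mul, norm_neg, hexp]
    refine (mul_le_mul_of_nonneg_left (norm_sineIntegrand_le hM hx) (Real.exp_pos _).le).trans_eq ?_
    linear_combination M * weight γ x * hcancel)
  simpa using hd

/-- The entry `Q₂₁` up to a constant factor, with `κ = 2k(z)/a` and the real `κ' = 2k(μ)/a`. The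
sector condition enters as `‖κ - κ'‖ ≤ B Im κ`. -/
lemma exists_lower_entry (ha : 0 ≤ a) (hm : 0 < m) {B : ℝ} (hB : 0 ≤ B) (ω δ : ℝ)
    (hγ : 0 < γ) (hγ1 : γ ≤ 1) :
    ∃ C : ℝ, 0 ≤ C ∧ ∀ (κ κ' : ℂ) (h : ℝ → ℂ) (M : ℝ), Continuous h →
      (∀ t, h (t + a) = h t) → (∀ t, ‖h t‖ ≤ M) → 0 ≤ κ.im → κ.im ≤ 1 → κ'.im = 0 →
      ‖κ - κ'‖ ≤ B * κ.im →
      (∀ s : ℝ, s = 2 * ω ∨ s = -(2 * ω) → m ≤ ‖Complex.exp (Complex.I * (-κ + s) * a) - 1‖) →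
      (∀ s : ℝ, s = 2 * ω ∨ s = -(2 * ω) → m ≤ ‖Complex.exp (Complex.I * (-κ' + s) * a) - 1‖) →
      ∀ x : ℝ, 0 ≤ x → ImproperConverges (sineIntegrand ω δ γ h (-κ')) 0 ∧
      ‖Complex.exp (Complex.I * κ * x) * ((∫ t in (0 : ℝ)..x, sineIntegrand ω δ γ h (-κ) t) -
        improperIntegral (sineIntegrand ω δ γ h (-κ')) 0)‖ ≤ C * M * weight γ x ∧
      ∃ d, HasDerivWithinAt (fun s : ℝ => Complex.exp (Complex.I * κ * s) *
        ((∫ t in (0 : ℝ)..s, sineIntegrand ω δ γ h (-κ) t) -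
          improperIntegral (sineIntegrand ω δ γ h (-κ')) 0)) d (Ici 0) x ∧
        ‖d‖ ≤ (‖κ‖ * (C * M) + M) * weight γ x := by
  obtain ⟨C, hC, hmain⟩ := exists_norm_integral_sineIntegrand_sub_le ha hm hB ω δ hγ hγ1
  refine ⟨C, hC, ?_⟩
  intro κ κ' h M hc hp hM hκ0 hκ1 hκ'0 hκκ hκm hκm' x hx
  obtain ⟨L, hL, hLn⟩ := hmain (-κ) (-κ') h M hc hp hM (by simpa using hκ0) (by simpa using hκ1)
    (by simpa using hκ'0) (by
      rw [← neg_sub', norm_neg, Complex.neg_im, neg_neg]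
      exact hκκ) hκm hκm'
  rw [ImproperConverges.improperIntegral_eq hL]
  have hcancel : Real.exp (-κ.im * x) * Real.exp (κ.im * x) = 1 := by
    rw [← Real.exp_add]
    simp
  have hb : ‖Complex.exp (Complex.I * κ * x) *
      ((∫ t in (0 : ℝ)..x, sineIntegrand ω δ γ h (-κ) t) - L)‖ ≤ C * M * weight γ x := by
    have h1 := hLn x hx
    rw [Complex.neg_im, neg_neg] at h1
    rw [norm_mul, norm_exp_I_mul_mul]
    refine (mul_le_mul_of_nonneg_left h1 (Real.exp_pos _).le).trans_eq ?_
    linear_combination C * M * weight γ x * hcancel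
  refine ⟨⟨L, hL⟩, hb, ?_⟩
  have hJ := ((hasDerivAt_integral_sineIntegrand (ω := ω) (δ := δ) (γ := γ) (κ := -κ) hc
    hx).sub_const L).hasDerivWithinAt (s := Ici 0)
  have hd := exists_hasDerivWithinAt_exp_mul (C' := M) hJ hb (by
    have h1 := norm_sineIntegrand_le (ω := ω) (δ := δ) (γ := γ) (κ := -κ) hM hx
    rw [Complex.neg_im, neg_neg] at h1
    rw [norm_mul, norm_exp_I_mul_mul]
    refine (mul_le_mul_of_nonneg_left h1 (Real.exp_pos _).le).trans_eq ?_
    linear_combination M * weight γ x * hcancel)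
  simpa using hd

lemma integrandP_eq (a ω δ γ : ℝ) (k : ℂ → ℂ) (ψp : ℝ → ℂ → ℂ) (z : ℂ) :
    integrandP a ω δ γ k ψp z =
      sineIntegrand ω δ γ (fun t => periodicPartP a k ψp t z ^ 2) (2 * k z / a) := by
  funext t
  rw [integrandP, sineIntegrand]
  ring_nf

lemma integrandM_eq (a ω δ γ : ℝ) (k : ℂ → ℂ) (ψm : ℝ → ℂ → ℂ) (z w : ℂ) :
    integrandM a ω δ γ k ψm z w =
      sineIntegrand ω δ γ (fun t => periodicPartM a k ψm t z ^ 2) (-(2 * k w / a)) := by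
  funext t
  rw [integrandM, sineIntegrand]
  ring_nf

lemma Q_eq (a c ω δ γ : ℝ) (k : ℂ → ℂ) (ψp ψm : ℝ → ℂ → ℂ) (x : ℝ) (z : ℂ) (μ : ℝ) :
    Q a c ω δ γ k ψp ψm x z μ = ((c : ℂ) / wronskian ψp ψm z) •
      ((Complex.exp (-(Complex.I * (2 * k z / a)) * x) *
          improperIntegral (integrandP a ω δ γ k ψp z) x) • !![(0 : ℂ), 1; 0, 0] +
        (Complex.exp (Complex.I * (2 * k z / a) * x) *
          ((∫ t in (0 : ℝ)..x, integrandM a ω δ γ k ψm z z t) -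
            improperIntegral (integrandM a ω δ γ k ψm z μ) 0)) • !![(0 : ℂ), 0; 1, 0]) := by
  have e1 : -(2 * Complex.I * k z * x / a) = -(Complex.I * (2 * k z / a)) * x := by ring
  have e2 : 2 * Complex.I * k z * x / a = Complex.I * (2 * k z / a) * x := by ring
  rw [Q, e1, e2]
  congr 1
  ext i j
  fin_cases i <;> fin_cases j <;> simp

end Entries

section Nonresonance

variable {q : ℝ → ℝ} {a ω β μ : ℝ} {k : ℂ → ℂ}

/-- The denominators `e^{iκa} - 1`, for the frequencies `κ = ± 2k/a ± 2ω` that occur in the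
integrals, are bounded away from zero on the sector. -/
lemma exists_nonresonance (ha : 0 < a) (hk : ContinuousOn k {z | 0 ≤ z.im})
    (hcomp : IsCompact (sector a ω k β μ)) (hμ : 0 < eps a ω k μ) :
    ∃ m : ℝ, 0 < m ∧ ∀ z ∈ sector a ω k β μ, ∀ s : ℝ, s = 2 * ω ∨ s = -(2 * ω) →
      m ≤ ‖Complex.exp (Complex.I * (2 * k z / a + s) * a) - 1‖ ∧
      m ≤ ‖Complex.exp (Complex.I * (-(2 * k z / a) + s) * a) - 1‖ := by
  have hkS : ContinuousOn k (sector a ω k β μ) := hk.mono fun z hz => hz.1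
  have h1 : ∀ s : ℝ, s = 2 * ω ∨ s = -(2 * ω) → ∃ m : ℝ, 0 < m ∧ ∀ z ∈ sector a ω k β μ,
      m ≤ ‖Complex.exp (Complex.I * (2 * k z / a + s) * a) - 1‖ := fun s hs =>
    exists_norm_lower_bound hcomp
      (f := fun z => Complex.exp (Complex.I * (2 * k z / a + s) * a) - 1)
      (by fun_prop) fun z hz => sub_ne_zero.2 (exp_ne_one_of_mem_sector ha hμ hz.2.1 hs)
  have h2 : ∀ s : ℝ, s = 2 * ω ∨ s = -(2 * ω) → ∃ m : ℝ, 0 < m ∧ ∀ z ∈ sector a ω k β μ,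
      m ≤ ‖Complex.exp (Complex.I * (-(2 * k z / a) + s) * a) - 1‖ := fun s hs =>
    exists_norm_lower_bound hcomp
      (f := fun z => Complex.exp (Complex.I * (-(2 * k z / a) + s) * a) - 1)
      (by fun_prop) fun z hz => by
        have hs' : -s = 2 * ω ∨ -s = -(2 * ω) := by
          rcases hs with rfl | rfl
          · exact Or.inr rfl
          · exact Or.inl (neg_neg _)
        refine sub_ne_zero.2 fun h => exp_ne_one_of_mem_sector ha hμ hz.2.1 hs' ?_
        rw [show Complex.I * (2 * k z / a + (-s : ℝ)) * a =
          -(Complex.I * (-(2 * k z / a) + s) * a) by push_cast; ring, Complex.exp_neg, h, inv_one]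
  obtain ⟨m₁, hm₁, h₁⟩ := h1 (2 * ω) (Or.inl rfl)
  obtain ⟨m₂, hm₂, h₂⟩ := h1 (-(2 * ω)) (Or.inr rfl)
  obtain ⟨m₃, hm₃, h₃⟩ := h2 (2 * ω) (Or.inl rfl)
  obtain ⟨m₄, hm₄, h₄⟩ := h2 (-(2 * ω)) (Or.inr rfl)
  refine ⟨min (min m₁ m₂) (min m₃ m₄), lt_min (lt_min hm₁ hm₂) (lt_min hm₃ hm₄), ?_⟩
  rintro z hz s (rfl | rfl)
  · exact ⟨(min_le_left _ _).trans ((min_le_left _ _).trans (h₁ z hz)),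
      (min_le_right _ _).trans ((min_le_left _ _).trans (h₃ z hz))⟩
  · exact ⟨(min_le_left _ _).trans ((min_le_right _ _).trans (h₂ z hz)),
      (min_le_right _ _).trans ((min_le_right _ _).trans (h₄ z hz))⟩

lemma norm_sub_le_of_mem_sector (him : (k μ).im = 0) {z : ℂ} (hz : z ∈ sector a ω k β μ)
    (h0 : 0 ≤ (k z).im) : ‖k z - k μ‖ ≤ (β + 1) * (k z).im := by
  have h1 := Complex.norm_le_abs_re_add_abs_im (k z - k μ)
  rw [Complex.sub_re, Complex.sub_im, him, sub_zero, abs_of_nonneg h0] at h1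
  linarith [hz.2.2.2.2]

end Nonresonance

end Hill

theorem mainTheorem3
    (q : ℝ → ℝ) (a : ℝ) (ha : 0 < a) (hqper : Function.Periodic q a)
    (hqint : IntervalIntegrable q volume 0 a)
    (c ω δ γ : ℝ) (hγ : γ ∈ Set.Ioc (1 / 2 : ℝ) 1)
    (k : ℂ → ℂ) (hk : Hill.IsQuasimomentum q a k)
    (β : ℝ) (hβ : 0 < β)
    (μ : ℝ) (hμ : μ ∈ Hill.bands q a \ (Hill.bandEdges q a ∪ Hill.criticalPoints q a ω k))
    (ψp ψm : ℝ → ℂ → ℂ)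
    (hψ : Hill.IsBlochPair q a k (Hill.sector a ω k β μ) ψp ψm) :
    ∃ c₁ : ℝ, ∀ x : ℝ, 0 ≤ x → ∀ z ∈ Hill.sector a ω k β μ,
      Hill.ImproperConverges (Hill.integrandP a ω δ γ k ψp z) x ∧
      Hill.ImproperConverges (Hill.integrandM a ω δ γ k ψm z μ) 0 ∧
      DifferentiableWithinAt ℝ (fun s => Hill.Q a c ω δ γ k ψp ψm s z μ) (Set.Ici 0) x ∧
      ‖Hill.Q a c ω δ γ k ψp ψm x z μ‖ < c₁ / (x + 1) ^ γ ∧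
      ‖derivWithin (fun s => Hill.Q a c ω δ γ k ψp ψm s z μ) (Set.Ici 0) x‖
        < c₁ / (x + 1) ^ γ := by
  have hq : ∀ s t, IntervalIntegrable q volume s t :=
    hqper.intervalIntegrable₀ ha.ne' hqint
  have hE : ∀ z : ℂ, 0 < z.im → Hill.CauchySolvable q z := fun z hz =>
    hψ.cauchySolvable hq (Or.inl (Or.inl hz))
  have hμband : μ ∈ Hill.bands q a \ Hill.bandEdges q a :=
    ⟨hμ.1, fun h => hμ.2 (Or.inl h)⟩
  have hkμ := hk.im_eq_zero_of_mem_bands hμ.1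
  have heps : 0 < Hill.eps a ω k μ := Hill.eps_pos ha hkμ
    (hk.re_nonneg_of_mem_bands ha hq hψ hμband) hμ.1 fun h => hμ.2 (Or.inr h)
  have hcomp := hk.isCompact_sector (ω := ω) (μ := μ) ha hq hE hβ
  set S := Hill.sector a ω k β μ with hS
  have hSdom : S ⊆ Hill.blochDomain q a S := fun z hz => Or.inr hz
  have hμS : (μ : ℂ) ∈ S :=
    ⟨by simp, by linarith, by rw [Hill.im_two_mul_div, hkμ]; simp,
      by rw [Hill.im_two_mul_div, hkμ]; simp, by rw [hkμ]; simp⟩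
  -- constants that are uniform on the compact sector
  obtain ⟨M, hM⟩ := Hill.exists_periodicPart_bound ha hq hcomp hSdom hψ fun z hz => by
    obtain ⟨h0, h1⟩ := Hill.im_le_of_mem_sector ha hz
    rwa [abs_of_nonneg h0]
  obtain ⟨mW, hmW, hW⟩ := Hill.exists_norm_lower_bound hcomp (hψ.continuous_wronskian.mono hSdom)
    fun z hz => hψ.wronskian_ne_zero z (hSdom hz)
  obtain ⟨m, hm, hres⟩ := Hill.exists_nonresonance ha hk.continuousOn hcomp heps
  obtain ⟨P, hP⟩ := hcomp.exists_bound_of_continuousOn (f := fun z => 2 * k z / a)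
    (((hk.continuousOn.mono fun z hz => hz.1).const_mul 2).div_const _)
  obtain ⟨C, hC, hlower⟩ := Hill.exists_lower_entry ha.le hm (B := β + 1) (by linarith) ω δ
    (show 0 < γ by linarith [hγ.1]) hγ.2
  have hM0 : 0 ≤ M := (norm_nonneg _).trans (hM μ hμS 0).1
  have hP0 : 0 ≤ P := (norm_nonneg _).trans (hP μ hμS)
  set N := 4 * (Real.exp a * a / m * M) with hN
  have hN0 : 0 ≤ N := by positivity
  set e₁₂ : Matrix (Fin 2) (Fin 2) ℂ := !![(0 : ℂ), 1; 0, 0] with he₁₂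
  set e₂₁ : Matrix (Fin 2) (Fin 2) ℂ := !![(0 : ℂ), 0; 1, 0] with he₂₁
  have hcW : ∀ z ∈ S, ‖(c : ℂ) / Hill.wronskian ψp ψm z‖ ≤ |c| / mW := fun z hz => by
    rw [norm_div, Complex.norm_real, Real.norm_eq_abs]
    have := hW z hz
    gcongr
  have hcomb : ∀ z ∈ S, ∀ (u v : ℂ) (U V w : ℝ), 0 ≤ U → 0 ≤ V → 0 ≤ w → ‖u‖ ≤ U * w →
      ‖v‖ ≤ V * w → ‖((c : ℂ) / Hill.wronskian ψp ψm z) • (u • e₁₂ + v • e₂₁)‖ ≤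
        |c| / mW * (U * ‖e₁₂‖ + V * ‖e₂₁‖) * w := by
    intro z hz u v U V w hU hV hw hu hv
    rw [norm_smul]
    calc _ ≤ |c| / mW * (U * w * ‖e₁₂‖ + V * w * ‖e₂₁‖) := by
          refine mul_le_mul (hcW z hz) ?_ (norm_nonneg _) (by positivity)
          refine (norm_add_le _ _).trans ?_
          rw [norm_smul, norm_smul]
          gcongr
      _ = _ := by ring
  set U := P * N + N + M with hU
  set V := P * (C * M) + C * M + M with hV
  have hU0 : 0 ≤ U := by positivity
  have hV0 : 0 ≤ V := by positivity
  refine ⟨|c| / mW * (U * ‖e₁₂‖ + V * ‖e₂₁‖) + 1, fun x hx z hz => ?_⟩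
  have hzd := hSdom hz
  obtain ⟨him0, him1⟩ := Hill.im_le_of_mem_sector ha hz
  have hκ0 : 0 ≤ (2 * k z / a).im := hz.2.2.1
  have hκ1 : (2 * k z / a).im ≤ 1 := hz.2.2.2.1
  have hκμ : (2 * k μ / a).im = 0 := by
    rw [Hill.im_two_mul_div, hkμ]
    simp
  have hdist : ‖2 * k z / a - 2 * k μ / a‖ ≤ (β + 1) * (2 * k z / a).im := by
    have h1 := Hill.norm_sub_le_of_mem_sector hkμ hz him0
    rw [← sub_div, ← mul_sub, norm_div, norm_mul, Complex.norm_two, Complex.norm_real,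
      Real.norm_eq_abs, abs_of_pos ha, Hill.im_two_mul_div, ← mul_div_assoc]
    rw [div_le_div_iff_of_pos_right ha]
    linarith
  have hw := Hill.weight_pos γ hx
  have hup := Hill.upper_entry (h := fun t => Hill.periodicPartP a k ψp t z ^ 2)
    (κ := 2 * k z / a) (δ := δ) ha.le hm
    ((Hill.continuous_periodicPartP (a := a) (k := k) (hψ.solution_p z hzd).continuous).pow 2)
    (fun t => by simp only [Hill.periodicPartP_add ha hψ hzd]) (fun t => (hM z hz t).1) hκ0 hκ1
    (fun s hs => (hres z hz s hs).1) (show 0 < γ by linarith [hγ.1]) hx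
  have hlow := hlower (2 * k z / a) (2 * k μ / a)
    (fun t => Hill.periodicPartM a k ψm t z ^ 2) M
    ((Hill.continuous_periodicPartM (a := a) (k := k) (hψ.solution_m z hzd).continuous).pow 2)
    (fun t => by simp only [Hill.periodicPartM_add ha hψ hzd]) (fun t => (hM z hz t).2)
    hκ0 hκ1 hκμ hdist (fun s hs => (hres z hz s hs).2) (fun s hs => (hres μ hμS s hs).2) x hx
  rw [← Hill.integrandP_eq] at hup
  simp only [← Hill.integrandM_eq] at hlow
  obtain ⟨hconv, hbd, d, hd, hdb⟩ := hup
  obtain ⟨hconv', hbd', d', hd', hdb'⟩ := hlow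
  have hderiv : HasDerivWithinAt (fun s => Hill.Q a c ω δ γ k ψp ψm s z μ)
      (((c : ℂ) / Hill.wronskian ψp ψm z) • (d • e₁₂ + d' • e₂₁)) (Set.Ici 0) x := by
    simp only [Hill.Q_eq]
    exact ((hd.smul_const e₁₂).add (hd'.smul_const e₂₁)).const_smul
      ((c : ℂ) / Hill.wronskian ψp ψm z)
  have hfin : ∀ A : Matrix (Fin 2) (Fin 2) ℂ,
      ‖A‖ ≤ |c| / mW * (U * ‖e₁₂‖ + V * ‖e₂₁‖) * Hill.weight γ x →
      ‖A‖ < (|c| / mW * (U * ‖e₁₂‖ + V * ‖e₂₁‖) + 1) / (x + 1) ^ γ := by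
    intro A hA
    have h1 : ((x + 1) ^ γ)⁻¹ = Hill.weight γ x := by
      rw [Hill.weight, Real.rpow_neg (by linarith)]
    rw [div_eq_mul_inv, h1]
    linarith
  refine ⟨hconv, hconv', hderiv.differentiableWithinAt, hfin _ ?_, ?_⟩
  · rw [Hill.Q_eq]
    refine hcomb z hz _ _ U V _ hU0 hV0 hw.le (hbd.trans ?_) (hbd'.trans ?_)
    · refine mul_le_mul_of_nonneg_right ?_ hw.le
      have : 0 ≤ P * N := by positivity
      linarith
    · refine mul_le_mul_of_nonneg_right ?_ hw.le
      have : 0 ≤ P * (C * M) := by positivity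
      linarith
  · have hval : derivWithin (fun s => Hill.Q a c ω δ γ k ψp ψm s z μ) (Set.Ici 0) x =
        ((c : ℂ) / Hill.wronskian ψp ψm z) • (d • e₁₂ + d' • e₂₁) :=
      hderiv.derivWithin ((uniqueDiffOn_Ici 0) x hx)
    rw [hval]
    refine hfin _ (hcomb z hz _ _ U V _ hU0 hV0 hw.le (hdb.trans ?_) (hdb'.trans ?_))
    · refine mul_le_mul_of_nonneg_right ?_ hw.le
      have : ‖2 * k z / a‖ * N ≤ P * N := mul_le_mul_of_nonneg_right (hP z hz) hN0
      linarith
    · refine mul_le_mul_of_nonneg_right ?_ hw.le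
      have : ‖2 * k z / a‖ * (C * M) ≤ P * (C * M) :=
        mul_le_mul_of_nonneg_right (hP z hz) (by positivity)
      have : 0 ≤ C * M := by positivity
      linarith
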